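/- Let $q:\mathbb{R}\to\mathbb{C}$ be $1$-periodic and Lebesgue integrable on $[0,1]$, and let $H$ be the Hill operator generated in $L_2(\mathbb{R})$ by $-y''+qy$. For $t\in\mathbb{R}$ let $H_t$ be the operator generated in $L_2[0,1]$ by $-y''+qy$ and the boundary conditions $y(1)=e^{it}y(0)$, $y'(1)=e^{it}y'(0)$; the spectrum of $H$ is the union of the spectra of the $H_t$, $t\in[0,2\pi)$, and the spectrum of $H_t$ consists of eigenvalues, which are the roots of $F(\lambda)=2\cos t$. Here $F(\lambda)=\varphi'(1,\lambda)+\theta(1,\lambda)$ is the Hill discriminant, $\theta,\varphi$ being the solutions of $-y''+qy=\lambda y$ with $\theta(0)=\varphi'(0)=1$, $\theta'(0)=\varphi(0)=0$. The multiplicity of an eigenvalue of $H_t$ is its multiplicity as a root of $F(\lambda)=2\cos t$ (simple: multiplicity $1$; multiple: multiplicity at least $2$); its geometric multiplicity is the dimension of the space of eigenfunctions. A point $\lambda_0\in\sigma(H)$ is a *spectral singularity* of $H$ if for every $\varepsilon>0$ the spectral projections of the operators $H_t$, $t\in[0,2\pi)$, corresponding to simple eigenvalues lying in $\{|z-\lambda_0|<\varepsilon\}$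 are not uniformly bounded. It is an *essential spectral singularity* (ESS) of $H$ if there are $t_0\in(-\pi,\pi]$ with $\lambda_0\in\sigma(H_{t_0})$, a number $\delta>0$ and a continuous branch $\mu(t)$ of simple eigenvalues of $H_t$, defined for $0<|t-t_0|<\delta$, such that $\mu(t)\to\lambda_0$ as $t\to t_0$ and $$\int_{0<|t-t_0|<\delta'}\frac{dt}{|\alpha(t)|}=\infty\quad\text{for every }\delta'\in(0,\delta],$$ where $\alpha(t)=(\Psi_t^*,\Psi_t)$ and $\Psi_t$, $\Psi_t^*$ are normalized eigenfunctions of $H_t$ and of its adjoint $H_t^*$ for the eigenvalues $\mu(t)$ and $\overline{\mu(t)}$. **Theorem.** Let $t_0=0$ or $t_0=\pi$. The eigenvalues of $H_{t_0}$, counted with multiplicity, can be numbered by the integers, and for every such numbering $\{\lambda_k(t_0)\}_{k\in\mathbb{Z}}$ there is a number $N$ such that for all $|k|>N$ for which $\lambda_k(t_0)$ is a multiple eigenvalue of $H_{t_0}$ the following holds: $\lambda_k(t_0)$ is a spectral singularity of $H$ if and only if its geometric multiplicity is $1$, and $\lambda_k(t_0)$ is an ESS of $H$ if and only if its geometric multiplicity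 is $1$. -/

import Mathlib

open MeasureTheory Set Filter Topology

namespace Hill

/-- The Hilbert space `L₂[0,1]` of complex-valued functions. -/
abbrev L2 : Type := Lp ℂ 2 (volume.restrict (Icc (0 : ℝ) 1))

/-- `y` solves `-y'' + q y = f` on `[0,1]` in the Carathéodory sense, with `dy = y'`:
`y` and `y'` are absolutely continuous on `[0,1]` and the equation holds almost everywhere
(written in the equivalent integrated form). -/
structure Solves (q f y dy : ℝ → ℂ) : Prop where
  cont : ContinuousOn y (Icc 0 1)
  cont_deriv : ContinuousOn dy (Icc 0 1)
  integrable : IntegrableOn (fun s => q s * y s - f s) (Icc 0 1)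
  eq_integral : ∀ x ∈ Icc (0 : ℝ) 1, y x = y 0 + ∫ s in (0 : ℝ)..x, dy s
  deriv_eq_integral : ∀ x ∈ Icc (0 : ℝ) 1,
    dy x = dy 0 + ∫ s in (0 : ℝ)..x, (q s * y s - f s)

/-- `(u, f)` belongs to the graph of the operator `H_t` generated in `L₂[0,1]` by
`-y'' + q y` and the boundary conditions `y(1) = e^{it} y(0)`, `y'(1) = e^{it} y'(0)`. -/
def InGraph (q : ℝ → ℂ) (t : ℝ) (u f : L2) : Prop :=
  ∃ y dy : ℝ → ℂ, (u : ℝ → ℂ) =ᵐ[volume.restrict (Icc (0 : ℝ) 1)] y ∧ Solves q f y dy ∧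
    y 1 = Complex.exp (Complex.I * t) * y 0 ∧ dy 1 = Complex.exp (Complex.I * t) * dy 0

lemma intervalIntegrable_of_Icc {g : ℝ → ℂ} (hg : IntegrableOn g (Icc 0 1)) {x : ℝ}
    (hx : x ∈ Icc (0 : ℝ) 1) : IntervalIntegrable g volume 0 x := by
  rw [intervalIntegrable_iff_integrableOn_Icc_of_le hx.1]
  exact hg.mono_set (Icc_subset_Icc le_rfl hx.2)

lemma Solves.congr_right {q f g y dy : ℝ → ℂ} (h : Solves q f y dy)
    (hfg : f =ᵐ[volume.restrict (Icc (0 : ℝ) 1)] g) : Solves q g y dy := by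
  have hae : (fun s => q s * y s - f s) =ᵐ[volume.restrict (Icc (0 : ℝ) 1)]
      fun s => q s * y s - g s := by
    filter_upwards [hfg] with s hs
    rw [hs]
  refine ⟨h.cont, h.cont_deriv, h.integrable.congr hae, h.eq_integral, fun x hx => ?_⟩
  rw [h.deriv_eq_integral x hx]
  congr 1
  refine intervalIntegral.integral_congr_ae_restrict ?_
  refine ae_restrict_of_ae_restrict_of_subset ?_ hae
  rw [uIoc_of_le hx.1]
  exact (Ioc_subset_Icc_self).trans (Icc_subset_Icc le_rfl hx.2)

lemma Solves.add {q f g y dy z dz : ℝ → ℂ} (h : Solves q f y dy) (h' : Solves q g z dz) :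
    Solves q (f + g) (y + z) (dy + dz) := by
  have e : (fun s => q s * (y + z) s - (f + g) s) =
      fun s => (q s * y s - f s) + (q s * z s - g s) := by
    funext s; simp only [Pi.add_apply]; ring
  refine ⟨h.cont.add h'.cont, h.cont_deriv.add h'.cont_deriv, ?_, fun x hx => ?_, fun x hx => ?_⟩
  · rw [e]; exact h.integrable.add h'.integrable
  · simp only [Pi.add_apply]
    rw [intervalIntegral.integral_add
      (intervalIntegrable_of_Icc (h.cont_deriv.integrableOn_compact isCompact_Icc) hx)
      (intervalIntegrable_of_Icc (h'.cont_deriv.integrableOn_compact isCompact_Icc) hx),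
      h.eq_integral x hx, h'.eq_integral x hx]
    ring
  · rw [e, intervalIntegral.integral_add (intervalIntegrable_of_Icc h.integrable hx)
      (intervalIntegrable_of_Icc h'.integrable hx)]
    simp only [Pi.add_apply]
    rw [h.deriv_eq_integral x hx, h'.deriv_eq_integral x hx]
    ring

lemma Solves.smul {q f y dy : ℝ → ℂ} (c : ℂ) (h : Solves q f y dy) :
    Solves q (c • f) (c • y) (c • dy) := by
  have e : (fun s => q s * (c • y) s - (c • f) s) = fun s => c * (q s * y s - f s) := by
    funext s; simp only [Pi.smul_apply, smul_eq_mul]; ring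
  refine ⟨h.cont.const_smul c, h.cont_deriv.const_smul c, ?_, fun x hx => ?_, fun x hx => ?_⟩
  · rw [e]; exact h.integrable.const_mul c
  · simp only [Pi.smul_apply, smul_eq_mul]
    rw [intervalIntegral.integral_const_mul, h.eq_integral x hx]
    ring
  · rw [e, intervalIntegral.integral_const_mul]
    simp only [Pi.smul_apply, smul_eq_mul]
    rw [h.deriv_eq_integral x hx]
    ring

/-- The graph of the operator `H_t`, as a subspace of `L₂[0,1] × L₂[0,1]`. -/
def graph (q : ℝ → ℂ) (t : ℝ) : Submodule ℂ (L2 × L2) where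
  carrier := {p | InGraph q t p.1 p.2}
  zero_mem' := by
    have h : Solves q 0 0 0 :=
      ⟨continuousOn_const, continuousOn_const, by simp, by simp, by simp⟩
    exact ⟨0, 0, Lp.coeFn_zero _ _ _, h.congr_right (Lp.coeFn_zero ℂ 2 _).symm, by simp, by simp⟩
  add_mem' := by
    rintro ⟨u, f⟩ ⟨v, g⟩ ⟨y, dy, hu, hy, b1, b2⟩ ⟨z, dz, hv, hz, c1, c2⟩
    refine ⟨y + z, dy + dz, (Lp.coeFn_add u v).trans (hu.add hv),
      (hy.add hz).congr_right (Lp.coeFn_add f g).symm, ?_, ?_⟩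
    · simp only [Pi.add_apply]; rw [b1, c1]; ring
    · simp only [Pi.add_apply]; rw [b2, c2]; ring
  smul_mem' := by
    rintro c ⟨u, f⟩ ⟨y, dy, hu, hy, b1, b2⟩
    refine ⟨c • y, c • dy, (Lp.coeFn_smul c u).trans (hu.const_smul c),
      (hy.smul c).congr_right (Lp.coeFn_smul c f).symm, ?_, ?_⟩
    · simp only [Pi.smul_apply, smul_eq_mul]; rw [b1]; ring
    · simp only [Pi.smul_apply, smul_eq_mul]; rw [b2]; ring

/-- The kernel of `T - μ` for an operator `T` in `L₂[0,1]` with graph `G`. -/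
noncomputable def eigenspace (G : Submodule ℂ (L2 × L2)) (μ : ℂ) : Submodule ℂ L2 :=
  G.comap (LinearMap.prod LinearMap.id (μ • LinearMap.id))

/-- The range of `T - μ` for an operator `T` in `L₂[0,1]` with graph `G`. -/
noncomputable def rangeSub (G : Submodule ℂ (L2 × L2)) (μ : ℂ) : Submodule ℂ L2 :=
  G.map (LinearMap.snd ℂ L2 L2 - μ • LinearMap.fst ℂ L2 L2)

/-- `μ` is an eigenvalue of `H_t`. As `H_t` has compact resolvent, the spectrum `σ(H_t)` is the
set of its eigenvalues. -/
def IsEigenvalue (q : ℝ → ℂ) (t : ℝ) (μ : ℂ) : Prop :=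
  eigenspace (graph q t) μ ≠ ⊥

/-- The geometric multiplicity of `μ` as an eigenvalue of `H_t`. -/
noncomputable def geomMult (q : ℝ → ℂ) (t : ℝ) (μ : ℂ) : ℕ :=
  Module.finrank ℂ (eigenspace (graph q t) μ)

/-- The solution of `-y'' + q y = μ y` on `[0,1]` with `y(0) = a`, `y'(0) = b`, paired with its
derivative. For `q` integrable on `[0,1]` it exists and is unique on `[0,1]`. -/
noncomputable def cauchySol (q : ℝ → ℂ) (μ a b : ℂ) : (ℝ → ℂ) × (ℝ → ℂ) :=
  Classical.epsilon fun p => Solves q (μ • p.1) p.1 p.2 ∧ p.1 0 = a ∧ p.2 0 = b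

/-- The Hill discriminant `F(μ) = φ'(1,μ) + θ(1,μ)`, where `θ, φ` are the solutions of
`-y'' + q y = μ y` with `θ(0) = φ'(0) = 1`, `θ'(0) = φ(0) = 0`. -/
noncomputable def discriminant (q : ℝ → ℂ) (μ : ℂ) : ℂ :=
  (cauchySol q μ 0 1).2 1 + (cauchySol q μ 1 0).1 1

/-- The (algebraic) multiplicity of `μ` as an eigenvalue of `H_t`, that is, its multiplicity as a
root of the characteristic equation `F(μ) = 2 cos t`. -/
noncomputable def algMult (q : ℝ → ℂ) (t : ℝ) (μ : ℂ) : ℕ∞ :=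
  analyticOrderAt (fun z => discriminant q z - 2 * (Real.cos t : ℂ)) μ

/-- `μ` is a simple eigenvalue of `H_t`. -/
def IsSimpleEigenvalue (q : ℝ → ℂ) (t : ℝ) (μ : ℂ) : Prop :=
  IsEigenvalue q t μ ∧ algMult q t μ = 1

/-- `μ` is a multiple eigenvalue of `H_t`. -/
def IsMultipleEigenvalue (q : ℝ → ℂ) (t : ℝ) (μ : ℂ) : Prop :=
  IsEigenvalue q t μ ∧ 2 ≤ algMult q t μ

/-- `lam` is a numbering, by the integers and counting multiplicity, of all eigenvalues
of `H_t`. -/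
def IsNumbering (q : ℝ → ℂ) (t : ℝ) (lam : ℤ → ℂ) : Prop :=
  (∀ k, IsEigenvalue q t (lam k)) ∧ ∀ μ, {k : ℤ | lam k = μ}.encard = algMult q t μ

/-- `P` is the spectral projection of `H_t` corresponding to a simple eigenvalue `μ`:
the bounded projection onto the eigenspace along the range of `H_t - μ`. -/
structure IsSpectralProjection (q : ℝ → ℂ) (t : ℝ) (μ : ℂ) (P : L2 →L[ℂ] L2) : Prop where
  idem : IsIdempotentElem P
  range_eq : LinearMap.range (P : L2 →ₗ[ℂ] L2) = eigenspace (graph q t) μ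
  ker_eq : LinearMap.ker (P : L2 →ₗ[ℂ] L2) = rangeSub (graph q t) μ

/-- The spectrum of the Hill operator `H`, the union of the spectra of `H_t`, `t ∈ [0, 2π)`. -/
def hillSpectrum (q : ℝ → ℂ) : Set ℂ :=
  {μ | ∃ t ∈ Ico (0 : ℝ) (2 * Real.pi), IsEigenvalue q t μ}

/-- `lam₀` is a spectral singularity of `H`: for every `ε > 0` the spectral projections of the
operators `H_t`, `t ∈ [0, 2π)`, corresponding to simple eigenvalues in the `ε`-neighbourhood of
`lam₀` are not uniformly bounded. -/
def IsSpectralSingularity (q : ℝ → ℂ) (lam₀ : ℂ) : Prop :=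
  lam₀ ∈ hillSpectrum q ∧
    ∀ ε > 0, ∀ M : ℝ, ∃ t ∈ Ico (0 : ℝ) (2 * Real.pi), ∃ μ ∈ Metric.ball lam₀ ε,
      IsSimpleEigenvalue q t μ ∧ ∃ P, IsSpectralProjection q t μ P ∧ M < ‖P‖

/-- The punctured interval `(t₀ - δ, t₀) ∪ (t₀, t₀ + δ)`. -/
def puncturedInterval (t₀ δ : ℝ) : Set ℝ := Ioo (t₀ - δ) t₀ ∪ Ioo t₀ (t₀ + δ)

/-- `lam₀` is an essential spectral singularity (ESS) of `H`: for some quasimomentum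
`t₀ ∈ (-π, π]` with `lam₀ ∈ σ(H_{t₀})` there is a continuous branch `μ(t)` of simple eigenvalues
of `H_t` on a punctured neighbourhood of `t₀`, tending to `lam₀` as `t → t₀`, such that
`1 / |α(t)|` is not integrable over any punctured neighbourhood of `t₀`.
Here `α(t) = (Ψ*_t, Ψ_t)`, where `Ψ_t` and `Ψ*_t` are normalized eigenfunctions of `H_t` and of
the adjoint `H_t*` for the eigenvalues `μ(t)` and `conj μ(t)`; `|α(t)|` does not depend on the
choice of these functions. -/
def IsESS (q : ℝ → ℂ) (lam₀ : ℂ) : Prop :=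
  ∃ t₀ ∈ Ioc (-Real.pi) Real.pi, IsEigenvalue q t₀ lam₀ ∧
    ∃ δ > 0, ∃ (μ : ℝ → ℂ) (Ψ Ψs : ℝ → L2),
      ContinuousOn μ (puncturedInterval t₀ δ) ∧
      (∀ t ∈ puncturedInterval t₀ δ,
        IsSimpleEigenvalue q t (μ t) ∧
        Ψ t ∈ eigenspace (graph q t) (μ t) ∧ ‖Ψ t‖ = 1 ∧
        Ψs t ∈ eigenspace (graph q t).adjoint (starRingEnd ℂ (μ t)) ∧ ‖Ψs t‖ = 1) ∧
      Tendsto μ (𝓝[≠] t₀) (𝓝 lam₀) ∧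
      ∀ δ' ∈ Ioc 0 δ, ∫⁻ t in puncturedInterval t₀ δ', ‖inner ℂ (Ψs t) (Ψ t)‖ₑ⁻¹ = ⊤

end Hill

/-!
Write `[v, w]` for the symplectic form on Cauchy data, which the monodromy operator `M(μ)`
preserves. When `sin t ≠ 0`, a root `μ` of `F = 2 cos t` has monodromy eigenvectors `v`, `w` with
multipliers `e^{it}`, `e^{-it}`. The corresponding solutions `ψ_v` and `conj ψ_w` span the
eigenspaces of `H_t` and `H_t*`, so that `|α| = |∫ ψ_w ψ_v| / (‖ψ_w‖ ‖ψ_v‖)` is the reciprocal of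
the norm of the spectral projection, and `F'(μ) [v, w] = 2i sin t ∫ ψ_w ψ_v`.

Since `F(λ)` is close to `2 cos √λ` for large `|λ|`, the functions `F'` and `F''` have no common
zero there, so a large multiple eigenvalue `lam₀` is a double root. Near it `|F'(μ)|` is comparable
to `|sin t|`, hence `|α|` is comparable to `|[v, w]| / (‖v‖ ‖w‖)`, which measures the angle between
`v` and `w`. If `M(lam₀)` is the scalar `e^{i t₀}`, then `M(μ) - e^{i t₀} = O(μ - lam₀) = O(sin t)`,
while the multipliers of `M(μ)` differ by `2i sin t`: the angle stays away from zero. Otherwise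
`M(lam₀)` is a Jordan block and `v`, `w` merge at the rate `|t - t₀|`, so that `1 / |α|` is
unbounded and not integrable.
-/

open scoped Asymptotics

namespace Hill

/-- `u` is an absolutely continuous primitive of the integrable function `f` on the interval with
endpoints `a` and `b`, in integrated form. -/
structure IsPrimitiveOn {E : Type*} [NormedAddCommGroup E] [NormedSpace ℝ E]
    (f u : ℝ → E) (a b : ℝ) : Prop where
  intervalIntegrable : IntervalIntegrable f volume a b
  eq_integral : ∀ x ∈ uIcc a b, u x = u a + ∫ s in a..x, f s

namespace IsPrimitiveOn

section NormedSpace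

variable {E : Type*} [NormedAddCommGroup E] [NormedSpace ℝ E] {f g u v : ℝ → E} {a b : ℝ}

lemma intervalIntegrable_left (h : IsPrimitiveOn f u a b) {x : ℝ} (hx : x ∈ uIcc a b) :
    IntervalIntegrable f volume a x :=
  h.intervalIntegrable.mono_set (uIcc_subset_uIcc left_mem_uIcc hx)

lemma integral_eq_sub (h : IsPrimitiveOn f u a b) : ∫ s in a..b, f s = u b - u a := by
  rw [h.eq_integral b right_mem_uIcc, add_sub_cancel_left]

lemma of_hasDerivAt [CompleteSpace E] (hu : ∀ x ∈ uIcc a b, HasDerivAt u (f x) x)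
    (hf : IntervalIntegrable f volume a b) : IsPrimitiveOn f u a b := by
  refine ⟨hf, fun x hx => ?_⟩
  rw [intervalIntegral.integral_eq_sub_of_hasDerivAt
    (fun y hy => hu y (uIcc_subset_uIcc left_mem_uIcc hx hy))
    (hf.mono_set (uIcc_subset_uIcc left_mem_uIcc hx)), add_sub_cancel]

lemma integral (hf : IntervalIntegrable f volume a b) :
    IsPrimitiveOn f (fun x => ∫ s in a..x, f s) a b :=
  ⟨hf, fun x _ => by rw [intervalIntegral.integral_same, zero_add]⟩

lemma sub (hu : IsPrimitiveOn f u a b) (hv : IsPrimitiveOn g v a b) :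
    IsPrimitiveOn (fun s => f s - g s) (fun s => u s - v s) a b := by
  refine ⟨hu.intervalIntegrable.sub hv.intervalIntegrable, fun x hx => ?_⟩
  rw [intervalIntegral.integral_sub (hu.intervalIntegrable_left hx)
    (hv.intervalIntegrable_left hx), hu.eq_integral x hx, hv.eq_integral x hx]
  abel

lemma clm_comp {F : Type*} [NormedAddCommGroup F] [NormedSpace ℝ F] [CompleteSpace E]
    [CompleteSpace F] (L : E →L[ℝ] F) (h : IsPrimitiveOn f u a b) :
    IsPrimitiveOn (fun s => L (f s)) (fun s => L (u s)) a b := by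
  refine ⟨⟨L.integrable_comp h.intervalIntegrable.1, L.integrable_comp h.intervalIntegrable.2⟩,
    fun x hx => ?_⟩
  rw [L.intervalIntegral_comp_comm (h.intervalIntegrable_left hx), ← map_add, h.eq_integral x hx]

lemma prodMk {F : Type*} [NormedAddCommGroup F] [NormedSpace ℝ F] [CompleteSpace E]
    [CompleteSpace F] {g v : ℝ → F} (hu : IsPrimitiveOn f u a b) (hv : IsPrimitiveOn g v a b) :
    IsPrimitiveOn (fun s => (f s, g s)) (fun s => (u s, v s)) a b := by
  have hi : ∀ x ∈ uIcc a b, IntervalIntegrable (fun s => (f s, g s)) volume a x := fun x hx =>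
    ⟨(hu.intervalIntegrable_left hx).1.prodMk (hv.intervalIntegrable_left hx).1,
      (hu.intervalIntegrable_left hx).2.prodMk (hv.intervalIntegrable_left hx).2⟩
  refine ⟨hi b right_mem_uIcc, fun x hx => Prod.ext ?_ ?_⟩
  · exact (hu.eq_integral x hx).trans (congrArg (u a + ·)
      ((ContinuousLinearMap.fst ℝ E F).intervalIntegral_comp_comm (hi x hx)))
  · exact (hv.eq_integral x hx).trans (congrArg (v a + ·)
      ((ContinuousLinearMap.snd ℝ E F).intervalIntegral_comp_comm (hi x hx)))

lemma absolutelyContinuousOnInterval (h : IsPrimitiveOn f u a b) :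
    AbsolutelyContinuousOnInterval u a b := by
  have hac := h.intervalIntegrable.norm.absolutelyContinuousOnInterval_intervalIntegral
    (c := a) left_mem_uIcc
  rw [absolutelyContinuousOnInterval_iff] at hac ⊢
  intro ε hε
  obtain ⟨δ, hδ, H⟩ := hac ε hε
  refine ⟨δ, hδ, fun J hJ hJδ => lt_of_le_of_lt (Finset.sum_le_sum fun i hi => ?_) (H J hJ hJδ)⟩
  obtain ⟨h₁, h₂⟩ := hJ.1 i hi
  have i₁ := h.intervalIntegrable_left h₁
  have i₂ := h.intervalIntegrable_left h₂
  rw [dist_eq_norm, dist_eq_norm, h.eq_integral _ h₁, h.eq_integral _ h₂, add_sub_add_left_eq_sub,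
    intervalIntegral.integral_interval_sub_left i₁ i₂,
    intervalIntegral.integral_interval_sub_left i₁.norm i₂.norm]
  exact intervalIntegral.norm_integral_le_abs_integral_norm

lemma continuousOn (h : IsPrimitiveOn f u a b) : ContinuousOn u (uIcc a b) :=
  h.absolutelyContinuousOnInterval.continuousOn

end NormedSpace

variable {𝕜 : Type*} [RCLike 𝕜] {f g u v : ℝ → 𝕜} {a b : ℝ}

lemma mul (hu : IsPrimitiveOn f u a b) (hv : IsPrimitiveOn g v a b) :
    IsPrimitiveOn (fun s => f s * v s + u s * g s) (fun s => u s * v s) a b := by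
  have hI : IntervalIntegrable (fun s => f s * v s + u s * g s) volume a b :=
    (hu.intervalIntegrable.mul_continuousOn hv.continuousOn).add
      (hv.intervalIntegrable.continuousOn_mul hu.continuousOn)
  refine ⟨hI, fun x hx => ?_⟩
  set U : ℝ → 𝕜 := fun x => u a + ∫ s in a..x, f s with hU
  set V : ℝ → 𝕜 := fun x => v a + ∫ s in a..x, g s with hV
  set W : ℝ → 𝕜 := fun x => ∫ s in a..x, (f s * v s + u s * g s) with hW
  have hD : ∀ᵐ x, x ∈ uIcc a b → HasDerivAt (fun x => U x * V x - W x) 0 x := by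
    filter_upwards [hu.intervalIntegrable.ae_hasDerivAt_integral,
      hv.intervalIntegrable.ae_hasDerivAt_integral, hI.ae_hasDerivAt_integral]
      with x dU dV dW hx
    have d := (((dU hx a left_mem_uIcc).const_add (u a)).mul
      ((dV hx a left_mem_uIcc).const_add (v a))).sub (dW hx a left_mem_uIcc)
    rwa [← hu.eq_integral x hx, ← hv.eq_integral x hx, sub_self] at d
  have hac : AbsolutelyContinuousOnInterval (fun x => U x * V x - W x) a b := by
    have hconst (c : 𝕜) : AbsolutelyContinuousOnInterval (fun _ : ℝ => c) a b :=
      contDiff_const.contDiffOn.absolutelyContinuousOnInterval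
    have hUac := (hconst (u a)).fun_add
      (integral hu.intervalIntegrable).absolutelyContinuousOnInterval
    have hVac := (hconst (v a)).fun_add
      (integral hv.intervalIntegrable).absolutelyContinuousOnInterval
    exact (hUac.fun_smul hVac).fun_sub (integral hI).absolutelyContinuousOnInterval
  obtain ⟨C, hC⟩ := hac.const_of_ae_hasDerivAt_zero hD
  have hx' := hC x hx
  have ha := hC a left_mem_uIcc
  simp only [hU, hV, hW, ← hu.eq_integral x hx, ← hv.eq_integral x hx,
    intervalIntegral.integral_same, add_zero, sub_zero] at hx' ha
  rw [ha, ← hx', sub_add_cancel]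

lemma pow (hu : IsPrimitiveOn f u a b) (n : ℕ) :
    IsPrimitiveOn (fun s => (n + 1) * u s ^ n * f s) (fun s => u s ^ (n + 1)) a b := by
  induction n with
  | zero => simpa using hu
  | succ n ih =>
    have e : (fun s => ((n + 1 : ℕ) + 1) * u s ^ (n + 1) * f s) =
        fun s => (n + 1) * u s ^ n * f s * u s + u s ^ (n + 1) * f s := by
      funext s
      push_cast
      ring
    simpa only [e, pow_succ (_ : 𝕜) (n + 1)] using ih.mul hu

end IsPrimitiveOn

section Green

variable {q f g y dy z dz : ℝ → ℂ}

lemma solves_iff_isPrimitiveOn : Solves q f y dy ↔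
    IsPrimitiveOn dy y 0 1 ∧ IsPrimitiveOn (fun s => q s * y s - f s) dy 0 1 := by
  have hI : Icc (0 : ℝ) 1 = uIcc 0 1 := (uIcc_of_le zero_le_one).symm
  constructor
  · rintro ⟨-, hdy, hint, h, h'⟩
    rw [hI] at hdy h h'
    exact ⟨⟨hdy.intervalIntegrable, h⟩, ⟨intervalIntegrable_of_Icc hint ⟨zero_le_one, le_rfl⟩, h'⟩⟩
  · rintro ⟨h, h'⟩
    refine ⟨hI ▸ h.continuousOn, hI ▸ h'.continuousOn, ?_, hI ▸ h.eq_integral, hI ▸ h'.eq_integral⟩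
    exact (intervalIntegrable_iff_integrableOn_Icc_of_le zero_le_one).1 h'.intervalIntegrable

lemma Solves.green (h : Solves q f y dy) (h' : Solves q g z dz) :
    ∫ s in (0 : ℝ)..1, (y s * g s - f s * z s) =
      (dy 1 * z 1 - y 1 * dz 1) - (dy 0 * z 0 - y 0 * dz 0) := by
  obtain ⟨hy, hdy⟩ := solves_iff_isPrimitiveOn.1 h
  obtain ⟨hz, hdz⟩ := solves_iff_isPrimitiveOn.1 h'
  rw [← ((hdy.mul hz).sub (hy.mul hdz)).integral_eq_sub]
  congr 1
  funext s
  ring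

end Green

lemma differentiable_inverse_one_sub_add_smul {A : Type*} [NormedRing A] [NormedAlgebra ℂ A]
    [HasSummableGeomSeries A] {a b : A} (h : ∀ c : ℂ, IsUnit (1 - (a + c • b))) :
    Differentiable ℂ fun c : ℂ => Ring.inverse (1 - (a + c • b)) := fun c => by
  have hd : DifferentiableAt ℂ (fun c : ℂ => 1 - (a + c • b)) c := by fun_prop
  exact (differentiableAt_inverse (h c)).comp c hd

lemma isUnit_one_sub_of_norm_pow_lt_one {A : Type*} [NormedRing A] [HasSummableGeomSeries A]
    {a : A} {n : ℕ} (h : ‖a ^ n‖ < 1) : IsUnit (1 - a) := by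
  have hc : Commute (1 - a) (∑ i ∈ Finset.range n, a ^ i) :=
    Commute.sum_right _ _ _ fun i _ => (Commute.one_left _).sub_left (Commute.self_pow a i)
  refine (hc.isUnit_mul_iff.1 ?_).1
  rw [mul_neg_geom_sum]
  exact isUnit_one_sub_of_norm_lt_one h

lemma IsPrimitiveOn.integral_pow_mul {f u : ℝ → ℝ} {a b : ℝ} (hu : IsPrimitiveOn f u a b)
    (ha : u a = 0) (n : ℕ) : ∫ s in a..b, u s ^ n * f s = u b ^ (n + 1) / (n + 1) := by
  have h := (hu.pow n).integral_eq_sub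
  simp only [ha, mul_assoc, intervalIntegral.integral_const_mul, ne_eq, n.succ_ne_zero,
    not_false_eq_true, zero_pow, sub_zero] at h
  rw [← h, mul_div_cancel_left₀ _ n.cast_add_one_ne_zero]

section LinearSystem

variable {E : Type*} [NormedAddCommGroup E]

/-- The extension of a continuous function on `[0,1]` to the line by constants, the form in which
it is integrated. -/
noncomputable def extend (Y : C(unitInterval, E)) : ℝ → E := IccExtend zero_le_one Y

lemma continuous_extend (Y : C(unitInterval, E)) : Continuous (extend Y) :=
  Y.continuous.Icc_extend'

lemma extend_apply (Y : C(unitInterval, E)) {x : ℝ} (hx : x ∈ Icc (0 : ℝ) 1) :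
    extend Y x = Y ⟨x, hx⟩ :=
  IccExtend_of_mem _ _ hx

lemma norm_extend_le (Y : C(unitInterval, E)) (x : ℝ) : ‖extend Y x‖ ≤ ‖Y‖ :=
  Y.norm_coe_le_norm _

variable [NormedSpace ℂ E] {A B : ℝ → E →L[ℂ] E}

lemma intervalIntegrable_clm_extend (hA : IntervalIntegrable A volume 0 1)
    (Y : C(unitInterval, E)) {x : ℝ} (hx : x ∈ Icc (0 : ℝ) 1) :
    IntervalIntegrable (fun s => A s (extend Y s)) volume 0 x := by
  have hA' : IntervalIntegrable A volume 0 x :=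
    hA.mono_set (uIcc_subset_uIcc left_mem_uIcc (by rwa [uIcc_of_le zero_le_one]))
  refine (hA'.norm.mul_const ‖Y‖).mono_fun ?_ (Eventually.of_forall fun s => ?_)
  · exact (ContinuousLinearMap.id ℂ (E →L[ℂ] E)).aestronglyMeasurable_comp₂
      hA'.aestronglyMeasurable_restrict_uIoc (continuous_extend Y).aestronglyMeasurable
  · simp only [norm_mul, norm_norm]
    exact (A s).le_opNorm_of_le (norm_extend_le Y s)

/-- The primitive of an integrable function that vanishes at `0`, as a continuous function. -/
noncomputable def primitive (g : ℝ → E) (hg : IntervalIntegrable g volume 0 1) :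
    C(unitInterval, E) where
  toFun x := ∫ s in (0 : ℝ)..x, g s
  continuous_toFun := by
    have h := (IsPrimitiveOn.integral hg).continuousOn
    rw [uIcc_of_le zero_le_one] at h
    exact h.domRestrict

/-- `∫₀ˣ ‖A‖`, which controls the iterates of the Volterra operator with kernel `A`. -/
noncomputable def mass (A : ℝ → E →L[ℂ] E) (x : ℝ) : ℝ := ∫ s in (0 : ℝ)..x, ‖A s‖

lemma mass_nonneg {x : ℝ} (hx : 0 ≤ x) : 0 ≤ mass A x :=
  intervalIntegral.integral_nonneg hx fun _ _ => norm_nonneg _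

lemma isPrimitiveOn_mass (hA : IntervalIntegrable A volume 0 1) {x : ℝ}
    (hx : x ∈ Icc (0 : ℝ) 1) : IsPrimitiveOn (fun s => ‖A s‖) (mass A) 0 x :=
  .integral (hA.mono_set (uIcc_subset_uIcc left_mem_uIcc (by rwa [uIcc_of_le zero_le_one]))).norm

lemma mass_le_mass_one (hA : IntervalIntegrable A volume 0 1) {x : ℝ} (hx : x ∈ Icc (0 : ℝ) 1) :
    mass A x ≤ mass A 1 :=
  intervalIntegral.integral_mono_interval le_rfl hx.1 hx.2
    (Eventually.of_forall fun _ => norm_nonneg _) hA.norm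

/-- The Volterra operator `Y ↦ ∫₀ˣ A Y`; the system `Y' = A Y` with `Y(0) = v` reads
`Y = v + volterra A Y`. -/
noncomputable def volterra (A : ℝ → E →L[ℂ] E) (hA : IntervalIntegrable A volume 0 1) :
    C(unitInterval, E) →L[ℂ] C(unitInterval, E) :=
  LinearMap.mkContinuous
    { toFun := fun Y => primitive (fun s => A s (extend Y s))
        (intervalIntegrable_clm_extend hA Y ⟨zero_le_one, le_rfl⟩)
      map_add' := fun Y Z => by
        ext x
        refine (intervalIntegral.integral_congr fun s _ => map_add (A s) _ _).trans ?_
        exact intervalIntegral.integral_add (intervalIntegrable_clm_extend hA Y x.2)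
          (intervalIntegrable_clm_extend hA Z x.2)
      map_smul' := fun c Y => by
        ext x
        refine (intervalIntegral.integral_congr fun s _ => map_smul (A s) c _).trans ?_
        exact intervalIntegral.integral_smul c _ }
    (mass A 1) (fun Y => by
      refine (ContinuousMap.norm_le _ (mul_nonneg (mass_nonneg zero_le_one) (norm_nonneg Y))).2
        fun x => ?_
      calc ‖∫ s in (0 : ℝ)..x, A s (extend Y s)‖ ≤ ∫ s in (0 : ℝ)..x, ‖A s‖ * ‖Y‖ := by
            refine intervalIntegral.norm_integral_le_of_norm_le x.2.1
              (Eventually.of_forall fun s _ => (A s).le_opNorm_of_le (norm_extend_le Y s))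
              ((isPrimitiveOn_mass hA x.2).intervalIntegrable.mul_const _)
        _ = mass A x * ‖Y‖ := intervalIntegral.integral_mul_const _ _
        _ ≤ mass A 1 * ‖Y‖ := by gcongr; exact mass_le_mass_one hA x.2)

lemma volterra_apply (hA : IntervalIntegrable A volume 0 1) (Y : C(unitInterval, E))
    (x : unitInterval) : volterra A hA Y x = ∫ s in (0 : ℝ)..x, A s (extend Y s) := rfl

lemma volterra_add_smul (hA : IntervalIntegrable A volume 0 1)
    (hB : IntervalIntegrable B volume 0 1) (c : ℂ) :
    volterra (fun s => A s + c • B s) (hA.add (hB.smul c)) = volterra A hA + c • volterra B hB := by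
  ext Y x
  simp only [add_apply, smul_apply, ContinuousMap.add_apply, ContinuousMap.smul_apply,
    volterra_apply, ← intervalIntegral.integral_smul]
  exact intervalIntegral.integral_add (intervalIntegrable_clm_extend hA Y x.2)
    ((intervalIntegrable_clm_extend hB Y x.2).smul c)

lemma norm_volterra_pow_apply_le (hA : IntervalIntegrable A volume 0 1) (n : ℕ)
    (Y : C(unitInterval, E)) (x : unitInterval) :
    ‖(volterra A hA ^ n) Y x‖ ≤ ‖Y‖ * (mass A x ^ n / n.factorial) := by
  induction n generalizing x with
  | zero => simpa using Y.norm_coe_le_norm x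
  | succ n ih =>
    set Z := (volterra A hA ^ n) Y
    have hm := isPrimitiveOn_mass hA x.2
    have hZ : ∀ s ∈ Ioc (0 : ℝ) x,
        ‖A s (extend Z s)‖ ≤ ‖Y‖ / n.factorial * (mass A s ^ n * ‖A s‖) := fun s hs => by
      have hs' : s ∈ Icc (0 : ℝ) 1 := ⟨hs.1.le, hs.2.trans x.2.2⟩
      refine ((A s).le_opNorm_of_le ((congrArg norm (extend_apply Z hs')).trans_le
        (ih ⟨s, hs'⟩))).trans_eq ?_
      ring
    calc ‖(volterra A hA ^ (n + 1)) Y x‖ = ‖∫ s in (0 : ℝ)..x, A s (extend Z s)‖ := by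
          rw [pow_succ']; rfl
      _ ≤ ∫ s in (0 : ℝ)..x, ‖Y‖ / n.factorial * (mass A s ^ n * ‖A s‖) :=
          intervalIntegral.norm_integral_le_of_norm_le x.2.1 (Eventually.of_forall hZ)
            ((hm.intervalIntegrable.continuousOn_mul (hm.continuousOn.pow n)).const_mul _)
      _ = ‖Y‖ / n.factorial * (mass A x ^ (n + 1) / (n + 1)) := by
          rw [intervalIntegral.integral_const_mul,
            hm.integral_pow_mul (intervalIntegral.integral_same) n]
      _ = ‖Y‖ * (mass A x ^ (n + 1) / (n + 1).factorial) := by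
          rw [Nat.factorial_succ]
          push_cast
          field_simp

variable [CompleteSpace E]

lemma isUnit_one_sub_volterra (hA : IntervalIntegrable A volume 0 1) :
    IsUnit (1 - volterra A hA) := by
  have ht := FloorSemiring.tendsto_pow_div_factorial_atTop (mass A 1)
  obtain ⟨n, hn⟩ := (ht.eventually (gt_mem_nhds zero_lt_one)).exists
  refine isUnit_one_sub_of_norm_pow_lt_one (a := volterra A hA) (n := n) (lt_of_le_of_lt ?_ hn)
  have h0 : 0 ≤ mass A 1 := mass_nonneg zero_le_one
  refine ContinuousLinearMap.opNorm_le_bound _ (by positivity) fun Y => ?_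
  refine (ContinuousMap.norm_le _ (by positivity)).2 fun x => ?_
  refine (norm_volterra_pow_apply_le hA n Y x).trans ?_
  have h1 := mass_le_mass_one hA x.2
  have h2 : 0 ≤ mass A x := mass_nonneg x.2.1
  rw [mul_comm]
  gcongr

/-- The inverse of `1 - volterra A`. -/
noncomputable def resolvent (A : ℝ → E →L[ℂ] E) (hA : IntervalIntegrable A volume 0 1) :
    C(unitInterval, E) →L[ℂ] C(unitInterval, E) :=
  Ring.inverse (1 - volterra A hA)

lemma eq_resolvent_apply_iff (hA : IntervalIntegrable A volume 0 1) {R Y : C(unitInterval, E)} :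
    Y = resolvent A hA R ↔ Y = R + volterra A hA Y := by
  have hu := isUnit_one_sub_volterra hA
  have hl : (1 - volterra A hA) (resolvent A hA R) = R :=
    DFunLike.congr_fun (Ring.mul_inverse_cancel _ hu) R
  have hr : resolvent A hA ((1 - volterra A hA) Y) = Y :=
    DFunLike.congr_fun (Ring.inverse_mul_cancel _ hu) Y
  rw [← sub_eq_iff_eq_add]
  constructor
  · rintro rfl
    exact hl
  · intro h
    rw [← h]
    exact hr.symm

lemma isPrimitiveOn_resolvent (hA : IntervalIntegrable A volume 0 1) {g : ℝ → E}
    (hg : IntervalIntegrable g volume 0 1) (v : E) :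
    IsPrimitiveOn
      (fun s => A s (extend (resolvent A hA (ContinuousMap.const _ v + primitive g hg)) s) + g s)
      (extend (resolvent A hA (ContinuousMap.const _ v + primitive g hg))) 0 1 ∧
    extend (resolvent A hA (ContinuousMap.const _ v + primitive g hg)) 0 = v := by
  set Y := resolvent A hA (ContinuousMap.const _ v + primitive g hg) with hY
  have hint : ∀ x ∈ Icc (0 : ℝ) 1,
      extend Y x = v + ∫ s in (0 : ℝ)..x, (A s (extend Y s) + g s) := fun x hx => by
    have hgx : IntervalIntegrable g volume 0 x :=
      hg.mono_set (uIcc_subset_uIcc left_mem_uIcc (by rwa [uIcc_of_le zero_le_one]))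
    have hfix := DFunLike.congr_fun ((eq_resolvent_apply_iff hA).1 hY) ⟨x, hx⟩
    rw [extend_apply Y hx, hfix,
      intervalIntegral.integral_add (intervalIntegrable_clm_extend hA Y hx) hgx]
    simp only [ContinuousMap.add_apply, ContinuousMap.const_apply, volterra_apply]
    rw [add_assoc, add_comm (primitive g hg _)]
    rfl
  have h0 : extend Y 0 = v := by
    rw [hint 0 ⟨le_rfl, zero_le_one⟩, intervalIntegral.integral_same, add_zero]
  refine ⟨⟨(intervalIntegrable_clm_extend hA Y ⟨zero_le_one, le_rfl⟩).add hg, ?_⟩, h0⟩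
  rwa [h0, uIcc_of_le zero_le_one]

/-- The solution operator `v ↦ Y` of the system `Y' = A Y`, `Y(0) = v` on `[0,1]`. -/
noncomputable def propagator (A : ℝ → E →L[ℂ] E) (hA : IntervalIntegrable A volume 0 1) :
    E →L[ℂ] C(unitInterval, E) :=
  (resolvent A hA).comp (ContinuousLinearMap.const ℂ unitInterval)

lemma isPrimitiveOn_propagator (hA : IntervalIntegrable A volume 0 1) (v : E) :
    IsPrimitiveOn (fun s => A s (extend (propagator A hA v) s)) (extend (propagator A hA v)) 0 1 ∧
      extend (propagator A hA v) 0 = v := by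
  have h0 : primitive (0 : ℝ → E) .zero = 0 := by
    ext x
    exact intervalIntegral.integral_zero
  have h := isPrimitiveOn_resolvent hA .zero v
  simp only [h0, add_zero, Pi.zero_apply] at h
  exact h

lemma IsPrimitiveOn.eq_propagator (hA : IntervalIntegrable A volume 0 1) {u : ℝ → E}
    (hu : IsPrimitiveOn (fun s => A s (u s)) u 0 1) {x : ℝ} (hx : x ∈ Icc (0 : ℝ) 1) :
    u x = extend (propagator A hA (u 0)) x := by
  have hc := hu.continuousOn
  rw [uIcc_of_le zero_le_one] at hc
  set U : C(unitInterval, E) := ⟨(Icc (0 : ℝ) 1).domRestrict u, hc.domRestrict⟩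
  have hU : ∀ x ∈ Icc (0 : ℝ) 1, extend U x = u x := fun x hx => extend_apply U hx
  have hfix : U = ContinuousMap.const _ (u 0) + volterra A hA U := by
    ext x
    refine (hu.eq_integral x (by rw [uIcc_of_le zero_le_one]; exact x.2)).trans ?_
    refine congrArg (u 0 + ·) (intervalIntegral.integral_congr fun s hs => ?_)
    rw [uIcc_of_le x.2.1] at hs
    simp only [hU s ⟨hs.1, hs.2.trans x.2.2⟩]
  rw [← hU x hx]
  exact congrArg (extend · x) ((eq_resolvent_apply_iff hA).2 hfix)

lemma differentiable_propagator_add_smul (hA : IntervalIntegrable A volume 0 1)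
    (hB : IntervalIntegrable B volume 0 1) :
    Differentiable ℂ fun c : ℂ => propagator (fun s => A s + c • B s) (hA.add (hB.smul c)) := by
  have hu : ∀ c : ℂ, IsUnit (1 - (volterra A hA + c • volterra B hB)) := fun c =>
    volterra_add_smul hA hB c ▸ isUnit_one_sub_volterra (hA.add (hB.smul c))
  have hres := differentiable_inverse_one_sub_add_smul
    (A := C(unitInterval, E) →L[ℂ] C(unitInterval, E)) hu
  simp only [← volterra_add_smul hA hB] at hres
  exact hres.clm_comp (differentiable_const _)

end LinearSystem

section CauchyProblem

variable {q : ℝ → ℂ}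

/-- The constant coefficient `(a, b) ↦ (0, a)` with which the potential enters the first-order
system for `(y, y')`. -/
noncomputable def potentialCoeff : ℂ × ℂ →L[ℂ] ℂ × ℂ :=
  ContinuousLinearMap.prod 0 (ContinuousLinearMap.fst ℂ ℂ ℂ)

/-- The coefficient `(a, b) ↦ (b, q a)` of the first-order system for `(y, y')` which is equivalent
to `-y'' + q y = 0`. -/
noncomputable def systemCoeff (q : ℝ → ℂ) (s : ℝ) : ℂ × ℂ →L[ℂ] ℂ × ℂ :=
  ContinuousLinearMap.prod (ContinuousLinearMap.snd ℂ ℂ ℂ) 0 + q s • potentialCoeff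

lemma intervalIntegrable_systemCoeff (hq : IntervalIntegrable q volume 0 1) :
    IntervalIntegrable (systemCoeff q) volume 0 1 :=
  intervalIntegrable_const.add ⟨hq.1.smul_const _, hq.2.smul_const _⟩

lemma intervalIntegrable_systemCoeff_add (hq : IntervalIntegrable q volume 0 1) (μ : ℂ) :
    IntervalIntegrable (fun s => systemCoeff q s + μ • -potentialCoeff) volume 0 1 :=
  (intervalIntegrable_systemCoeff hq).add intervalIntegrable_const

lemma systemCoeff_add_apply (μ : ℂ) (s : ℝ) (p : ℂ × ℂ) :
    (systemCoeff q s + μ • -potentialCoeff) p = (p.2, (q s - μ) * p.1) := by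
  ext
  · simp [systemCoeff, potentialCoeff]
  · simp [systemCoeff, potentialCoeff]
    ring

lemma solves_iff_isPrimitiveOn_system {μ : ℂ} {f y dy : ℝ → ℂ} :
    Solves q (f + μ • y) y dy ↔
      IsPrimitiveOn (fun s => (systemCoeff q s + μ • -potentialCoeff) (y s, dy s) + (0, -f s))
        (fun s => (y s, dy s)) 0 1 := by
  have e₁ : (fun s => (systemCoeff q s + μ • -potentialCoeff) (y s, dy s) + (0, -f s)) =
      fun s => (dy s, (q s - μ) * y s - f s) := by
    funext s
    rw [systemCoeff_add_apply, Prod.mk_add_mk, add_zero, ← sub_eq_add_neg]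
  have e₂ : (fun s => q s * y s - (f + μ • y) s) = fun s => (q s - μ) * y s - f s := by
    funext s
    simp only [Pi.add_apply, Pi.smul_apply, smul_eq_mul]
    ring
  rw [solves_iff_isPrimitiveOn, e₁, e₂]
  exact ⟨fun h => h.1.prodMk h.2, fun h => ⟨h.clm_comp (ContinuousLinearMap.fst ℝ ℂ ℂ),
    h.clm_comp (ContinuousLinearMap.snd ℝ ℂ ℂ)⟩⟩

lemma exists_solves (hq : IntervalIntegrable q volume 0 1) (μ : ℂ) {f : ℝ → ℂ}
    (hf : IntervalIntegrable f volume 0 1) (v : ℂ × ℂ) :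
    ∃ y dy : ℝ → ℂ, Solves q (f + μ • y) y dy ∧ y 0 = v.1 ∧ dy 0 = v.2 := by
  have hf' : IntervalIntegrable (fun s => ((0 : ℂ), -f s)) volume 0 1 :=
    ⟨(integrable_zero _ _ _).prodMk hf.1.neg, (integrable_zero _ _ _).prodMk hf.2.neg⟩
  obtain ⟨hY, h0⟩ := isPrimitiveOn_resolvent (intervalIntegrable_systemCoeff_add hq μ) hf' v
  exact ⟨_, _, solves_iff_isPrimitiveOn_system.2 hY, congrArg Prod.fst h0, congrArg Prod.snd h0⟩

variable (hq : IntervalIntegrable q volume 0 1)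

/-- The operator taking `v` to the solution `y` of `-y'' + q y = μ y` with `(y(0), y'(0)) = v`. -/
noncomputable def flow (μ : ℂ) : ℂ × ℂ →L[ℂ] C(unitInterval, ℂ) :=
  ((ContinuousLinearMap.fst ℂ ℂ ℂ).compLeftContinuous ℂ unitInterval).comp
    (propagator _ (intervalIntegrable_systemCoeff_add hq μ))

/-- The operator taking `v` to the derivative of `flow hq μ v`. -/
noncomputable def flowDeriv (μ : ℂ) : ℂ × ℂ →L[ℂ] C(unitInterval, ℂ) :=
  ((ContinuousLinearMap.snd ℂ ℂ ℂ).compLeftContinuous ℂ unitInterval).comp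
    (propagator _ (intervalIntegrable_systemCoeff_add hq μ))

lemma solves_flow (μ : ℂ) (v : ℂ × ℂ) :
    Solves q (μ • extend (flow hq μ v)) (extend (flow hq μ v)) (extend (flowDeriv hq μ v)) := by
  have h := (isPrimitiveOn_propagator (intervalIntegrable_systemCoeff_add hq μ) v).1
  rw [← zero_add (μ • _), solves_iff_isPrimitiveOn_system]
  simp only [Pi.zero_apply, neg_zero, Prod.mk_zero_zero, add_zero]
  exact h

lemma extend_flow_zero (μ : ℂ) (v : ℂ × ℂ) : extend (flow hq μ v) 0 = v.1 :=
  congrArg Prod.fst (isPrimitiveOn_propagator (intervalIntegrable_systemCoeff_add hq μ) v).2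

lemma extend_flowDeriv_zero (μ : ℂ) (v : ℂ × ℂ) : extend (flowDeriv hq μ v) 0 = v.2 :=
  congrArg Prod.snd (isPrimitiveOn_propagator (intervalIntegrable_systemCoeff_add hq μ) v).2

lemma Solves.eq_flow {μ : ℂ} {y dy : ℝ → ℂ} (h : Solves q (μ • y) y dy) {x : ℝ}
    (hx : x ∈ Icc (0 : ℝ) 1) :
    (y x, dy x) = (extend (flow hq μ (y 0, dy 0)) x, extend (flowDeriv hq μ (y 0, dy 0)) x) := by
  rw [← zero_add (μ • y), solves_iff_isPrimitiveOn_system] at h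
  simp only [Pi.zero_apply, neg_zero, Prod.mk_zero_zero, add_zero] at h
  exact h.eq_propagator (intervalIntegrable_systemCoeff_add hq μ) hx

lemma differentiable_flow : Differentiable ℂ (flow hq) :=
  (differentiable_const _).clm_comp (differentiable_propagator_add_smul
    (intervalIntegrable_systemCoeff hq) intervalIntegrable_const)

lemma differentiable_flowDeriv : Differentiable ℂ (flowDeriv hq) :=
  (differentiable_const _).clm_comp (differentiable_propagator_add_smul
    (intervalIntegrable_systemCoeff hq) intervalIntegrable_const)

/-- The monodromy operator `(y(0), y'(0)) ↦ (y(1), y'(1))` of `-y'' + q y = μ y`. -/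
noncomputable def monodromy (μ : ℂ) : ℂ × ℂ →L[ℂ] ℂ × ℂ :=
  ((ContinuousMap.evalCLM ℂ 1).comp (flow hq μ)).prod
    ((ContinuousMap.evalCLM ℂ 1).comp (flowDeriv hq μ))

lemma monodromy_apply (μ : ℂ) (v : ℂ × ℂ) :
    monodromy hq μ v = (extend (flow hq μ v) 1, extend (flowDeriv hq μ v) 1) := by
  rw [extend_apply _ ⟨zero_le_one, le_rfl⟩, extend_apply _ ⟨zero_le_one, le_rfl⟩]
  rfl

lemma differentiable_monodromy_apply (v : ℂ × ℂ) :
    Differentiable ℂ fun μ => monodromy hq μ v :=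
  ((ContinuousMap.evalCLM ℂ 1).differentiable.comp
      ((differentiable_flow hq).clm_apply (differentiable_const v))).prodMk
    ((ContinuousMap.evalCLM ℂ 1).differentiable.comp
      ((differentiable_flowDeriv hq).clm_apply (differentiable_const v)))

lemma differentiable_monodromy : Differentiable ℂ (monodromy hq) :=
  (contDiff_clm_apply_iff.2 fun v =>
    (differentiable_monodromy_apply hq v).contDiff (n := 1)).differentiable one_ne_zero

lemma cauchySol_one (μ a b : ℂ) :
    ((cauchySol q μ a b).1 1, (cauchySol q μ a b).2 1) = monodromy hq μ (a, b) := by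
  obtain ⟨h, ha, hb⟩ := Classical.epsilon_spec (p := fun p : (ℝ → ℂ) × (ℝ → ℂ) =>
    Solves q (μ • p.1) p.1 p.2 ∧ p.1 0 = a ∧ p.2 0 = b)
    ⟨(extend (flow hq μ (a, b)), extend (flowDeriv hq μ (a, b))), solves_flow hq μ (a, b),
      extend_flow_zero hq μ (a, b), extend_flowDeriv_zero hq μ (a, b)⟩
  have h₁ := h.eq_flow hq ⟨zero_le_one, le_rfl⟩
  rw [ha, hb] at h₁
  exact h₁.trans (monodromy_apply hq μ (a, b)).symm

lemma discriminant_eq (μ : ℂ) :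
    discriminant q μ = (monodromy hq μ (1, 0)).1 + (monodromy hq μ (0, 1)).2 := by
  rw [← cauchySol_one hq, ← cauchySol_one hq, discriminant, add_comm]

lemma differentiable_discriminant (hq : IntervalIntegrable q volume 0 1) :
    Differentiable ℂ (discriminant q) := by
  rw [funext (discriminant_eq hq)]
  exact (differentiable_monodromy_apply hq _).fst.add (differentiable_monodromy_apply hq _).snd

end CauchyProblem

section Asymptotics

lemma norm_cos_le_exp (z : ℂ) : ‖Complex.cos z‖ ≤ Real.exp |z.im| := by
  rw [Complex.cos, norm_div, Complex.norm_ofNat, div_le_iff₀ two_pos]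
  refine (norm_add_le _ _).trans ?_
  rw [Complex.norm_exp, Complex.norm_exp]
  have h₁ : Real.exp (z * Complex.I).re ≤ Real.exp |z.im| :=
    Real.exp_le_exp.2 (by simpa using neg_le_abs z.im)
  have h₂ : Real.exp (-z * Complex.I).re ≤ Real.exp |z.im| :=
    Real.exp_le_exp.2 (by simpa using le_abs_self z.im)
  linarith

lemma norm_sin_le_exp (z : ℂ) : ‖Complex.sin z‖ ≤ Real.exp |z.im| := by
  rw [Complex.sin, norm_div, Complex.norm_ofNat, div_le_iff₀ two_pos, norm_mul, Complex.norm_I,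
    mul_one]
  refine (norm_sub_le _ _).trans ?_
  rw [Complex.norm_exp, Complex.norm_exp]
  have h₁ : Real.exp (z * Complex.I).re ≤ Real.exp |z.im| :=
    Real.exp_le_exp.2 (by simpa using neg_le_abs z.im)
  have h₂ : Real.exp (-z * Complex.I).re ≤ Real.exp |z.im| :=
    Real.exp_le_exp.2 (by simpa using le_abs_self z.im)
  linarith

lemma exp_le_norm_cos_add_norm_sin (z : ℂ) :
    Real.exp |z.im| ≤ ‖Complex.cos z‖ + ‖Complex.sin z‖ := by
  rcases abs_cases z.im with ⟨h, -⟩ | ⟨h, -⟩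
  · have e : Complex.exp (-z * Complex.I) = Complex.cos z - Complex.sin z * Complex.I := by
      rw [Complex.exp_mul_I, Complex.cos_neg, Complex.sin_neg, neg_mul, sub_eq_add_neg]
    have := norm_sub_le (Complex.cos z) (Complex.sin z * Complex.I)
    rw [← e, Complex.norm_exp, norm_mul, Complex.norm_I, mul_one] at this
    simpa [h] using this
  · have := norm_add_le (Complex.cos z) (Complex.sin z * Complex.I)
    rw [← Complex.exp_mul_I, Complex.norm_exp, norm_mul, Complex.norm_I, mul_one] at this
    simpa [h] using this

lemma abs_im_mul_ofReal (k : ℂ) {x : ℝ} (hx : 0 ≤ x) : |(k * x).im| = |k.im| * x := by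
  rw [Complex.im_mul_ofReal, abs_mul, abs_of_nonneg hx]

lemma abs_im_mul_sub (k : ℂ) {x s : ℝ} (h : s ≤ x) : |(k * (x - s)).im| = |k.im| * (x - s) := by
  rw [← Complex.ofReal_sub, abs_im_mul_ofReal k (sub_nonneg.2 h)]

lemma hasDerivAt_sin_mul_sub (k : ℂ) (x s : ℝ) :
    HasDerivAt (fun s : ℝ => Complex.sin (k * (x - s))) (-k * Complex.cos (k * (x - s))) s := by
  have h : HasDerivAt (fun s : ℝ => k * ((x : ℂ) - s)) (-k) s := by
    simpa using ((Complex.ofRealCLM.hasDerivAt (x := s)).const_sub (x : ℂ)).const_mul k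
  convert! (Complex.hasDerivAt_sin (k * ((x : ℂ) - s))).comp s h using 1
  ring

lemma hasDerivAt_cos_mul_sub (k : ℂ) (x s : ℝ) :
    HasDerivAt (fun s : ℝ => Complex.cos (k * (x - s))) (k * Complex.sin (k * (x - s))) s := by
  have h : HasDerivAt (fun s : ℝ => k * ((x : ℂ) - s)) (-k) s := by
    simpa using ((Complex.ofRealCLM.hasDerivAt (x := s)).const_sub (x : ℂ)).const_mul k
  convert! (Complex.hasDerivAt_cos (k * ((x : ℂ) - s))).comp s h using 1
  ring

variable {q : ℝ → ℂ} {k : ℂ} {y dy : ℝ → ℂ} {x : ℝ}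

lemma Solves.wronskian_eq_integral {μ : ℂ} {c dc : ℝ → ℂ} (h : Solves q (μ • y) y dy)
    (hc : ∀ s, HasDerivAt c (dc s) s) (hdc : ∀ s, HasDerivAt dc (-μ * c s) s)
    (hx : x ∈ Icc (0 : ℝ) 1) :
    dy x * c x - y x * dc x =
      dy 0 * c 0 - y 0 * dc 0 + ∫ s in (0 : ℝ)..x, c s * (q s * y s) := by
  have hc_cont : Continuous c := continuous_iff_continuousAt.2 fun s => (hc s).continuousAt
  have hdc_cont : Continuous dc := continuous_iff_continuousAt.2 fun s => (hdc s).continuousAt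
  have hC : IsPrimitiveOn dc c 0 1 :=
    .of_hasDerivAt (fun s _ => hc s) (hdc_cont.intervalIntegrable _ _)
  have hdC : IsPrimitiveOn (fun s => -μ * c s) dc 0 1 :=
    .of_hasDerivAt (fun s _ => hdc s) ((hc_cont.const_mul _).intervalIntegrable _ _)
  obtain ⟨hy, hdy⟩ := solves_iff_isPrimitiveOn.1 h
  rw [((hdy.mul hC).sub (hy.mul hdC)).eq_integral x (by rwa [uIcc_of_le zero_le_one])]
  congr 2
  funext s
  simp only [Pi.smul_apply, smul_eq_mul]
  ring

lemma Solves.variation_of_constants (h : Solves q (k ^ 2 • y) y dy) (hx : x ∈ Icc (0 : ℝ) 1) :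
    k * y x = dy 0 * Complex.sin (k * x) + k * y 0 * Complex.cos (k * x) +
      ∫ s in (0 : ℝ)..x, Complex.sin (k * (x - s)) * (q s * y s) := by
  have key := h.wronskian_eq_integral (hasDerivAt_sin_mul_sub k x)
    (fun s => ((hasDerivAt_cos_mul_sub k x s).const_mul (-k)).congr_deriv (by ring)) hx
  simp only [sub_self, mul_zero, Complex.sin_zero, Complex.cos_zero, Complex.ofReal_zero,
    sub_zero, mul_one] at key
  linear_combination key

lemma Solves.variation_of_constants_deriv (h : Solves q (k ^ 2 • y) y dy)
    (hx : x ∈ Icc (0 : ℝ) 1) :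
    dy x = dy 0 * Complex.cos (k * x) - k * y 0 * Complex.sin (k * x) +
      ∫ s in (0 : ℝ)..x, Complex.cos (k * (x - s)) * (q s * y s) := by
  have key := h.wronskian_eq_integral (hasDerivAt_cos_mul_sub k x)
    (fun s => ((hasDerivAt_sin_mul_sub k x s).const_mul k).congr_deriv (by ring)) hx
  simp only [sub_self, mul_zero, Complex.sin_zero, Complex.cos_zero, Complex.ofReal_zero,
    sub_zero, mul_one] at key
  linear_combination key

lemma norm_integral_mul_le_exp (hq : IntervalIntegrable q volume 0 1) {c : ℝ → ℂ} {τ B : ℝ}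
    (hB : 0 ≤ B) (hx : x ∈ Icc (0 : ℝ) 1)
    (hc : ∀ s ∈ Icc (0 : ℝ) x, ‖c s‖ ≤ Real.exp (τ * (x - s)))
    (hy : ∀ s ∈ Icc (0 : ℝ) 1, ‖y s‖ ≤ B * Real.exp (τ * s)) :
    ‖∫ s in (0 : ℝ)..x, c s * (q s * y s)‖ ≤
      (∫ s in (0 : ℝ)..1, ‖q s‖) * (B * Real.exp (τ * x)) := by
  have hqx : IntervalIntegrable q volume 0 x :=
    hq.mono_set (uIcc_subset_uIcc left_mem_uIcc (by rwa [uIcc_of_le zero_le_one]))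
  calc ‖∫ s in (0 : ℝ)..x, c s * (q s * y s)‖
      ≤ ∫ s in (0 : ℝ)..x, ‖q s‖ * (B * Real.exp (τ * x)) := by
        refine intervalIntegral.norm_integral_le_of_norm_le hx.1
          (Eventually.of_forall fun s hs => ?_) (hqx.norm.mul_const _)
        have h₁ := hc s ⟨hs.1.le, hs.2⟩
        have h₂ := hy s ⟨hs.1.le, hs.2.trans hx.2⟩
        rw [norm_mul, norm_mul]
        calc ‖c s‖ * (‖q s‖ * ‖y s‖)
            ≤ Real.exp (τ * (x - s)) * (‖q s‖ * (B * Real.exp (τ * s))) := by gcongr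
          _ = ‖q s‖ * (B * (Real.exp (τ * (x - s)) * Real.exp (τ * s))) := by ring
          _ = ‖q s‖ * (B * Real.exp (τ * x)) := by rw [← Real.exp_add]; ring_nf
    _ = (∫ s in (0 : ℝ)..x, ‖q s‖) * (B * Real.exp (τ * x)) :=
        intervalIntegral.integral_mul_const _ _
    _ ≤ (∫ s in (0 : ℝ)..1, ‖q s‖) * (B * Real.exp (τ * x)) := by
        gcongr
        exact intervalIntegral.integral_mono_interval le_rfl hx.1 hx.2
          (ae_of_all _ fun _ => norm_nonneg _) hq.norm

lemma Solves.norm_sub_le (hq : IntervalIntegrable q volume 0 1) (h : Solves q (k ^ 2 • y) y dy)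
    {B : ℝ} (hB : 0 ≤ B) (hy : ∀ s ∈ Icc (0 : ℝ) 1, ‖y s‖ ≤ B * Real.exp (|k.im| * s))
    (hx : x ∈ Icc (0 : ℝ) 1) :
    ‖k * y x - (dy 0 * Complex.sin (k * x) + k * y 0 * Complex.cos (k * x))‖ ≤
      (∫ s in (0 : ℝ)..1, ‖q s‖) * (B * Real.exp (|k.im| * x)) := by
  rw [h.variation_of_constants hx, add_sub_cancel_left]
  exact norm_integral_mul_le_exp hq hB hx
    (fun s hs => (norm_sin_le_exp _).trans_eq (by rw [abs_im_mul_sub k hs.2])) hy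

lemma Solves.norm_deriv_sub_le (hq : IntervalIntegrable q volume 0 1)
    (h : Solves q (k ^ 2 • y) y dy) {B : ℝ} (hB : 0 ≤ B)
    (hy : ∀ s ∈ Icc (0 : ℝ) 1, ‖y s‖ ≤ B * Real.exp (|k.im| * s)) (hx : x ∈ Icc (0 : ℝ) 1) :
    ‖dy x - (dy 0 * Complex.cos (k * x) - k * y 0 * Complex.sin (k * x))‖ ≤
      (∫ s in (0 : ℝ)..1, ‖q s‖) * (B * Real.exp (|k.im| * x)) := by
  rw [h.variation_of_constants_deriv hx, add_sub_cancel_left]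
  exact norm_integral_mul_le_exp hq hB hx
    (fun s hs => (norm_cos_le_exp _).trans_eq (by rw [abs_im_mul_sub k hs.2])) hy

lemma integral_norm_nonneg (q : ℝ → ℂ) : 0 ≤ ∫ s in (0 : ℝ)..1, ‖q s‖ :=
  intervalIntegral.integral_nonneg zero_le_one fun _ _ => norm_nonneg _

lemma Solves.norm_le (hq : IntervalIntegrable q volume 0 1) (hk₀ : 0 < ‖k‖)
    (hk : 2 * ∫ s in (0 : ℝ)..1, ‖q s‖ ≤ ‖k‖) (h : Solves q (k ^ 2 • y) y dy)
    (hx : x ∈ Icc (0 : ℝ) 1) :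
    ‖y x‖ ≤ 2 * ((‖dy 0‖ + ‖k‖ * ‖y 0‖) / ‖k‖) * Real.exp (|k.im| * x) := by
  obtain ⟨x₀, hx₀, hmax⟩ := isCompact_Icc.exists_isMaxOn ⟨(0 : ℝ), le_rfl, zero_le_one⟩
    (h.cont.norm.mul (f := fun x => ‖y x‖) (g := fun x => Real.exp (-(|k.im| * x)))
      (by fun_prop))
  set Q := ∫ s in (0 : ℝ)..1, ‖q s‖
  set A := ‖dy 0‖ + ‖k‖ * ‖y 0‖ with hA
  set B := ‖y x₀‖ * Real.exp (-(|k.im| * x₀)) with hB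
  have hB₀ : 0 ≤ B := by positivity
  have hy : ∀ s ∈ Icc (0 : ℝ) 1, ‖y s‖ ≤ B * Real.exp (|k.im| * s) := fun s hs => by
    rw [← div_le_iff₀ (Real.exp_pos _), div_eq_mul_inv, ← Real.exp_neg]
    exact hmax hs
  have hfree : ‖dy 0 * Complex.sin (k * x₀) + k * y 0 * Complex.cos (k * x₀)‖ ≤
      A * Real.exp (|k.im| * x₀) := by
    have hsin := norm_sin_le_exp (k * x₀)
    have hcos := norm_cos_le_exp (k * x₀)
    rw [abs_im_mul_ofReal k hx₀.1] at hsin hcos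
    calc _ ≤ ‖dy 0‖ * ‖Complex.sin (k * x₀)‖ + ‖k‖ * ‖y 0‖ * ‖Complex.cos (k * x₀)‖ :=
          (norm_add_le _ _).trans_eq (by simp only [norm_mul])
      _ ≤ ‖dy 0‖ * Real.exp (|k.im| * x₀) + ‖k‖ * ‖y 0‖ * Real.exp (|k.im| * x₀) := by gcongr
      _ = A * Real.exp (|k.im| * x₀) := by rw [hA]; ring
  have hky : ‖k * y x₀‖ ≤ (A + Q * B) * Real.exp (|k.im| * x₀) := by
    have := norm_le_norm_add_norm_sub'
      (k * y x₀) (dy 0 * Complex.sin (k * x₀) + k * y 0 * Complex.cos (k * x₀))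
    linarith [h.norm_sub_le hq hB₀ hy hx₀]
  have hBA : ‖k‖ * B ≤ A + Q * B :=
    calc ‖k‖ * B = ‖k * y x₀‖ / Real.exp (|k.im| * x₀) := by
          rw [hB, norm_mul, Real.exp_neg, div_eq_mul_inv, mul_assoc]
      _ ≤ A + Q * B := (div_le_iff₀ (Real.exp_pos _)).2 hky
  have hB_le : B ≤ 2 * (A / ‖k‖) := by
    rw [mul_div_assoc', le_div_iff₀ hk₀]
    nlinarith
  exact (hy x hx).trans (by gcongr)

lemma norm_discriminant_sub_le (hq : IntervalIntegrable q volume 0 1) (hk₀ : 0 < ‖k‖)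
    (hk : 2 * ∫ s in (0 : ℝ)..1, ‖q s‖ ≤ ‖k‖) :
    ‖discriminant q (k ^ 2) - 2 * Complex.cos k‖ ≤
      4 * (∫ s in (0 : ℝ)..1, ‖q s‖) * Real.exp |k.im| / ‖k‖ := by
  have h₁ : (1 : ℝ) ∈ Icc (0 : ℝ) 1 := ⟨zero_le_one, le_rfl⟩
  have hθ := solves_flow hq (k ^ 2) (1, 0)
  have hφ := solves_flow hq (k ^ 2) (0, 1)
  have bθ := hθ.norm_sub_le hq (by positivity) (fun s => hθ.norm_le hq hk₀ hk) h₁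
  have bφ := hφ.norm_deriv_sub_le hq (by positivity) (fun s => hφ.norm_le hq hk₀ hk) h₁
  simp only [extend_flow_zero, extend_flowDeriv_zero, zero_mul, mul_zero, one_mul, mul_one,
    Complex.ofReal_one, zero_add, add_zero, sub_zero, norm_zero, norm_one] at bθ bφ
  rw [← mul_sub, norm_mul, div_self hk₀.ne', ← le_div_iff₀' hk₀] at bθ
  rw [discriminant_eq hq, monodromy_apply, monodromy_apply]
  calc _ ≤ _ := (congrArg norm (by ring)).trans_le (norm_add_le
        (extend (flow hq (k ^ 2) (1, 0)) 1 - Complex.cos k)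
        (extend (flowDeriv hq (k ^ 2) (0, 1)) 1 - Complex.cos k))
    _ ≤ _ := add_le_add bθ bφ
    _ = _ := by ring

end Asymptotics

section EntireFunctions

variable {f g : ℂ → ℂ} {z₀ : ℂ}

lemma exists_sphere_le_norm_sub (hg : Differentiable ℂ g) (hne : ∃ z, g z ≠ g z₀) :
    ∃ r ∈ Ioc (0 : ℝ) 1, ∃ m > 0, ∀ z ∈ Metric.sphere z₀ r, m ≤ ‖g z - g z₀‖ := by
  have hisol : ∀ᶠ z in 𝓝[≠] z₀, g z ≠ g z₀ := by
    rcases (hg.analyticAt z₀).eventually_eq_or_eventually_ne (analyticAt_const (v := g z₀))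
      with h | h
    · obtain ⟨z, hz⟩ := hne
      exact absurd (AnalyticOnNhd.eqOn_of_preconnected_of_eventuallyEq
        (fun w _ => hg.analyticAt w) (fun w _ => analyticAt_const) isPreconnected_univ
        (mem_univ z₀) h (mem_univ z)) hz
    · exact h
  obtain ⟨ε, hε, hball⟩ := Metric.mem_nhdsWithin_iff.1 hisol
  have hr : 0 < min 1 (ε / 2) := lt_min one_pos (half_pos hε)
  obtain ⟨w, hw, hmin⟩ := (isCompact_sphere z₀ (min 1 (ε / 2))).exists_isMinOn
    (NormedSpace.sphere_nonempty.2 hr.le)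
    (f := fun z => ‖g z - g z₀‖) (hg.continuous.sub continuous_const).norm.continuousOn
  refine ⟨_, ⟨hr, min_le_left _ _⟩, _, norm_pos_iff.2 (sub_ne_zero.2 (hball ⟨?_, ?_⟩)),
    fun z hz => hmin hz⟩
  · rw [Metric.mem_ball, Metric.mem_sphere.1 hw]
    exact (min_le_right _ _).trans_lt (half_lt_self hε)
  · exact Metric.ne_of_mem_sphere hw hr.ne'

lemma exists_mem_closedBall_eq_of_norm_sub_le (hf : Differentiable ℂ f) {r m : ℝ} (hr : 0 < r)
    (hm : 0 < m) (hg : ∀ z ∈ Metric.sphere z₀ r, m ≤ ‖g z - g z₀‖)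
    (hfg : ∀ z ∈ Metric.closedBall z₀ r, ‖f z - g z‖ ≤ m / 5) :
    ∃ z ∈ Metric.closedBall z₀ r, f z = g z₀ := by
  have hcenter : ‖f z₀ - g z₀‖ ≤ m / 5 := hfg z₀ (Metric.mem_closedBall_self hr.le)
  have hsphere : ∀ z ∈ Metric.sphere z₀ r, 3 * m / 5 ≤ ‖f z - f z₀‖ := fun z hz => by
    have h := hfg z (Metric.sphere_subset_closedBall hz)
    have e : g z - g z₀ = (f z - f z₀) + ((f z₀ - g z₀) - (f z - g z)) := by ring
    have h' := (hg z hz).trans_eq (congrArg norm e) |>.trans (norm_add_le _ _)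
    linarith [norm_sub_le (f z₀ - g z₀) (f z - g z)]
  have hfreq : ∃ᶠ z in 𝓝 z₀, f z ≠ f z₀ := fun hev => by
    simp only [not_not] at hev
    have hconst := AnalyticOnNhd.eqOn_of_preconnected_of_eventuallyEq (g := fun _ => f z₀)
      (fun w _ => hf.analyticAt w) (fun w _ => analyticAt_const) isPreconnected_univ
      (mem_univ z₀) hev
    obtain ⟨z, hz⟩ := NormedSpace.sphere_nonempty (x := z₀).2 hr.le
    have h := hsphere z hz
    rw [hconst (mem_univ z), sub_self, norm_zero] at h
    linarith
  have hmem : g z₀ ∈ Metric.ball (f z₀) (3 * m / 5 / 2) := by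
    rw [Metric.mem_ball', dist_eq_norm]
    linarith
  exact hf.diffContOnCl.ball_subset_image_closedBall hr hsphere hfreq hmem

lemma exists_sphere_le_norm_two_mul_cos_sub (c : ℂ) :
    ∃ r ∈ Ioc (0 : ℝ) 1, ∃ m > 0, ∃ τ : ℝ, ∀ X : ℝ, ∃ k : ℂ, X < ‖k‖ ∧ |k.im| = τ ∧
      2 * Complex.cos k = c ∧ ∀ z ∈ Metric.sphere k r, m ≤ ‖2 * Complex.cos z - c‖ := by
  obtain ⟨z₀, hz₀⟩ := Complex.cos_surjective (c / 2)
  obtain ⟨w, hw⟩ := Complex.cos_surjective (c / 2 + 1)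
  have hc : 2 * Complex.cos z₀ = c := by rw [hz₀]; ring
  obtain ⟨r, hr, m, hm, hsphere⟩ := exists_sphere_le_norm_sub (z₀ := z₀)
    (Complex.differentiable_cos.const_mul 2) ⟨w, by simp [hw, hz₀]⟩
  refine ⟨r, hr, m, hm, |z₀.im|, fun X => ?_⟩
  obtain ⟨n, hn⟩ := exists_nat_gt (|X| + ‖z₀‖)
  refine ⟨z₀ + n * (2 * Real.pi), ?_, by simp, by rw [Complex.cos_add_nat_mul_two_pi, hc],
    fun z hz => ?_⟩
  · have h := norm_sub_norm_le (n * (2 * Real.pi) : ℂ) (-z₀)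
    rw [sub_neg_eq_add, add_comm _ z₀, norm_neg, norm_mul, norm_mul, Complex.norm_natCast,
      Complex.norm_ofNat, Complex.norm_real, Real.norm_of_nonneg Real.pi_pos.le] at h
    nlinarith [Real.pi_gt_three, Nat.cast_nonneg (α := ℝ) n, le_abs_self X]
  · rw [mem_sphere_iff_norm] at hz
    have h := hsphere (z - n * (2 * Real.pi)) (by
      rw [mem_sphere_iff_norm, ← hz, sub_sub, add_comm z₀])
    rwa [Complex.cos_sub_nat_mul_two_pi, hc] at h

end EntireFunctions

section DiscriminantAsymptotics

lemma norm_four_sub_sq_le (c k : ℂ) : ‖4 - c ^ 2‖ ≤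
    ‖2 * Complex.cos k - c‖ * (‖2 * Complex.cos k - c‖ + 2 * ‖c‖) + ‖2 * Complex.sin k‖ ^ 2 := by
  have h : 4 - c ^ 2 = (2 * Complex.cos k - c) * ((2 * Complex.cos k - c) + 2 * c) +
      (2 * Complex.sin k) ^ 2 := by
    linear_combination -4 * Complex.sin_sq_add_cos_sq k
  rw [h, ← norm_pow]
  refine (norm_add_le _ _).trans ?_
  rw [norm_mul]
  gcongr
  exact (norm_add_le _ _).trans_eq (by rw [norm_mul, Complex.norm_ofNat])

variable {q : ℝ → ℂ}

/-- The deviation of the discriminant from that of the free equation, in the variable `k = √μ`. -/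
noncomputable def discDev (q : ℝ → ℂ) (k : ℂ) : ℂ := discriminant q (k ^ 2) - 2 * Complex.cos k

lemma differentiable_discDev (hq : IntervalIntegrable q volume 0 1) :
    Differentiable ℂ (discDev q) := by
  have := differentiable_discriminant hq
  unfold discDev
  fun_prop

lemma exists_norm_discDev_le (hq : IntervalIntegrable q volume 0 1) :
    ∃ C R : ℝ, 0 ≤ C ∧ 1 ≤ R ∧ ∀ k : ℂ, R ≤ ‖k‖ →
      ∀ z ∈ Metric.closedBall k 1, ‖discDev q z‖ ≤ C * Real.exp |k.im| / ‖k‖ := by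
  set Q := ∫ s in (0 : ℝ)..1, ‖q s‖
  have hQ : 0 ≤ Q := integral_norm_nonneg q
  refine ⟨8 * Q * Real.exp 1, 2 * Q + 2, by positivity, by linarith, fun k hk z hz => ?_⟩
  rw [mem_closedBall_iff_norm] at hz
  have hkz : ‖k‖ ≤ ‖z‖ + 1 := by linarith [norm_le_norm_add_norm_sub z k]
  have him : |z.im| ≤ |k.im| + 1 := by
    have h := (Complex.abs_im_le_norm (z - k)).trans hz
    rw [Complex.sub_im] at h
    linarith [abs_sub_abs_le_abs_sub z.im k.im]
  have hk₀ : 0 < ‖k‖ := by linarith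
  calc ‖discDev q z‖ ≤ 4 * Q * Real.exp |z.im| / ‖z‖ :=
        norm_discriminant_sub_le hq (by linarith) (by linarith)
    _ ≤ 4 * Q * Real.exp (|k.im| + 1) / (‖k‖ / 2) := by gcongr; linarith
    _ = 8 * Q * Real.exp 1 * Real.exp |k.im| / ‖k‖ := by rw [Real.exp_add]; field_simp; ring

lemma exists_norm_deriv_discDev_le (hq : IntervalIntegrable q volume 0 1) :
    ∃ C R : ℝ, 0 ≤ C ∧ 1 ≤ R ∧ ∀ k : ℂ, R ≤ ‖k‖ →
      ‖discDev q k‖ ≤ C * Real.exp |k.im| / ‖k‖ ∧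
      ‖deriv (discDev q) k‖ ≤ C * Real.exp |k.im| / ‖k‖ ∧
      ‖deriv (deriv (discDev q)) k‖ ≤ C * Real.exp |k.im| / ‖k‖ := by
  obtain ⟨C, R, hC, hR, H⟩ := exists_norm_discDev_le hq
  refine ⟨2 * C, R, by positivity, hR, fun k hk => ?_⟩
  have hd : DiffContOnCl ℂ (discDev q) (Metric.ball k 1) := (differentiable_discDev hq).diffContOnCl
  have hs : ∀ z ∈ Metric.sphere k 1, ‖discDev q z‖ ≤ C * Real.exp |k.im| / ‖k‖ :=
    fun z hz => H k hk z (Metric.sphere_subset_closedBall hz)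
  have h₀ := H k hk k (Metric.mem_closedBall_self zero_le_one)
  have h₁ := Complex.norm_iteratedDeriv_le_of_forall_mem_sphere_norm_le 1 one_pos hd hs
  have h₂ := Complex.norm_iteratedDeriv_le_of_forall_mem_sphere_norm_le 2 one_pos hd hs
  rw [iteratedDeriv_one] at h₁
  rw [iteratedDeriv_succ, iteratedDeriv_one] at h₂
  simp only [Nat.factorial, one_pow, div_one] at h₁ h₂
  push_cast at h₁ h₂
  rw [show 2 * C * Real.exp |k.im| / ‖k‖ = 2 * (C * Real.exp |k.im| / ‖k‖) by ring]
  have : 0 ≤ C * Real.exp |k.im| / ‖k‖ := by positivity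
  refine ⟨?_, ?_, ?_⟩ <;> linarith

lemma deriv_discDev (hq : IntervalIntegrable q volume 0 1) (k : ℂ) : deriv (discDev q) k =
    deriv (discriminant q) (k ^ 2) * (2 * k) + 2 * Complex.sin k := by
  have hpow : HasDerivAt (fun z : ℂ => z ^ 2) (2 * k) k := by simpa using hasDerivAt_pow 2 k
  have h := ((differentiable_discriminant hq (k ^ 2)).hasDerivAt.comp k hpow).sub
    ((Complex.hasDerivAt_cos k).const_mul 2)
  exact h.deriv.trans (by ring)

lemma differentiable_deriv_discriminant (hq : IntervalIntegrable q volume 0 1) :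
    Differentiable ℂ (deriv (discriminant q)) :=
  ((differentiable_discriminant hq).contDiff (n := 2)).differentiable_deriv_two

lemma deriv_deriv_discDev (hq : IntervalIntegrable q volume 0 1)
    (k : ℂ) : deriv (deriv (discDev q)) k =
    deriv (deriv (discriminant q)) (k ^ 2) * (2 * k) * (2 * k) +
      deriv (discriminant q) (k ^ 2) * 2 + 2 * Complex.cos k := by
  have hpow : HasDerivAt (fun z : ℂ => z ^ 2) (2 * k) k := by simpa using hasDerivAt_pow 2 k
  have hlin : HasDerivAt (fun z : ℂ => 2 * z) 2 k := by simpa using (hasDerivAt_id k).const_mul 2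
  rw [funext (deriv_discDev hq)]
  exact ((((differentiable_deriv_discriminant hq (k ^ 2)).hasDerivAt.comp k hpow).mul hlin).add
    ((Complex.hasDerivAt_sin k).const_mul 2)).deriv

lemma exists_deriv_deriv_discriminant_ne_zero (hq : IntervalIntegrable q volume 0 1) :
    ∃ R : ℝ, ∀ μ : ℂ, R < ‖μ‖ → deriv (discriminant q) μ = 0 →
      deriv (deriv (discriminant q)) μ ≠ 0 := by
  obtain ⟨C, R, hC, hR, H⟩ := exists_norm_deriv_discDev_le hq
  refine ⟨(R + C) ^ 2, fun μ hμ h₁ h₂ => ?_⟩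
  obtain ⟨k, rfl⟩ := IsAlgClosed.exists_pow_nat_eq μ (n := 2) two_pos
  rw [norm_pow] at hμ
  have hk : R + C < ‖k‖ := lt_of_pow_lt_pow_left₀ 2 (norm_nonneg _) hμ
  obtain ⟨-, hsin, hcos⟩ := H k (by linarith)
  rw [deriv_discDev hq, h₁, zero_mul, zero_add, norm_mul, Complex.norm_ofNat] at hsin
  rw [deriv_deriv_discDev hq, h₁, h₂, zero_mul, zero_mul, zero_mul, zero_add, zero_add, norm_mul,
    Complex.norm_ofNat] at hcos
  have hlt : C * Real.exp |k.im| / ‖k‖ < Real.exp |k.im| := by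
    rw [div_lt_iff₀ (by linarith), mul_comm]
    exact mul_lt_mul_of_pos_left (by linarith) (Real.exp_pos _)
  linarith [exp_le_norm_cos_add_norm_sin k]

lemma exists_deriv_discriminant_ne_zero (hq : IntervalIntegrable q volume 0 1)
    {c : ℂ} (hc : c ^ 2 ≠ 4) :
    ∃ R : ℝ, ∀ μ : ℂ, R < ‖μ‖ → discriminant q μ = c → deriv (discriminant q) μ ≠ 0 := by
  obtain ⟨C, R, hC, hR, H⟩ := exists_norm_deriv_discDev_le hq
  have hd : 0 < ‖4 - c ^ 2‖ := norm_pos_iff.2 (sub_ne_zero.2 (Ne.symm hc))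
  set T := 3 * C * ‖c‖ ^ 2 / ‖4 - c ^ 2‖
  have hT : 0 ≤ T := by positivity
  refine ⟨(R + 2 * C + T) ^ 2, fun μ hμ hF h₁ => ?_⟩
  obtain ⟨k, rfl⟩ := IsAlgClosed.exists_pow_nat_eq μ (n := 2) two_pos
  rw [norm_pow] at hμ
  have hk : R + 2 * C + T < ‖k‖ := lt_of_pow_lt_pow_left₀ 2 (norm_nonneg _) hμ
  have hk₀ : 0 < ‖k‖ := by linarith
  obtain ⟨hcos, hsin, -⟩ := H k (by linarith)
  rw [discDev, hF, norm_sub_rev] at hcos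
  rw [deriv_discDev hq, h₁, zero_mul, zero_add] at hsin
  set ρ := C * Real.exp |k.im| / ‖k‖ with hρ
  have hρ₀ : 0 ≤ ρ := by positivity
  have hρ_half : ρ ≤ Real.exp |k.im| / 2 := by
    rw [hρ, div_le_iff₀ hk₀]
    nlinarith [Real.exp_pos |k.im|]
  have hexp : Real.exp |k.im| ≤ ‖c‖ := by
    have h₂ := norm_le_norm_add_norm_sub' (2 * Complex.cos k) c
    have h₃ := exp_le_norm_cos_add_norm_sin k
    rw [norm_mul, Complex.norm_ofNat] at h₂ hsin
    linarith
  have hlt : 3 * ‖c‖ * ρ < ‖4 - c ^ 2‖ :=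
    calc 3 * ‖c‖ * ρ ≤ 3 * ‖c‖ * (C * ‖c‖ / ‖k‖) := by rw [hρ]; gcongr
      _ = 3 * C * ‖c‖ ^ 2 / ‖k‖ := by ring
      _ < ‖4 - c ^ 2‖ := (div_lt_comm₀ hk₀ hd).2 (by linarith)
  have hle : ‖4 - c ^ 2‖ ≤ 3 * ‖c‖ * ρ :=
    calc ‖4 - c ^ 2‖ ≤ _ := norm_four_sub_sq_le c k
      _ ≤ ρ * (ρ + 2 * ‖c‖) + ρ ^ 2 := by gcongr
      _ ≤ 3 * ‖c‖ * ρ := by nlinarith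
  linarith

lemma discriminant_ne_const (hq : IntervalIntegrable q volume 0 1)
    (c : ℂ) : ∃ μ, discriminant q μ ≠ c := by
  by_contra! h
  obtain ⟨R, hR⟩ := exists_deriv_deriv_discriminant_ne_zero hq
  obtain ⟨μ, hμ⟩ := NormedSpace.exists_lt_norm ℂ ℂ R
  have h₀ : deriv (discriminant q) = fun _ => 0 := by
    rw [show discriminant q = fun _ => c from funext h, deriv_const']
  exact hR μ hμ (by rw [h₀]) (by rw [h₀, deriv_const])

lemma analyticOrderAt_discriminant_ne_top (hq : IntervalIntegrable q volume 0 1) (c μ : ℂ) :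
    analyticOrderAt (fun z => discriminant q z - c) μ ≠ ⊤ := by
  rw [Ne, analyticOrderAt_eq_top]
  intro h
  obtain ⟨z, hz⟩ := discriminant_ne_const hq c
  exact hz (sub_eq_zero.1 (AnalyticOnNhd.eqOn_zero_of_preconnected_of_eventuallyEq_zero
    (fun w _ => ((differentiable_discriminant hq).sub_const c).analyticAt w)
    isPreconnected_univ (mem_univ μ) h (mem_univ z)))

lemma exists_lt_norm_discriminant_eq (hq : IntervalIntegrable q volume 0 1) (c : ℂ) (X : ℝ) :
    ∃ μ : ℂ, X < ‖μ‖ ∧ discriminant q μ = c := by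
  obtain ⟨C, R, -, hR, H⟩ := exists_norm_discDev_le hq
  obtain ⟨r, ⟨hr, hr₁⟩, m, hm, τ, hcos⟩ := exists_sphere_le_norm_two_mul_cos_sub c
  set E := C * Real.exp τ
  obtain ⟨k, hk, rfl, rfl, hsphere⟩ := hcos (max R (max (5 * E / m) (|X| + 2)))
  obtain ⟨hRk, hEk, hXk⟩ : R < ‖k‖ ∧ 5 * E / m < ‖k‖ ∧ |X| + 2 < ‖k‖ := by
    simpa only [max_lt_iff] using hk
  have hk₀ : 0 < ‖k‖ := by linarith
  have hE : E / ‖k‖ ≤ m / 5 := by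
    rw [div_lt_iff₀ hm] at hEk
    rw [div_le_div_iff₀ hk₀ (by norm_num)]
    linarith
  obtain ⟨z, hz, hFz⟩ := exists_mem_closedBall_eq_of_norm_sub_le
    (f := fun z => discriminant q (z ^ 2))
    (by have := differentiable_discriminant hq; fun_prop) hr hm hsphere fun z hz =>
      (H k hRk.le z (Metric.closedBall_subset_closedBall hr₁ hz)).trans hE
  refine ⟨z ^ 2, ?_, hFz⟩
  rw [mem_closedBall_iff_norm'] at hz
  have hz_large : |X| + 1 ≤ ‖z‖ := by linarith [norm_le_norm_add_norm_sub' k z]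
  rw [norm_pow]
  nlinarith [abs_nonneg X, le_abs_self X]

end DiscriminantAsymptotics

section EmbeddingL2

lemma memLp_extend (y : C(unitInterval, ℂ)) :
    MemLp (extend y) 2 (volume.restrict (Icc (0 : ℝ) 1)) :=
  MemLp.of_bound (continuous_extend y).aestronglyMeasurable ‖y‖
    (Eventually.of_forall (norm_extend_le y))

/-- The embedding of the continuous functions into `L₂[0,1]`. -/
noncomputable def toL2 : C(unitInterval, ℂ) →L[ℂ] L2 :=
  LinearMap.mkContinuousOfExistsBound
    { toFun := fun y => (memLp_extend y).toLp
      map_add' := fun y z => MemLp.toLp_add (memLp_extend y) (memLp_extend z)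
      map_smul' := fun c y => MemLp.toLp_const_smul c (memLp_extend y) }
    ⟨_, fun y => Lp.norm_le_of_ae_bound (norm_nonneg y) ((memLp_extend y).coeFn_toLp.mono
      fun x hx => (congrArg norm hx).trans_le (norm_extend_le y x))⟩

lemma coeFn_toL2 (y : C(unitInterval, ℂ)) :
    (toL2 y : ℝ → ℂ) =ᵐ[volume.restrict (Icc (0 : ℝ) 1)] extend y :=
  (memLp_extend y).coeFn_toLp

lemma toL2_injective : Function.Injective toL2 := by
  intro y z h
  have hae : extend y =ᵐ[volume.restrict (Icc (0 : ℝ) 1)] extend z :=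
    (coeFn_toL2 y).symm.trans (h ▸ coeFn_toL2 z)
  have heq := Measure.eqOn_Icc_of_ae_eq volume zero_ne_one hae (continuous_extend y).continuousOn
    (continuous_extend z).continuousOn
  ext x
  have hx := heq x.2
  rwa [extend_apply _ x.2, extend_apply _ x.2] at hx

lemma intervalIntegrable_coeFn (f : L2) : IntervalIntegrable (f : ℝ → ℂ) volume 0 1 :=
  intervalIntegrable_of_Icc ((Lp.memLp f).integrable one_le_two) ⟨zero_le_one, le_rfl⟩

lemma inner_toL2_star (z : C(unitInterval, ℂ)) (f : L2) :
    inner ℂ (toL2 (star z)) f = ∫ s in (0 : ℝ)..1, extend z s * (f : ℝ → ℂ) s := by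
  rw [L2.inner_def, intervalIntegral.integral_of_le zero_le_one, ← integral_Icc_eq_integral_Ioc]
  refine integral_congr_ae ?_
  filter_upwards [coeFn_toL2 (star z)] with s hs
  rw [hs, show extend (star z) s = starRingEnd ℂ (extend z s) from rfl, RCLike.inner_apply,
    Complex.conj_conj, mul_comm]

/-- The bilinear pairing `∫₀¹ z y`. -/
noncomputable def pairing (z y : C(unitInterval, ℂ)) : ℂ := inner ℂ (toL2 (star z)) (toL2 y)

lemma pairing_eq (z y : C(unitInterval, ℂ)) :
    pairing z y = ∫ s in (0 : ℝ)..1, extend z s * extend y s := by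
  rw [pairing, inner_toL2_star]
  refine intervalIntegral.integral_congr_ae_restrict ?_
  rw [uIoc_of_le zero_le_one]
  refine ae_restrict_of_ae_restrict_of_subset Ioc_subset_Icc_self ?_
  filter_upwards [coeFn_toL2 y] with s hs
  rw [hs]

lemma pairing_comm (z y : C(unitInterval, ℂ)) : pairing z y = pairing y z := by
  simp only [pairing_eq, mul_comm]

end EmbeddingL2

section SymplecticForm

variable {K : Type*} [Field K]

/-- The standard symplectic form on the plane; evaluated at the Cauchy data of two solutions it is
their Wronskian. -/
def symp (v w : K × K) : K := v.1 * w.2 - v.2 * w.1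

lemma symp_swap (v w : K × K) : symp v w = -symp w v := by
  simp only [symp]
  ring

lemma symp_smul_left (c : K) (v w : K × K) :
    symp (c • v) w = c * symp v w := by
  simp only [symp, Prod.smul_fst, Prod.smul_snd, smul_eq_mul]
  ring

lemma symp_smul_right (c : K) (v w : K × K) :
    symp v (c • w) = c * symp v w := by
  rw [symp_swap, symp_smul_left, symp_swap w, mul_neg, neg_neg]

lemma end_prod_apply (L : Module.End K (K × K)) (v : K × K) :
    L v = v.1 • L (1, 0) + v.2 • L (0, 1) := by
  simp [← map_smul, ← map_add]

lemma symp_map_add_symp_map (L : Module.End K (K × K)) (v w : K × K) :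
    symp (L v) w + symp v (L w) = ((L (1, 0)).1 + (L (0, 1)).2) * symp v w := by
  rw [end_prod_apply L v, end_prod_apply L w]
  simp only [symp, Prod.fst_add, Prod.snd_add, Prod.smul_fst, Prod.smul_snd, smul_eq_mul]
  ring

lemma exists_smul_of_symp_eq_zero {v w : K × K} (hv : v ≠ 0) (h : symp v w = 0) :
    ∃ c : K, w = c • v := by
  rw [symp, sub_eq_zero] at h
  by_cases h₁ : v.1 = 0
  · have h₂ : v.2 ≠ 0 := fun h₂ => hv (Prod.ext h₁ h₂)
    rw [h₁, zero_mul, eq_comm, mul_eq_zero, or_iff_right h₂] at h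
    exact ⟨w.2 / v.2, Prod.ext (by simp [h, h₁]) (by simp [h₂])⟩
  · exact ⟨w.1 / v.1, Prod.ext (by simp [h₁]) (by simp; field_simp; linear_combination h)⟩

lemma hasEigenvalue_prod_iff (L : Module.End K (K × K)) (e : K) : L.HasEigenvalue e ↔
    ((L (1, 0)).1 - e) * ((L (0, 1)).2 - e) - (L (0, 1)).1 * (L (1, 0)).2 = 0 := by
  rw [Module.End.hasEigenvalue_iff, Module.End.eigenspace_def,
    ← LinearMap.det_eq_zero_iff_ker_ne_bot,
    ← LinearMap.det_toMatrix (Module.Basis.finTwoProd K), Matrix.det_fin_two]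
  simp [LinearMap.toMatrix_apply]

end SymplecticForm

section Monodromy

variable {q : ℝ → ℂ} (hq : IntervalIntegrable q volume 0 1)

lemma Solves.symp_monodromy_sub {μ : ℂ} {f y dy : ℝ → ℂ} (hy : Solves q (f + μ • y) y dy)
    (w : ℂ × ℂ) : symp (y 1, dy 1) (monodromy hq μ w) - symp (y 0, dy 0) w =
      ∫ s in (0 : ℝ)..1, extend (flow hq μ w) s * f s := by
  have h := hy.green (solves_flow hq μ w)
  have e : ∀ s, y s * (μ • extend (flow hq μ w)) s - (f + μ • y) s * extend (flow hq μ w) s =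
      -(extend (flow hq μ w) s * f s) := fun s => by
    simp only [Pi.add_apply, Pi.smul_apply, smul_eq_mul]
    ring
  simp only [e, intervalIntegral.integral_neg, extend_flow_zero, extend_flowDeriv_zero] at h
  simp only [symp, monodromy_apply]
  linear_combination h

lemma symp_monodromy_sub (lam μ : ℂ) (v w : ℂ × ℂ) :
    symp (monodromy hq lam v) (monodromy hq μ w) - symp v w =
      (lam - μ) * pairing (flow hq μ w) (flow hq lam v) := by
  have hy : Solves q ((lam - μ) • extend (flow hq lam v) + μ • extend (flow hq lam v))
      (extend (flow hq lam v)) (extend (flowDeriv hq lam v)) := by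
    rw [← add_smul, sub_add_cancel]
    exact solves_flow hq lam v
  have h := hy.symp_monodromy_sub hq w
  rw [extend_flow_zero, extend_flowDeriv_zero, ← monodromy_apply] at h
  rw [h, pairing_eq, ← intervalIntegral.integral_const_mul]
  simp only [Pi.smul_apply, smul_eq_mul, mul_left_comm]

lemma symp_monodromy (μ : ℂ) (v w : ℂ × ℂ) :
    symp (monodromy hq μ v) (monodromy hq μ w) = symp v w := by
  rw [← sub_eq_zero, symp_monodromy_sub, sub_self, zero_mul]

lemma det_monodromy (μ : ℂ) :
    (monodromy hq μ (1, 0)).1 * (monodromy hq μ (0, 1)).2 -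
      (monodromy hq μ (1, 0)).2 * (monodromy hq μ (0, 1)).1 = 1 := by
  simpa [symp] using symp_monodromy hq μ (1, 0) (0, 1)

lemma hasEigenvalue_monodromy_iff (μ : ℂ) {e : ℂ} (he : e ≠ 0) :
    Module.End.HasEigenvalue (monodromy hq μ : ℂ × ℂ →ₗ[ℂ] ℂ × ℂ) e ↔
      discriminant q μ = e + e⁻¹ := by
  have hdet := det_monodromy hq μ
  rw [hasEigenvalue_prod_iff, discriminant_eq hq]
  simp only [ContinuousLinearMap.coe_coe]
  constructor
  · intro h
    field_simp
    linear_combination hdet - h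
  · intro h
    field_simp at h
    linear_combination hdet - h

/-- The embedding of the initial data into `L₂[0,1]` by the solutions. -/
noncomputable def flowL2 (μ : ℂ) : ℂ × ℂ →L[ℂ] L2 := toL2.comp (flow hq μ)

lemma flow_injective (μ : ℂ) : Function.Injective (flow hq μ) := by
  refine (injective_iff_map_eq_zero _).2 fun v hv => ?_
  obtain ⟨hy, hdy⟩ := solves_iff_isPrimitiveOn.1 (solves_flow hq μ v)
  have hy₀ : extend (flow hq μ v) = 0 := by rw [hv]; rfl
  have hdy_const : ∀ x ∈ uIcc (0 : ℝ) 1, extend (flowDeriv hq μ v) x = v.2 := fun x hx => by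
    simp [hdy.eq_integral x hx, hy₀, extend_flowDeriv_zero]
  have hv₂ := hy.integral_eq_sub
  rw [intervalIntegral.integral_congr hdy_const, hy₀] at hv₂
  refine Prod.ext ?_ (by simpa using hv₂)
  rw [← extend_flow_zero hq μ v, hy₀]
  rfl

lemma flowL2_injective (μ : ℂ) : Function.Injective (flowL2 hq μ) :=
  toL2_injective.comp (flow_injective hq μ)

lemma eigenspace_eq_map (t : ℝ) (μ : ℂ) : eigenspace (graph q t) μ =
    (Module.End.eigenspace (monodromy hq μ : ℂ × ℂ →ₗ[ℂ] ℂ × ℂ)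
      (Complex.exp (Complex.I * t))).map (flowL2 hq μ : ℂ × ℂ →ₗ[ℂ] L2) := by
  ext u
  simp only [Submodule.mem_map, Module.End.mem_eigenspace_iff, ContinuousLinearMap.coe_coe]
  constructor
  · rintro ⟨y, dy, huy, hy, hy₁, hdy₁⟩
    have hs : Solves q (μ • y) y dy :=
      hy.congr_right ((Lp.coeFn_smul μ u).trans (huy.const_smul μ))
    refine ⟨(y 0, dy 0), ?_, Lp.ext ((coeFn_toL2 _).trans ?_)⟩
    · rw [monodromy_apply, ← hs.eq_flow hq ⟨zero_le_one, le_rfl⟩, hy₁, hdy₁]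
      rfl
    · filter_upwards [huy, ae_restrict_mem measurableSet_Icc] with x hux hx
      exact (congrArg Prod.fst (hs.eq_flow hq hx)).symm.trans hux.symm
  · rintro ⟨v, hv, rfl⟩
    rw [monodromy_apply, Prod.ext_iff] at hv
    refine ⟨extend (flow hq μ v), extend (flowDeriv hq μ v), coeFn_toL2 _,
      (solves_flow hq μ v).congr_right ?_, ?_, ?_⟩
    · exact ((Lp.coeFn_smul μ _).trans ((coeFn_toL2 _).const_smul μ)).symm
    · rw [extend_flow_zero]; exact hv.1
    · rw [extend_flowDeriv_zero]; exact hv.2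

lemma exp_I_mul_add_inv (t : ℝ) :
    Complex.exp (Complex.I * t) + (Complex.exp (Complex.I * t))⁻¹ = 2 * (Real.cos t : ℂ) := by
  rw [← Complex.exp_neg, Complex.ofReal_cos, Complex.two_cos]
  congr 2 <;> ring

lemma isEigenvalue_iff (hq : IntervalIntegrable q volume 0 1) (t : ℝ) (μ : ℂ) :
    IsEigenvalue q t μ ↔ discriminant q μ = 2 * (Real.cos t : ℂ) := by
  rw [← exp_I_mul_add_inv, ← hasEigenvalue_monodromy_iff hq μ (Complex.exp_ne_zero _),
    IsEigenvalue, eigenspace_eq_map hq, Module.End.hasEigenvalue_iff, Ne, Ne,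
    (Submodule.map_injective_of_injective (flowL2_injective hq μ)).eq_iff' (Submodule.map_bot _)]

lemma geomMult_eq_one_iff {t : ℝ} {μ : ℂ} (h : IsEigenvalue q t μ) :
    geomMult q t μ = 1 ↔ ¬ ∀ v, monodromy hq μ v = Complex.exp (Complex.I * t) • v := by
  set K := Module.End.eigenspace (monodromy hq μ : ℂ × ℂ →ₗ[ℂ] ℂ × ℂ)
    (Complex.exp (Complex.I * t)) with hK
  have hgeom : geomMult q t μ = Module.finrank ℂ K := by
    rw [geomMult, eigenspace_eq_map hq]
    exact (Submodule.equivMapOfInjective _ (flowL2_injective hq μ) K).finrank_eq.symm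
  have hpos : Module.finrank ℂ K ≠ 0 := fun h₀ => h <| by
    rw [eigenspace_eq_map hq, ← hK, Submodule.finrank_eq_zero.1 h₀, Submodule.map_bot]
  have htop : K = ⊤ ↔ ∀ v, monodromy hq μ v = Complex.exp (Complex.I * t) • v := by
    simp [hK, Submodule.eq_top_iff']
  have hprod : Module.finrank ℂ (ℂ × ℂ) = 2 := by simp
  rw [hgeom, ← htop]
  refine ⟨fun h₁ h₂ => ?_, fun hne => ?_⟩
  · rw [h₂, finrank_top, hprod] at h₁
    omega
  · have hlt := Submodule.finrank_lt hne
    omega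

end Monodromy

section ObliqueProjection

variable {𝕜 E : Type*} [RCLike 𝕜] [NormedAddCommGroup E] [InnerProductSpace 𝕜 E]

lemma eq_inv_inner_smul_rankOne_iff {ψ ψs : E} (h : inner 𝕜 ψs ψ ≠ 0) (P : E →L[𝕜] E) :
    P = (inner 𝕜 ψs ψ)⁻¹ • InnerProductSpace.rankOne 𝕜 ψ ψs ↔
      IsIdempotentElem P ∧ LinearMap.range (P : E →ₗ[𝕜] E) = Submodule.span 𝕜 {ψ} ∧
        LinearMap.ker (P : E →ₗ[𝕜] E) = (Submodule.span 𝕜 {ψs})ᗮ := by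
  have hψ : ψ ≠ 0 := fun h₀ => h (by rw [h₀, inner_zero_right])
  constructor
  · rintro rfl
    have happly : ∀ f, ((inner 𝕜 ψs ψ)⁻¹ • InnerProductSpace.rankOne 𝕜 ψ ψs) f =
        ((inner 𝕜 ψs ψ)⁻¹ * inner 𝕜 ψs f) • ψ := fun f => mul_smul _ _ _ |>.symm
    have hself : ((inner 𝕜 ψs ψ)⁻¹ • InnerProductSpace.rankOne 𝕜 ψ ψs) ψ = ψ := by
      rw [happly, inv_mul_cancel₀ h, one_smul]
    refine ⟨ContinuousLinearMap.ext fun f => ?_, le_antisymm ?_ ?_, ?_⟩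
    · rw [mul_apply_eq_comp, happly f, map_smul, hself]
    · rintro _ ⟨f, rfl⟩
      exact Submodule.mem_span_singleton.2 ⟨_, (happly f).symm⟩
    · exact (Submodule.span_singleton_le_iff_mem _ _).2 ⟨ψ, hself⟩
    · ext f
      rw [LinearMap.mem_ker, ContinuousLinearMap.coe_coe, happly, smul_eq_zero_iff_left hψ,
        mul_eq_zero_iff_left (inv_ne_zero h), Submodule.mem_orthogonal_singleton_iff_inner_right]
  · rintro ⟨hidem, hrange, hker⟩
    obtain ⟨x, hx⟩ : ψ ∈ LinearMap.range (P : E →ₗ[𝕜] E) :=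
      hrange ▸ Submodule.mem_span_singleton_self ψ
    have hself : P ψ = ψ := by
      rw [← hx]
      exact congrArg (fun A : E →L[𝕜] E => A x) hidem
    ext f
    have hmem : f - ((inner 𝕜 ψs ψ)⁻¹ * inner 𝕜 ψs f) • ψ ∈ LinearMap.ker (P : E →ₗ[𝕜] E) := by
      rw [hker, Submodule.mem_orthogonal_singleton_iff_inner_right, inner_sub_right,
        inner_smul_right, mul_right_comm, inv_mul_cancel₀ h, one_mul, sub_self]
    rw [LinearMap.mem_ker, ContinuousLinearMap.coe_coe, map_sub, map_smul, hself,
      sub_eq_zero] at hmem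
    rw [hmem, mul_smul]
    rfl

end ObliqueProjection

section Adjoint

lemma eigenspace_adjoint (G : Submodule ℂ (L2 × L2)) (μ : ℂ) :
    eigenspace G.adjoint (starRingEnd ℂ μ) = (rangeSub G μ)ᗮ := by
  ext u
  have hmem : u ∈ eigenspace G.adjoint (starRingEnd ℂ μ) ↔
      ((u, starRingEnd ℂ μ • u) : L2 × L2) ∈ G.adjoint := Iff.rfl
  have hinner : ∀ a b : L2, inner ℂ b u - inner ℂ a (starRingEnd ℂ μ • u) =
      inner ℂ (b - μ • a) u := fun a b => by
    rw [inner_smul_right, inner_sub_left, inner_smul_left]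
  rw [hmem, Submodule.mem_adjoint_iff, Submodule.mem_orthogonal]
  simp only [hinner]
  exact ⟨fun H => by rintro _ ⟨⟨a, b⟩, hab, rfl⟩; exact H a b hab,
    fun H a b hab => H _ ⟨(a, b), hab, rfl⟩⟩

lemma coeFn_add_smul_ae_eq {u f : L2} {y : ℝ → ℂ} (μ : ℂ)
    (hu : (u : ℝ → ℂ) =ᵐ[volume.restrict (Icc (0 : ℝ) 1)] y) :
    ((f + μ • u : L2) : ℝ → ℂ) =ᵐ[volume.restrict (Icc (0 : ℝ) 1)] (f : ℝ → ℂ) + μ • y :=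
  (Lp.coeFn_add _ _).trans
    ((EventuallyEq.refl _ _).add ((Lp.coeFn_smul μ u).trans (hu.const_smul μ)))

lemma mem_rangeSub_graph_iff {q : ℝ → ℂ} {t : ℝ} {μ : ℂ} {f : L2} :
    f ∈ rangeSub (graph q t) μ ↔ ∃ y dy : ℝ → ℂ, Solves q ((f : ℝ → ℂ) + μ • y) y dy ∧
      y 1 = Complex.exp (Complex.I * t) * y 0 ∧ dy 1 = Complex.exp (Complex.I * t) * dy 0 := by
  constructor
  · rintro ⟨⟨u, g⟩, ⟨y, dy, hu, hy, hy₁, hdy₁⟩, hg⟩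
    obtain rfl : f + μ • u = g := sub_eq_iff_eq_add.1 hg |>.symm
    exact ⟨y, dy, hy.congr_right (coeFn_add_smul_ae_eq μ hu), hy₁, hdy₁⟩
  · rintro ⟨y, dy, hy, hy₁, hdy₁⟩
    have hmem : MemLp y 2 (volume.restrict (Icc (0 : ℝ) 1)) := by
      obtain ⟨B, hB⟩ := isCompact_Icc.exists_bound_of_continuousOn hy.cont
      exact MemLp.of_bound (hy.cont.aestronglyMeasurable measurableSet_Icc) B
        ((ae_restrict_mem measurableSet_Icc).mono hB)
    exact ⟨(hmem.toLp, f + μ • hmem.toLp), ⟨y, dy, hmem.coeFn_toLp,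
      hy.congr_right (coeFn_add_smul_ae_eq μ hmem.coeFn_toLp).symm, hy₁, hdy₁⟩,
      add_sub_cancel_right f _⟩

end Adjoint

section FloquetPair

variable {q : ℝ → ℂ} {hq : IntervalIntegrable q volume 0 1} {t : ℝ} {μ : ℂ} {v w : ℂ × ℂ}

variable (hq) in
/-- The Floquet data of a spectral parameter: `v` and `w` are eigenvectors of the monodromy
operator with distinct multipliers `e^{it}` and `e^{-it}`. -/
structure IsFloquetPair (t : ℝ) (μ : ℂ) (v w : ℂ × ℂ) : Prop where
  left_ne : v ≠ 0
  right_ne : w ≠ 0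
  left_eq : monodromy hq μ v = Complex.exp (Complex.I * t) • v
  right_eq : monodromy hq μ w = (Complex.exp (Complex.I * t))⁻¹ • w
  ne_inv : Complex.exp (Complex.I * t) ≠ (Complex.exp (Complex.I * t))⁻¹

lemma exp_I_mul_sub_inv (t : ℝ) :
    Complex.exp (Complex.I * t) - (Complex.exp (Complex.I * t))⁻¹ =
      2 * Complex.I * (Real.sin t : ℂ) := by
  have h := Complex.two_sin (t : ℂ)
  rw [show -(t : ℂ) * Complex.I = -(Complex.I * t) by ring, mul_comm (t : ℂ)] at h
  rw [← Complex.exp_neg, Complex.ofReal_sin]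
  linear_combination (-Complex.I) * h - (Complex.exp (-(Complex.I * t)) -
    Complex.exp (Complex.I * t)) * Complex.I_mul_I

variable (hq) in
lemma exists_isFloquetPair (h : discriminant q μ = 2 * (Real.cos t : ℂ))
    (ht : Real.sin t ≠ 0) : ∃ v w, IsFloquetPair hq t μ v w := by
  have he := Complex.exp_ne_zero (Complex.I * t)
  rw [← exp_I_mul_add_inv] at h
  obtain ⟨v, hv⟩ := ((hasEigenvalue_monodromy_iff hq μ he).2 h).exists_hasEigenvector
  obtain ⟨w, hw⟩ := ((hasEigenvalue_monodromy_iff hq μ (inv_ne_zero he)).2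
    (by rw [h, inv_inv, add_comm])).exists_hasEigenvector
  refine ⟨v, w, hv.2, hw.2, hv.apply_eq_smul, hw.apply_eq_smul, ?_⟩
  rw [← sub_ne_zero, exp_I_mul_sub_inv]
  exact mul_ne_zero (by simp) (Complex.ofReal_ne_zero.2 ht)

namespace IsFloquetPair

lemma eigenspace_eq (h : IsFloquetPair hq t μ v w) :
    eigenspace (graph q t) μ = Submodule.span ℂ {flowL2 hq μ v} := by
  rw [eigenspace_eq_map hq, ← ContinuousLinearMap.coe_coe (flowL2 hq μ), ← image_singleton,
    ← Submodule.map_span]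
  congr 1
  ext v'
  rw [Module.End.mem_eigenspace_iff, ContinuousLinearMap.coe_coe, Submodule.mem_span_singleton]
  constructor
  · intro hv'
    have hs := symp_monodromy hq μ v v'
    rw [h.left_eq, hv'] at hs
    have hzero : (Complex.exp (Complex.I * t) - (Complex.exp (Complex.I * t))⁻¹) *
        symp v v' = 0 := by
      have he := Complex.exp_ne_zero (Complex.I * t)
      simp only [symp, Prod.smul_fst, Prod.smul_snd, smul_eq_mul] at hs ⊢
      field_simp
      linear_combination hs
    obtain ⟨c, hc⟩ := exists_smul_of_symp_eq_zero h.left_ne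
      ((mul_eq_zero.1 hzero).resolve_left (sub_ne_zero.2 h.ne_inv))
    exact ⟨c, hc.symm⟩
  · rintro ⟨c, rfl⟩
    rw [map_smul, h.left_eq, smul_comm]

lemma inner_eq_symp_sub (h : IsFloquetPair hq t μ v w) {f : L2} {y dy : ℝ → ℂ}
    (hy : Solves q ((f : ℝ → ℂ) + μ • y) y dy) :
    inner ℂ (toL2 (star (flow hq μ w))) f =
      (Complex.exp (Complex.I * t))⁻¹ * symp (y 1, dy 1) w - symp (y 0, dy 0) w := by
  rw [inner_toL2_star, ← hy.symp_monodromy_sub hq w, h.right_eq]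
  simp only [symp, Prod.smul_fst, Prod.smul_snd, smul_eq_mul]
  ring

lemma rangeSub_eq (h : IsFloquetPair hq t μ v w) :
    rangeSub (graph q t) μ = (Submodule.span ℂ {toL2 (star (flow hq μ w))})ᗮ := by
  have he := Complex.exp_ne_zero (Complex.I * t)
  ext f
  rw [mem_rangeSub_graph_iff, Submodule.mem_orthogonal_singleton_iff_inner_right]
  constructor
  · rintro ⟨y, dy, hy, hy₁, hdy₁⟩
    rw [h.inner_eq_symp_sub hy, hy₁, hdy₁]
    simp only [symp]
    field_simp
    ring
  · intro hf
    obtain ⟨y, dy, hy, hy₀, hdy₀⟩ := exists_solves hq μ (intervalIntegrable_coeFn f) 0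
    obtain ⟨κ, hκ⟩ : ∃ κ : ℂ, (y 1, dy 1) = κ • w := by
      rw [h.inner_eq_symp_sub hy, hy₀, hdy₀] at hf
      refine exists_smul_of_symp_eq_zero h.right_ne ?_
      simp only [symp, Prod.fst_zero, Prod.snd_zero, zero_mul, sub_zero, mul_eq_zero,
        inv_eq_zero, he, false_or] at hf ⊢
      linear_combination -hf
    obtain ⟨hκ₁, hκ₂⟩ := Prod.ext_iff.1 hκ
    have hw := h.right_eq
    rw [monodromy_apply, Prod.ext_iff] at hw
    obtain ⟨hw₁, hw₂⟩ := hw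
    have hne := sub_ne_zero.2 h.ne_inv
    -- Adding `c` times the solution with multiplier `e^{-it}` restores the boundary conditions.
    obtain ⟨c, hc⟩ : ∃ c, κ + c * (Complex.exp (Complex.I * t))⁻¹ =
        Complex.exp (Complex.I * t) * c :=
      ⟨κ / (Complex.exp (Complex.I * t) - (Complex.exp (Complex.I * t))⁻¹), by
        linear_combination -(div_mul_cancel₀ κ hne)⟩
    refine ⟨y + c • extend (flow hq μ w), dy + c • extend (flowDeriv hq μ w), ?_, ?_, ?_⟩
    · rw [smul_add, smul_comm μ c, ← add_assoc]
      exact hy.add ((solves_flow hq μ w).smul c)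
    · simp only [Pi.add_apply, Pi.smul_apply, smul_eq_mul, Prod.smul_fst] at hκ₁ hw₁ ⊢
      rw [hκ₁, hw₁, hy₀, extend_flow_zero, Prod.fst_zero]
      linear_combination w.1 * hc
    · simp only [Pi.add_apply, Pi.smul_apply, smul_eq_mul, Prod.smul_snd] at hκ₂ hw₂ ⊢
      rw [hκ₂, hw₂, hdy₀, extend_flowDeriv_zero, Prod.snd_zero]
      linear_combination w.2 * hc

lemma adjoint_eigenspace_eq (h : IsFloquetPair hq t μ v w) :
    eigenspace (graph q t).adjoint (starRingEnd ℂ μ) =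
      Submodule.span ℂ {toL2 (star (flow hq μ w))} := by
  rw [eigenspace_adjoint, h.rangeSub_eq, Submodule.orthogonal_orthogonal]

end IsFloquetPair

variable (hq) in
/-- The modulus of `α = (Ψ*, Ψ)`, where `Ψ` and `Ψ*` are the normalized multiples of the solution
with the initial data `v` and of the complex conjugate of the solution with the initial
data `w`. -/
noncomputable def alpha (μ : ℂ) (v w : ℂ × ℂ) : ℝ :=
  ‖pairing (flow hq μ w) (flow hq μ v)‖ / (‖toL2 (star (flow hq μ w))‖ * ‖flowL2 hq μ v‖)

lemma isSpectralProjection_iff (h : IsFloquetPair hq t μ v w)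
    (hne : pairing (flow hq μ w) (flow hq μ v) ≠ 0) {P : L2 →L[ℂ] L2} :
    IsSpectralProjection q t μ P ↔ P = (pairing (flow hq μ w) (flow hq μ v))⁻¹ •
      InnerProductSpace.rankOne ℂ (flowL2 hq μ v) (toL2 (star (flow hq μ w))) := by
  refine Iff.trans ?_ (eq_inv_inner_smul_rankOne_iff (ψ := flowL2 hq μ v) hne P).symm
  rw [← h.eigenspace_eq, ← h.rangeSub_eq]
  exact ⟨fun hP => ⟨hP.idem, hP.range_eq, hP.ker_eq⟩, fun hP => ⟨hP.1, hP.2.1, hP.2.2⟩⟩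

lemma norm_spectralProjection (h : IsFloquetPair hq t μ v w)
    (hne : pairing (flow hq μ w) (flow hq μ v) ≠ 0) {P : L2 →L[ℂ] L2}
    (hP : IsSpectralProjection q t μ P) : ‖P‖ = (alpha hq μ v w)⁻¹ := by
  rw [(isSpectralProjection_iff h hne).1 hP, norm_smul, InnerProductSpace.norm_rankOne, alpha,
    inv_div, norm_inv]
  ring

lemma norm_inner_eq_alpha (h : IsFloquetPair hq t μ v w) {Ψ Ψs : L2}
    (hΨ : Ψ ∈ eigenspace (graph q t) μ) (hΨ_norm : ‖Ψ‖ = 1)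
    (hΨs : Ψs ∈ eigenspace (graph q t).adjoint (starRingEnd ℂ μ)) (hΨs_norm : ‖Ψs‖ = 1) :
    ‖inner ℂ Ψs Ψ‖ = alpha hq μ v w := by
  rw [h.eigenspace_eq, Submodule.mem_span_singleton] at hΨ
  rw [h.adjoint_eigenspace_eq, Submodule.mem_span_singleton] at hΨs
  obtain ⟨a, rfl⟩ := hΨ
  obtain ⟨b, rfl⟩ := hΨs
  rw [norm_smul] at hΨ_norm hΨs_norm
  have hv : ‖flowL2 hq μ v‖ ≠ 0 := right_ne_zero_of_mul_eq_one hΨ_norm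
  have hw : ‖toL2 (star (flow hq μ w))‖ ≠ 0 := right_ne_zero_of_mul_eq_one hΨs_norm
  rw [inner_smul_left, inner_smul_right, norm_mul, norm_mul, RCLike.norm_conj,
    eq_inv_of_mul_eq_one_left hΨ_norm, eq_inv_of_mul_eq_one_left hΨs_norm, alpha, pairing]
  change _ * (_ * ‖inner ℂ _ (flowL2 hq μ v)‖) = ‖inner ℂ _ (flowL2 hq μ v)‖ / _
  field_simp

lemma norm_toL2_star (y : C(unitInterval, ℂ)) : ‖toL2 (star y)‖ = ‖toL2 y‖ := by
  rw [Lp.norm_def, Lp.norm_def]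
  congr 1
  refine eLpNorm_congr_norm_ae ?_
  filter_upwards [coeFn_toL2 (star y), coeFn_toL2 y] with s hs hs'
  rw [hs, hs', show extend (star y) s = starRingEnd ℂ (extend y s) from rfl, RCLike.norm_conj]

lemma flowL2_ne_zero (hv : v ≠ 0) : flowL2 hq μ v ≠ 0 :=
  (map_ne_zero_iff _ (flowL2_injective hq μ)).2 hv

lemma toL2_star_flow_ne_zero (hw : w ≠ 0) : toL2 (star (flow hq μ w)) ≠ 0 := by
  rw [← norm_ne_zero_iff, norm_toL2_star]
  exact norm_ne_zero_iff.2 (flowL2_ne_zero hw)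

lemma IsFloquetPair.exists_normalized (h : IsFloquetPair hq t μ v w) : ∃ Ψ Ψs : L2,
    Ψ ∈ eigenspace (graph q t) μ ∧ ‖Ψ‖ = 1 ∧
      Ψs ∈ eigenspace (graph q t).adjoint (starRingEnd ℂ μ) ∧ ‖Ψs‖ = 1 := by
  refine ⟨(‖flowL2 hq μ v‖⁻¹ : ℂ) • flowL2 hq μ v,
    (‖toL2 (star (flow hq μ w))‖⁻¹ : ℂ) • toL2 (star (flow hq μ w)), ?_,
    norm_smul_inv_norm (flowL2_ne_zero h.left_ne), ?_,
    norm_smul_inv_norm (toL2_star_flow_ne_zero h.right_ne)⟩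
  · rw [h.eigenspace_eq]
    exact Submodule.smul_mem _ _ (Submodule.mem_span_singleton_self _)
  · rw [h.adjoint_eigenspace_eq]
    exact Submodule.smul_mem _ _ (Submodule.mem_span_singleton_self _)

end FloquetPair

section LocalAnalysis

lemma isTheta_pow_of_analyticOrderAt_eq {𝕜 E : Type*} [NontriviallyNormedField 𝕜]
    [NormedAddCommGroup E] [NormedSpace 𝕜 E] {f : 𝕜 → E} {z₀ : 𝕜} {n : ℕ}
    (hf : AnalyticAt 𝕜 f z₀) (hn : analyticOrderAt f z₀ = n) :
    f =Θ[𝓝 z₀] fun z => (z - z₀) ^ n := by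
  obtain ⟨g, hg, hg₀, hfg⟩ := hf.analyticOrderAt_eq_natCast.1 hn
  have h := (Asymptotics.isTheta_refl (fun z => (z - z₀) ^ n) (𝓝 z₀)).smul
    (((Asymptotics.isEquivalent_const_iff_tendsto hg₀).2 hg.continuousAt.tendsto).isTheta.trans
      (Asymptotics.isTheta_const_const hg₀ (one_ne_zero' 𝕜)))
  simp only [smul_eq_mul, mul_one] at h
  exact EventuallyEq.trans_isTheta hfg h

lemma exists_analyticAt_pow_eq {g : ℂ → ℂ} {z₀ : ℂ} {n : ℕ} (hn : n ≠ 0)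
    (hg : AnalyticAt ℂ g z₀) (hg₀ : g z₀ ≠ 0) :
    ∃ r : ℂ → ℂ, AnalyticAt ℂ r z₀ ∧ r z₀ ≠ 0 ∧ ∀ᶠ z in 𝓝 z₀, r z ^ n = g z := by
  obtain ⟨κ, hκ⟩ := IsAlgClosed.exists_pow_nat_eq (g z₀) (Nat.pos_of_ne_zero hn)
  have hlog : AnalyticAt ℂ (fun z => Complex.log (g z / g z₀)) z₀ :=
    hg.div_const.clog (by simp [div_self hg₀])
  refine ⟨fun z => κ * Complex.exp (Complex.log (g z / g z₀) / n),
    analyticAt_const.mul hlog.div_const.cexp, ?_, ?_⟩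
  · have hκ₀ : κ ≠ 0 := by
      rintro rfl
      exact hg₀ (by rw [← hκ, zero_pow hn])
    exact mul_ne_zero hκ₀ (Complex.exp_ne_zero _)
  · filter_upwards [hg.continuousAt.eventually_ne hg₀] with z hz
    rw [mul_pow, hκ, ← Complex.exp_nat_mul, mul_div_cancel₀ _ (Nat.cast_ne_zero.2 hn),
      Complex.exp_log (div_ne_zero hz hg₀), mul_div_cancel₀ _ hg₀]

lemma exists_analyticAt_eq_pow {f : ℂ → ℂ} {z₀ : ℂ} {n : ℕ} (hn : n ≠ 0)
    (hf : AnalyticAt ℂ f z₀) (hfn : analyticOrderAt f z₀ = n) :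
    ∃ ρ : ℂ → ℂ, AnalyticAt ℂ ρ 0 ∧ ρ 0 = z₀ ∧ ∀ᶠ ζ in 𝓝 0, f (ρ ζ) = ζ ^ n := by
  obtain ⟨g, hg, hg₀, hfg⟩ := hf.analyticOrderAt_eq_natCast.1 hfn
  obtain ⟨r, hr, hr₀, hrg⟩ := exists_analyticAt_pow_eq hn hg hg₀
  have hW : AnalyticAt ℂ (fun z => (z - z₀) * r z) z₀ :=
    (analyticAt_id.sub analyticAt_const).mul hr
  have hW' : deriv (fun z => (z - z₀) * r z) z₀ ≠ 0 := by
    have h := ((hasDerivAt_id z₀).sub_const z₀).mul hr.differentiableAt.hasDerivAt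
    simp only [id, sub_self, zero_mul, add_zero, one_mul] at h
    exact h.deriv ▸ hr₀
  have hρ := hW.analyticAt_localInverse hW'
  have hρ₀ := (hW.hasStrictDerivAt.eventually_left_inverse hW').self_of_nhds
  have hWρ := hW.hasStrictDerivAt.eventually_right_inverse hW'
  set ρ := hW.hasStrictDerivAt.localInverse _ _ _ hW'
  simp only [sub_self, zero_mul] at hρ hρ₀ hWρ
  have hρ_tendsto := hρ.continuousAt.tendsto
  rw [hρ₀] at hρ_tendsto
  refine ⟨ρ, hρ, hρ₀, ?_⟩
  filter_upwards [hWρ, hρ_tendsto.eventually hrg, hρ_tendsto.eventually hfg] with ζ h₁ h₂ h₃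
  rw [h₃, smul_eq_mul, ← h₂, ← mul_pow, h₁]

end LocalAnalysis

section DoublePoint

variable {q : ℝ → ℂ} {t₀ : ℝ} {lam₀ : ℂ}

lemma analyticAt_discriminant_sub (hq : IntervalIntegrable q volume 0 1) (c μ : ℂ) :
    AnalyticAt ℂ (fun z => discriminant q z - c) μ :=
  ((differentiable_discriminant hq).sub_const c).analyticAt μ

lemma algMult_ne_zero_iff (hq : IntervalIntegrable q volume 0 1) {t : ℝ} {μ : ℂ} :
    algMult q t μ ≠ 0 ↔ discriminant q μ = 2 * (Real.cos t : ℂ) := by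
  rw [algMult, (analyticAt_discriminant_sub hq _ μ).analyticOrderAt_ne_zero, sub_eq_zero]

lemma isTheta_deriv_discriminant (hq : IntervalIntegrable q volume 0 1)
    (ho : algMult q t₀ lam₀ = 2) :
    deriv (discriminant q) =Θ[𝓝 lam₀] fun μ => μ - lam₀ := by
  have h := analyticOrderAt_deriv_of_pos (n := 1) (analyticAt_discriminant_sub hq _ lam₀)
    (ho.trans one_add_one_eq_two.symm)
  rw [deriv_sub_const_fun] at h
  simpa only [pow_one] using isTheta_pow_of_analyticOrderAt_eq
    ((differentiable_discriminant hq).analyticAt lam₀).deriv h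

lemma isTheta_four_sub_sq_discriminant (hq : IntervalIntegrable q volume 0 1)
    (ht₀ : Real.sin t₀ = 0) (ho : algMult q t₀ lam₀ = 2) :
    (fun μ => 4 - discriminant q μ ^ 2) =Θ[𝓝 lam₀] fun μ => (μ - lam₀) ^ 2 := by
  have hcos : (Real.cos t₀ : ℂ) ^ 2 = 1 := by
    have h := Real.sin_sq_add_cos_sq t₀
    rw [ht₀, zero_pow two_ne_zero, zero_add] at h
    exact_mod_cast h
  have hsum : discriminant q lam₀ - -(2 * (Real.cos t₀ : ℂ)) ≠ 0 := by
    rw [(algMult_ne_zero_iff hq).1 (ho.trans_ne two_ne_zero), sub_neg_eq_add, ← two_mul]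
    intro h
    have hzero : (Real.cos t₀ : ℂ) = 0 := by linear_combination h / 4
    rw [hzero] at hcos
    norm_num at hcos
  have hadd : (fun μ => discriminant q μ - -(2 * (Real.cos t₀ : ℂ))) =Θ[𝓝 lam₀]
      fun _ => (1 : ℂ) :=
    ((Asymptotics.isEquivalent_const_iff_tendsto hsum).2
      (analyticAt_discriminant_sub hq _ lam₀).continuousAt.tendsto).isTheta.trans
      (Asymptotics.isTheta_const_const hsum one_ne_zero)
  have hsub := isTheta_pow_of_analyticOrderAt_eq (analyticAt_discriminant_sub hq _ lam₀)
    (n := 2) ho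
  have hprod := Asymptotics.IsTheta.const_mul_left (neg_ne_zero.2 (one_ne_zero' ℂ))
    (hsub.mul hadd)
  simp only [mul_one] at hprod
  refine EventuallyEq.trans_isTheta (Eventually.of_forall fun μ => ?_) hprod
  linear_combination -4 * hcos

lemma exists_abs_sin_bounds (hq : IntervalIntegrable q volume 0 1)
    (ht₀ : Real.sin t₀ = 0) (ho : algMult q t₀ lam₀ = 2) :
    ∃ K > 0, ∀ᶠ μ in 𝓝 lam₀, ∀ t, discriminant q μ = 2 * (Real.cos t : ℂ) →
      ‖μ - lam₀‖ ≤ K * |Real.sin t| ∧ ‖deriv (discriminant q) μ‖ ≤ K * |Real.sin t| ∧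
        |Real.sin t| ≤ K * ‖deriv (discriminant q) μ‖ := by
  have hF := isTheta_deriv_discriminant hq ho
  set g : ℂ → ℝ := fun μ => √‖4 - discriminant q μ ^ 2‖
  have hg : g =Θ[𝓝 lam₀] fun μ => μ - lam₀ := by
    have h : (g ^ 2) =Θ[𝓝 lam₀] fun μ => (μ - lam₀) ^ 2 :=
      EventuallyEq.trans_isTheta (Eventually.of_forall fun μ => Real.sq_sqrt (norm_nonneg _))
        (isTheta_four_sub_sq_discriminant hq ht₀ ho).norm_left
    exact ⟨h.1.of_pow two_ne_zero, h.2.of_pow two_ne_zero⟩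
  have hg_sin : ∀ {μ : ℂ} {t : ℝ}, discriminant q μ = 2 * (Real.cos t : ℂ) →
      ‖g μ‖ = 2 * |Real.sin t| := by
    intro μ t h
    have hsq : 4 - discriminant q μ ^ 2 = (2 * (Real.sin t : ℂ)) ^ 2 := by
      rw [h]
      push_cast
      linear_combination -4 * Complex.sin_sq_add_cos_sq (t : ℂ)
    simp [g, hsq, -Complex.ofReal_sin]
  obtain ⟨a, ha, h₁⟩ := hg.2.exists_pos
  obtain ⟨b, hb, h₂⟩ := (hF.trans hg.symm).1.exists_pos
  obtain ⟨c, hc, h₃⟩ := (hF.trans hg.symm).2.exists_pos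
  refine ⟨2 * a + 2 * b + c, by positivity, ?_⟩
  filter_upwards [h₁.bound, h₂.bound, h₃.bound] with μ h₁ h₂ h₃ t ht
  rw [hg_sin ht] at h₁ h₂ h₃
  have hs := abs_nonneg (Real.sin t)
  have hd := norm_nonneg (deriv (discriminant q) μ)
  exact ⟨by nlinarith, by nlinarith, by nlinarith⟩

end DoublePoint

section FloquetPairIdentities

variable {q : ℝ → ℂ} {hq : IntervalIntegrable q volume 0 1} {t : ℝ} {μ : ℂ} {v w : ℂ × ℂ}

variable (hq) in
lemma differentiable_pairing_flow (z : C(unitInterval, ℂ)) (v : ℂ × ℂ) :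
    Differentiable ℂ fun lam => pairing z (flow hq lam v) :=
  ((innerSL ℂ (toL2 (star z))).comp toL2).differentiable.comp
    ((differentiable_flow hq).clm_apply (differentiable_const v))

namespace IsFloquetPair

lemma discriminant_mul_symp (h : IsFloquetPair hq t μ v w) (lam : ℂ) :
    discriminant q lam * symp v w = 2 * (Real.cos t : ℂ) * symp v w + (lam - μ) *
      (Complex.exp (Complex.I * t) * pairing (flow hq μ w) (flow hq lam v) -
        (Complex.exp (Complex.I * t))⁻¹ * pairing (flow hq μ v) (flow hq lam w)) := by
  have he := Complex.exp_ne_zero (Complex.I * t)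
  have hv := symp_monodromy_sub hq lam μ v w
  have hw := symp_monodromy_sub hq lam μ w v
  rw [h.right_eq, symp_smul_right] at hv
  rw [h.left_eq, symp_smul_right, symp_swap _ v, symp_swap w] at hw
  have htrace := symp_map_add_symp_map (monodromy hq lam : ℂ × ℂ →ₗ[ℂ] ℂ × ℂ) v w
  simp only [ContinuousLinearMap.coe_coe] at htrace
  rw [discriminant_eq hq, ← htrace, ← exp_I_mul_add_inv]
  set e := Complex.exp (Complex.I * t)
  field_simp at hv ⊢
  linear_combination e * hv - hw

lemma deriv_discriminant_mul_symp (h : IsFloquetPair hq t μ v w) :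
    deriv (discriminant q) μ * symp v w =
      2 * Complex.I * (Real.sin t : ℂ) * pairing (flow hq μ w) (flow hq μ v) := by
  have hL := ((differentiable_discriminant hq μ).hasDerivAt).mul_const (symp v w)
  have hG := (((differentiable_pairing_flow hq (flow hq μ w) v).const_mul
    (Complex.exp (Complex.I * t))).sub ((differentiable_pairing_flow hq (flow hq μ v) w).const_mul
    (Complex.exp (Complex.I * t))⁻¹) μ).hasDerivAt
  have hR := (((hasDerivAt_id μ).sub_const μ).mul hG).const_add
    (2 * (Real.cos t : ℂ) * symp v w)
  rw [hL.unique (hR.congr_of_eventuallyEq (Eventually.of_forall h.discriminant_mul_symp)),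
    ← exp_I_mul_sub_inv]
  simp only [id, sub_self, zero_mul, add_zero, one_mul, sub_mul, Pi.sub_apply]
  rw [pairing_comm (flow hq μ w)]

lemma symp_ne_zero (h : IsFloquetPair hq t μ v w) : symp v w ≠ 0 := by
  intro hsymp
  obtain ⟨c, rfl⟩ := exists_smul_of_symp_eq_zero h.left_ne hsymp
  have hinv := h.right_eq
  rw [map_smul, h.left_eq, smul_comm] at hinv
  exact h.ne_inv (smul_left_injective ℂ h.right_ne hinv)

lemma pairing_ne_zero (h : IsFloquetPair hq t μ v w) (hd : deriv (discriminant q) μ ≠ 0) :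
    pairing (flow hq μ w) (flow hq μ v) ≠ 0 := by
  intro hp
  have hsymp := h.deriv_discriminant_mul_symp
  rw [hp, mul_zero] at hsymp
  exact mul_ne_zero hd h.symp_ne_zero hsymp

end IsFloquetPair

end FloquetPairIdentities

lemma exists_norm_bounds_of_continuousAt {X 𝕜 E F : Type*} [TopologicalSpace X]
    [NontriviallyNormedField 𝕜] [CompleteSpace 𝕜] [NormedAddCommGroup E] [NormedSpace 𝕜 E]
    [FiniteDimensional 𝕜 E] [NormedAddCommGroup F] [NormedSpace 𝕜 F] {A : X → E →L[𝕜] F} {x₀ : X}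
    (hA : ContinuousAt A x₀) (hinj : Function.Injective (A x₀)) :
    ∃ c > 0, ∃ C > 0, ∀ᶠ x in 𝓝 x₀, ∀ v, c * ‖v‖ ≤ ‖A x v‖ ∧ ‖A x v‖ ≤ C * ‖v‖ := by
  obtain ⟨K, hK, hanti⟩ := LinearMap.exists_antilipschitzWith
    (A x₀ : E →ₗ[𝕜] F) (LinearMap.ker_eq_bot.2 hinj)
  have hK' : 0 < (K : ℝ)⁻¹ := inv_pos.2 hK
  have hnear : ∀ᶠ x in 𝓝 x₀, ‖A x - A x₀‖ < (K : ℝ)⁻¹ / 2 := by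
    simpa only [dist_eq_norm] using Metric.tendsto_nhds.1 hA _ (half_pos hK')
  refine ⟨(K : ℝ)⁻¹ / 2, by positivity, ‖A x₀‖ + (K : ℝ)⁻¹ / 2, by positivity, ?_⟩
  filter_upwards [hnear] with x hx v
  have hlow : (K : ℝ)⁻¹ * ‖v‖ ≤ ‖A x₀ v‖ :=
    (inv_mul_le_iff₀ (NNReal.coe_pos.2 hK)).2 (ZeroHomClass.bound_of_antilipschitz _ hanti v)
  have hdiff : ‖A x v - A x₀ v‖ ≤ (K : ℝ)⁻¹ / 2 * ‖v‖ :=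
    ((A x - A x₀).le_opNorm v).trans (mul_le_mul_of_nonneg_right hx.le (norm_nonneg _))
  have hup := (A x₀).le_opNorm v
  rw [add_mul]
  constructor
  · linarith [norm_le_norm_add_norm_sub (A x v) (A x₀ v)]
  · linarith [norm_le_norm_add_norm_sub' (A x v) (A x₀ v)]

section AlphaBounds

variable {q : ℝ → ℂ} {t₀ : ℝ} {lam₀ : ℂ}

lemma IsFloquetPair.discriminant_eq {hq : IntervalIntegrable q volume 0 1} {t : ℝ} {μ : ℂ}
    {v w : ℂ × ℂ} (h : IsFloquetPair hq t μ v w) : discriminant q μ = 2 * (Real.cos t : ℂ) := by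
  rw [← exp_I_mul_add_inv, ← hasEigenvalue_monodromy_iff hq μ (Complex.exp_ne_zero _)]
  exact Module.End.hasEigenvalue_of_hasEigenvector
    (Module.End.hasEigenvector_iff.2 ⟨Module.End.mem_eigenspace_iff.2 h.left_eq, h.left_ne⟩)

lemma IsFloquetPair.sin_ne_zero {hq : IntervalIntegrable q volume 0 1} {t : ℝ} {μ : ℂ}
    {v w : ℂ × ℂ} (h : IsFloquetPair hq t μ v w) : Real.sin t ≠ 0 := by
  intro ht
  have hsub := exp_I_mul_sub_inv t
  rw [ht, Complex.ofReal_zero, mul_zero, sub_eq_zero] at hsub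
  exact h.ne_inv hsub

lemma exists_pairing_bounds (hq : IntervalIntegrable q volume 0 1) (ht₀ : Real.sin t₀ = 0)
    (ho : algMult q t₀ lam₀ = 2) :
    ∃ K > 0, ∀ᶠ μ in 𝓝 lam₀, ∀ t v w, IsFloquetPair hq t μ v w →
      ‖symp v w‖ ≤ K * ‖pairing (flow hq μ w) (flow hq μ v)‖ ∧
        ‖pairing (flow hq μ w) (flow hq μ v)‖ ≤ K * ‖symp v w‖ := by
  obtain ⟨K, hK, hev⟩ := exists_abs_sin_bounds hq ht₀ ho
  refine ⟨2 * K, by positivity, ?_⟩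
  filter_upwards [hev] with μ hμ t v w h
  obtain ⟨-, hle, hge⟩ := hμ t h.discriminant_eq
  have hid := congrArg norm h.deriv_discriminant_mul_symp
  simp only [norm_mul, Complex.norm_ofNat, Complex.norm_I, mul_one, Complex.norm_real,
    Real.norm_eq_abs] at hid
  have hs := abs_pos.2 h.sin_ne_zero
  have hd : 0 < ‖deriv (discriminant q) μ‖ := pos_of_mul_pos_right (hs.trans_le hge) hK.le
  have hS := norm_nonneg (symp v w)
  have hp := norm_nonneg (pairing (flow hq μ w) (flow hq μ v))
  constructor
  · refine le_of_mul_le_mul_left ?_ hd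
    nlinarith [mul_le_mul_of_nonneg_right hge hp]
  · refine le_of_mul_le_mul_left ?_ hs
    nlinarith [mul_le_mul_of_nonneg_right hle hS, mul_nonneg hs.le hp]

lemma exists_alpha_bounds (hq : IntervalIntegrable q volume 0 1) (ht₀ : Real.sin t₀ = 0)
    (ho : algMult q t₀ lam₀ = 2) :
    ∃ c > 0, ∃ C > 0, ∀ᶠ μ in 𝓝 lam₀, ∀ t v w, IsFloquetPair hq t μ v w →
      c * ‖symp v w‖ ≤ alpha hq μ v w * (‖v‖ * ‖w‖) ∧
        alpha hq μ v w * (‖v‖ * ‖w‖) ≤ C * ‖symp v w‖ := by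
  obtain ⟨K, hK, hpair⟩ := exists_pairing_bounds hq ht₀ ho
  have hcont : Continuous fun μ => flowL2 hq μ :=
    ((differentiable_const toL2).clm_comp (differentiable_flow hq)).continuous
  obtain ⟨b, hb, B, hB, hflow⟩ :=
    exists_norm_bounds_of_continuousAt hcont.continuousAt (flowL2_injective hq lam₀)
  refine ⟨K⁻¹ / B ^ 2, by positivity, K / b ^ 2, by positivity, ?_⟩
  filter_upwards [hpair, hflow] with μ hpair hflow t v w h
  obtain ⟨h₁, h₂⟩ := hpair t v w h
  have hv := norm_pos_iff.2 h.left_ne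
  have hw := norm_pos_iff.2 h.right_ne
  have hlow : b ^ 2 * (‖v‖ * ‖w‖) ≤ ‖flowL2 hq μ w‖ * ‖flowL2 hq μ v‖ :=
    calc b ^ 2 * (‖v‖ * ‖w‖) = b * ‖w‖ * (b * ‖v‖) := by ring
      _ ≤ _ := mul_le_mul (hflow w).1 (hflow v).1 (by positivity) (by positivity)
  have hup : ‖flowL2 hq μ w‖ * ‖flowL2 hq μ v‖ ≤ B ^ 2 * (‖v‖ * ‖w‖) :=
    calc _ ≤ B * ‖w‖ * (B * ‖v‖) :=
          mul_le_mul (hflow w).2 (hflow v).2 (norm_nonneg _) (by positivity)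
      _ = _ := by ring
  have hpos : 0 < ‖flowL2 hq μ w‖ * ‖flowL2 hq μ v‖ := lt_of_lt_of_le (by positivity) hlow
  have hstar : ‖toL2 (star (flow hq μ w))‖ = ‖flowL2 hq μ w‖ := norm_toL2_star _
  rw [alpha, hstar, div_mul_eq_mul_div ‖pairing (flow hq μ w) (flow hq μ v)‖, le_div_iff₀ hpos,
    div_le_iff₀ hpos]
  constructor
  · calc K⁻¹ / B ^ 2 * ‖symp v w‖ * (‖flowL2 hq μ w‖ * ‖flowL2 hq μ v‖)
        = K⁻¹ * ‖symp v w‖ * ((‖flowL2 hq μ w‖ * ‖flowL2 hq μ v‖) / B ^ 2) := by ring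
      _ ≤ _ := mul_le_mul ((inv_mul_le_iff₀ hK).2 h₁)
          ((div_le_iff₀' (by positivity)).2 hup) (by positivity) (norm_nonneg _)
  · calc _ ≤ K * ‖symp v w‖ * ((‖flowL2 hq μ w‖ * ‖flowL2 hq μ v‖) / b ^ 2) :=
          mul_le_mul h₂ ((le_div_iff₀' (by positivity)).2 hlow) (by positivity) (by positivity)
      _ = _ := by ring

end AlphaBounds

section SymplecticBounds

variable {𝕜 : Type*} [NormedField 𝕜]

lemma symp_smul_eq_add (v w u : 𝕜 × 𝕜) : symp v w • u = symp u w • v + symp v u • w := by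
  ext <;> simp only [symp, Prod.smul_fst, Prod.smul_snd, Prod.fst_add, Prod.snd_add, smul_eq_mul]
  all_goals ring

lemma norm_symp_le (v w : 𝕜 × 𝕜) : ‖symp v w‖ ≤ 2 * (‖v‖ * ‖w‖) :=
  calc ‖symp v w‖ ≤ ‖v.1‖ * ‖w.2‖ + ‖v.2‖ * ‖w.1‖ := by
        rw [symp, ← norm_mul, ← norm_mul]
        exact norm_sub_le _ _
    _ ≤ ‖v‖ * ‖w‖ + ‖v‖ * ‖w‖ := by
        gcongr
        exacts [norm_fst_le v, norm_snd_le w, norm_snd_le v, norm_fst_le w]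
    _ = 2 * (‖v‖ * ‖w‖) := (two_mul _).symm

lemma exists_norm_symp_le_of_ne_zero {F : Type*} [NormedAddCommGroup F] [Module 𝕜 F]
    [NormSMulClass 𝕜 F] {N : 𝕜 × 𝕜 →ₗ[𝕜] F} (hN : N ≠ 0) :
    ∃ K > 0, ∀ v w, ‖symp v w‖ ≤ K * (‖N v‖ * ‖w‖ + ‖v‖ * ‖N w‖) := by
  obtain ⟨u, hu⟩ := DFunLike.ne_iff.1 hN
  have hu₀ : u ≠ 0 := fun h => hu (by simp [h])
  have hNu : 0 < ‖N u‖ := norm_pos_iff.2 hu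
  refine ⟨2 * ‖u‖ / ‖N u‖, div_pos (mul_pos two_pos (norm_pos_iff.2 hu₀)) hNu, fun v w => ?_⟩
  rw [div_mul_eq_mul_div, le_div_iff₀ hNu]
  calc ‖symp v w‖ * ‖N u‖ = ‖symp u w • N v + symp v u • N w‖ := by
        rw [← norm_smul, ← map_smul, symp_smul_eq_add, map_add, map_smul, map_smul]
    _ ≤ ‖symp u w‖ * ‖N v‖ + ‖symp v u‖ * ‖N w‖ := by
        rw [← norm_smul, ← norm_smul]
        exact norm_add_le _ _
    _ ≤ 2 * (‖u‖ * ‖w‖) * ‖N v‖ + 2 * (‖v‖ * ‖u‖) * ‖N w‖ := by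
        gcongr <;> exact norm_symp_le _ _
    _ = 2 * ‖u‖ * (‖N v‖ * ‖w‖ + ‖v‖ * ‖N w‖) := by ring

lemma sub_mul_fst_mul_fst {L : Module.End 𝕜 (𝕜 × 𝕜)} {r s : 𝕜} {v w : 𝕜 × 𝕜}
    (hv : L v = r • v) (hw : L w = s • w) :
    (s - r) * (v.1 * w.1) = (L (0, 1)).1 * symp v w := by
  rw [end_prod_apply] at hv hw
  have hv₁ := congrArg Prod.fst hv
  have hw₁ := congrArg Prod.fst hw
  simp only [Prod.fst_add, Prod.smul_fst, smul_eq_mul] at hv₁ hw₁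
  rw [symp]
  linear_combination w.1 * hv₁ - v.1 * hw₁

lemma sub_mul_snd_mul_snd {L : Module.End 𝕜 (𝕜 × 𝕜)} {r s : 𝕜} {v w : 𝕜 × 𝕜}
    (hv : L v = r • v) (hw : L w = s • w) :
    (r - s) * (v.2 * w.2) = (L (1, 0)).2 * symp v w := by
  rw [end_prod_apply] at hv hw
  have hv₂ := congrArg Prod.snd hv
  have hw₂ := congrArg Prod.snd hw
  simp only [Prod.snd_add, Prod.smul_snd, smul_eq_mul] at hv₂ hw₂
  rw [symp]
  linear_combination v.2 * hw₂ - w.2 * hv₂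

lemma le_of_mul_le_sq_of_sub_le {x y K S : ℝ} (hK : 0 ≤ K) (hS : 0 ≤ S)
    (hmul : x * y ≤ (K * S) ^ 2) (hsub : x - y ≤ S) : x ≤ (K + 1) * S := by
  by_contra! hlt
  nlinarith [mul_nonneg hK hS]

lemma norm_mul_norm_le_norm_symp {L : Module.End 𝕜 (𝕜 × 𝕜)} {r s : 𝕜} {v w : 𝕜 × 𝕜} {K : ℝ}
    (hv : L v = r • v) (hw : L w = s • w) (hrs : r ≠ s)
    (h₁ : ‖(L (0, 1)).1‖ ≤ K * ‖r - s‖) (h₂ : ‖(L (1, 0)).2‖ ≤ K * ‖r - s‖) :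
    ‖v‖ * ‖w‖ ≤ (K + 1) * ‖symp v w‖ := by
  have hpos : 0 < ‖r - s‖ := norm_pos_iff.2 (sub_ne_zero.2 hrs)
  have hK : 0 ≤ K := nonneg_of_mul_nonneg_left ((norm_nonneg _).trans h₁) hpos
  have hS := norm_nonneg (symp v w)
  have hfst : ‖v.1‖ * ‖w.1‖ ≤ K * ‖symp v w‖ := by
    refine le_of_mul_le_mul_left ?_ hpos
    rw [norm_sub_rev] at h₁ ⊢
    rw [← norm_mul, ← norm_mul, sub_mul_fst_mul_fst hv hw, norm_mul, ← mul_assoc, mul_comm _ K]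
    gcongr
  have hsnd : ‖v.2‖ * ‖w.2‖ ≤ K * ‖symp v w‖ := by
    refine le_of_mul_le_mul_left ?_ hpos
    rw [← norm_mul, ← norm_mul, sub_mul_snd_mul_snd hv hw, norm_mul, ← mul_assoc, mul_comm _ K]
    gcongr
  have hmixed : ‖v.1‖ * ‖w.2‖ * (‖v.2‖ * ‖w.1‖) ≤ (K * ‖symp v w‖) ^ 2 :=
    calc _ = ‖v.1‖ * ‖w.1‖ * (‖v.2‖ * ‖w.2‖) := by ring
      _ ≤ K * ‖symp v w‖ * (K * ‖symp v w‖) := mul_le_mul hfst hsnd (by positivity) (by positivity)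
      _ = _ := (sq _).symm
  have hdist : |‖v.1‖ * ‖w.2‖ - ‖v.2‖ * ‖w.1‖| ≤ ‖symp v w‖ := by
    rw [← norm_mul, ← norm_mul, symp]
    exact abs_norm_sub_norm_le _ _
  have h₁₂ := le_of_mul_le_sq_of_sub_le hK hS hmixed (abs_le.1 hdist).2
  have h₂₁ := le_of_mul_le_sq_of_sub_le hK hS (mul_comm (‖v.1‖ * ‖w.2‖) _ ▸ hmixed)
    (abs_le.1 (abs_sub_comm (‖v.1‖ * ‖w.2‖) _ ▸ hdist)).2
  rcases max_choice ‖v.1‖ ‖v.2‖ with hmv | hmv <;> rcases max_choice ‖w.1‖ ‖w.2‖ with hmw | hmw <;>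
    rw [Prod.norm_def, Prod.norm_def, hmv, hmw] <;> linarith

end SymplecticBounds

section Dichotomy

variable {q : ℝ → ℂ} {t₀ : ℝ} {lam₀ : ℂ}

lemma norm_exp_I_mul_sub_le (t s : ℝ) :
    ‖Complex.exp (Complex.I * t) - Complex.exp (Complex.I * s)‖ ≤ |t - s| := by
  have h : Complex.exp (Complex.I * t) - Complex.exp (Complex.I * s) =
      Complex.exp (s * Complex.I) * (Complex.exp (Complex.I * ((t - s : ℝ) : ℂ)) - 1) := by
    rw [mul_sub, ← Complex.exp_add, mul_one, mul_comm _ Complex.I, ← mul_add]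
    push_cast
    rw [add_sub_cancel]
  rw [h, norm_mul, Complex.norm_exp_ofReal_mul_I, one_mul]
  exact Real.norm_exp_I_mul_ofReal_sub_one_le

lemma exists_norm_monodromy_sub_le (hq : IntervalIntegrable q volume 0 1) (lam₀ : ℂ) :
    ∃ C > 0, ∀ᶠ μ in 𝓝 lam₀, ∀ v,
      ‖monodromy hq μ v - monodromy hq lam₀ v‖ ≤ C * ‖μ - lam₀‖ * ‖v‖ := by
  obtain ⟨C, hC, hbound⟩ :=
    (differentiable_monodromy hq lam₀).hasFDerivAt.isBigO_sub.exists_pos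
  refine ⟨C, hC, hbound.bound.mono fun μ hμ v => ?_⟩
  exact ((monodromy hq μ - monodromy hq lam₀).le_opNorm v).trans (by gcongr)

lemma exists_norm_symp_le (hq : IntervalIntegrable q volume 0 1) (ht₀ : Real.sin t₀ = 0)
    (hscalar : ¬ ∀ v, monodromy hq lam₀ v = Complex.exp (Complex.I * t₀) • v) :
    ∃ K > 0, ∀ᶠ μ in 𝓝 lam₀, ∀ t v w, IsFloquetPair hq t μ v w →
      ‖symp v w‖ ≤ K * (‖μ - lam₀‖ + |t - t₀|) * (‖v‖ * ‖w‖) := by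
  set e₀ := Complex.exp (Complex.I * t₀)
  have he₀ : Complex.exp (Complex.I * ((-t₀ : ℝ) : ℂ)) = e₀ := by
    have h := exp_I_mul_sub_inv t₀
    rw [ht₀, Complex.ofReal_zero, mul_zero, sub_eq_zero] at h
    rw [Complex.ofReal_neg, mul_neg, Complex.exp_neg]
    exact h.symm
  set N : ℂ × ℂ →ₗ[ℂ] ℂ × ℂ := (monodromy hq lam₀ : ℂ × ℂ →ₗ[ℂ] ℂ × ℂ) - e₀ • LinearMap.id
  have hN : N ≠ 0 := fun h => hscalar fun v => sub_eq_zero.1 (DFunLike.congr_fun h v)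
  obtain ⟨K, hK, hsymp⟩ := exists_norm_symp_le_of_ne_zero hN
  obtain ⟨C, hC, hmon⟩ := exists_norm_monodromy_sub_le hq lam₀
  refine ⟨K * (2 * (C + 1)), by positivity, ?_⟩
  filter_upwards [hmon] with μ hμ t v w h
  have hNle : ∀ (e : ℂ) (u : ℂ × ℂ), monodromy hq μ u = e • u → ‖e - e₀‖ ≤ |t - t₀| →
      ‖N u‖ ≤ (C + 1) * (‖μ - lam₀‖ + |t - t₀|) * ‖u‖ := fun e u hu he => by
    have hNu : N u = (e - e₀) • u - (monodromy hq μ u - monodromy hq lam₀ u) := by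
      rw [hu, sub_smul]
      simp only [N, LinearMap.sub_apply, LinearMap.smul_apply, LinearMap.id_apply,
        ContinuousLinearMap.coe_coe]
      abel
    calc ‖N u‖ ≤ ‖e - e₀‖ * ‖u‖ + C * ‖μ - lam₀‖ * ‖u‖ := by
          rw [hNu, ← norm_smul]
          exact (norm_sub_le _ _).trans (add_le_add_right (hμ u) _)
      _ ≤ |t - t₀| * ‖u‖ + C * ‖μ - lam₀‖ * ‖u‖ := by gcongr
      _ ≤ _ := by
          rw [← add_mul]
          gcongr
          nlinarith [norm_nonneg (μ - lam₀), abs_nonneg (t - t₀)]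
  have hv := hNle _ v h.left_eq (norm_exp_I_mul_sub_le t t₀)
  have hw := hNle _ w h.right_eq (by
    have := norm_exp_I_mul_sub_le (-t) (-t₀)
    rwa [he₀, Complex.ofReal_neg, mul_neg, Complex.exp_neg, neg_sub_neg, abs_sub_comm] at this)
  calc ‖symp v w‖ ≤ K * (‖N v‖ * ‖w‖ + ‖v‖ * ‖N w‖) := hsymp v w
    _ ≤ K * ((C + 1) * (‖μ - lam₀‖ + |t - t₀|) * ‖v‖ * ‖w‖ +
          ‖v‖ * ((C + 1) * (‖μ - lam₀‖ + |t - t₀|) * ‖w‖)) := by gcongr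
    _ = _ := by ring

lemma exists_norm_mul_norm_le_symp (hq : IntervalIntegrable q volume 0 1)
    (ht₀ : Real.sin t₀ = 0) (ho : algMult q t₀ lam₀ = 2)
    (hscalar : ∀ v, monodromy hq lam₀ v = Complex.exp (Complex.I * t₀) • v) :
    ∃ K > 0, ∀ᶠ μ in 𝓝 lam₀, ∀ t v w, IsFloquetPair hq t μ v w →
      ‖v‖ * ‖w‖ ≤ K * ‖symp v w‖ := by
  obtain ⟨K, hK, hsin⟩ := exists_abs_sin_bounds hq ht₀ ho
  obtain ⟨C, hC, hmon⟩ := exists_norm_monodromy_sub_le hq lam₀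
  refine ⟨C * K + 1, by positivity, ?_⟩
  filter_upwards [hsin, hmon] with μ hμ hmon t v w h
  have hnorm : ‖Complex.exp (Complex.I * t) - (Complex.exp (Complex.I * t))⁻¹‖ =
      2 * |Real.sin t| := by
    rw [exp_I_mul_sub_inv, norm_mul, norm_mul, Complex.norm_real, Complex.norm_ofNat,
      Complex.norm_I, mul_one, Real.norm_eq_abs]
  have hbound : ∀ u : ℂ × ℂ, ‖u‖ = 1 → ‖monodromy hq μ u - monodromy hq lam₀ u‖ ≤
      C * K * ‖Complex.exp (Complex.I * t) - (Complex.exp (Complex.I * t))⁻¹‖ := fun u hu => by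
    have hle := hmon u
    rw [hu, mul_one] at hle
    rw [hnorm]
    nlinarith [(hμ t h.discriminant_eq).1,
      mul_nonneg (mul_nonneg hC.le hK.le) (abs_nonneg (Real.sin t))]
  refine norm_mul_norm_le_norm_symp (L := (monodromy hq μ : ℂ × ℂ →ₗ[ℂ] ℂ × ℂ))
    h.left_eq h.right_eq h.ne_inv ?_ ?_
  · refine le_trans ?_ (hbound (0, 1) (by simp [Prod.norm_mk]))
    simpa [hscalar] using norm_fst_le (monodromy hq μ (0, 1) - monodromy hq lam₀ (0, 1))
  · refine le_trans ?_ (hbound (1, 0) (by simp [Prod.norm_mk]))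
    simpa [hscalar] using norm_snd_le (monodromy hq μ (1, 0) - monodromy hq lam₀ (1, 0))

end Dichotomy

section Numbering

lemma exists_int_encard_fiber_eq {α : Type*} {m : α → ℕ} (hc : m.support.Countable)
    (hi : m.support.Infinite) : ∃ f : ℤ → α, ∀ a, {k | f k = a}.encard = m a := by
  have hsupp : ∀ x : Σ a, Fin (m a), x.1 ∈ m.support := fun x => (Fin.pos x.2).ne'
  have := hc.to_subtype
  have := hi.to_subtype
  have : Countable (Σ a, Fin (m a)) :=
    Function.Injective.countable (f := fun x => ((⟨x.1, hsupp x⟩, x.2) : m.support × ℕ)) <| by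
      rintro ⟨a, i⟩ ⟨b, j⟩ h
      obtain ⟨rfl, hij⟩ : a = b ∧ (i : ℕ) = j := by simpa using h
      rw [Fin.ext hij]
  have : Infinite (Σ a, Fin (m a)) :=
    Infinite.of_injective (fun a : m.support => ⟨a, 0, Nat.pos_of_ne_zero a.2⟩)
      fun a b h => Subtype.ext (congrArg Sigma.fst h)
  obtain ⟨e⟩ := nonempty_equiv_of_countable (α := ℤ) (β := Σ a, Fin (m a))
  refine ⟨fun k => (e k).1, fun a => ?_⟩
  have hfiber : {k | (e k).1 = a} ≃ Fin (m a) :=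
    (e.subtypeEquiv fun _ => Iff.rfl).trans (Equiv.sigmaSubtype a)
  rw [← ENat.card_coe_set_eq, ENat.card_congr hfiber, ENat.card_eq_coe_fintype_card,
    Fintype.card_fin]

variable {q : ℝ → ℂ} {t : ℝ}

lemma finite_roots_inter_closedBall (hq : IntervalIntegrable q volume 0 1) (c : ℂ) (R : ℝ) :
    ({μ | discriminant q μ = c} ∩ Metric.closedBall 0 R).Finite := by
  by_contra hinf
  obtain ⟨x, -, hx⟩ := Set.Infinite.exists_accPt_of_subset_isCompact hinf
    (isCompact_closedBall (0 : ℂ) R) inter_subset_right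
  rw [accPt_iff_frequently_nhdsNE] at hx
  have hconst := AnalyticOnNhd.eqOn_zero_of_preconnected_of_frequently_eq_zero
    (fun μ _ => analyticAt_discriminant_sub hq c μ) isPreconnected_univ (mem_univ x)
    (hx.mono fun μ hμ => sub_eq_zero.2 hμ.1)
  obtain ⟨μ, hμ⟩ := discriminant_ne_const hq c
  exact hμ (sub_eq_zero.1 (hconst (mem_univ μ)))

lemma countable_roots (hq : IntervalIntegrable q volume 0 1) (c : ℂ) :
    {μ | discriminant q μ = c}.Countable := by
  rw [← inter_univ {μ | _}, ← Metric.iUnion_closedBall_nat (0 : ℂ), inter_iUnion]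
  exact countable_iUnion fun n => (finite_roots_inter_closedBall hq c n).countable

lemma infinite_roots (hq : IntervalIntegrable q volume 0 1) (c : ℂ) :
    {μ | discriminant q μ = c}.Infinite := by
  intro hfin
  obtain ⟨X, hX⟩ := hfin.isBounded.exists_norm_le
  obtain ⟨μ, hμ, hroot⟩ := exists_lt_norm_discriminant_eq hq c X
  exact (hX μ hroot).not_gt hμ

lemma exists_isNumbering (hq : IntervalIntegrable q volume 0 1) (t : ℝ) :
    ∃ lam : ℤ → ℂ, IsNumbering q t lam := by
  have htop : ∀ μ, algMult q t μ ≠ ⊤ := analyticOrderAt_discriminant_ne_top hq _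
  have hsupp : (fun μ => (algMult q t μ).toNat).support =
      {μ | discriminant q μ = 2 * (Real.cos t : ℂ)} := by
    ext μ
    rw [Function.mem_support, mem_ofPred_eq, ← algMult_ne_zero_iff hq, Ne, ENat.toNat_eq_zero,
      or_iff_left (htop μ)]
  obtain ⟨lam, hlam⟩ := exists_int_encard_fiber_eq (hsupp ▸ countable_roots hq _)
    (hsupp ▸ infinite_roots hq _)
  have hmult : ∀ μ, {k | lam k = μ}.encard = algMult q t μ := fun μ =>
    (hlam μ).trans (ENat.natCast_toNat (htop μ))
  refine ⟨lam, fun k => ?_, hmult⟩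
  rw [isEigenvalue_iff hq, ← algMult_ne_zero_iff hq, ← hmult]
  exact encard_ne_zero.2 ⟨k, rfl⟩

lemma IsNumbering.finite_norm_le (hq : IntervalIntegrable q volume 0 1) {lam : ℤ → ℂ}
    (h : IsNumbering q t lam) (R : ℝ) : {k | ‖lam k‖ ≤ R}.Finite := by
  refine ((finite_roots_inter_closedBall hq (2 * (Real.cos t : ℂ)) R).biUnion
    (t := fun μ => {k | lam k = μ}) fun μ _ => ?_).subset fun k hk => mem_biUnion
      ⟨(isEigenvalue_iff hq t _).1 (h.1 k), mem_closedBall_zero_iff.2 hk⟩ rfl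
  rw [← encard_ne_top_iff, h.2 μ]
  exact analyticOrderAt_discriminant_ne_top hq _ μ

lemma IsNumbering.exists_lt_norm (hq : IntervalIntegrable q volume 0 1) {lam : ℤ → ℂ}
    (h : IsNumbering q t lam) (R : ℝ) : ∃ N : ℕ, ∀ k : ℤ, (N : ℤ) < |k| → R < ‖lam k‖ := by
  obtain ⟨N, hN⟩ := ((h.finite_norm_le hq R).image Int.natAbs).bddAbove
  refine ⟨N, fun k hk => not_le.1 fun hle => ?_⟩
  have hkN : k.natAbs ≤ N := hN (mem_image_of_mem _ hle)
  rw [Int.abs_eq_natAbs] at hk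
  exact hkN.not_gt (by exact_mod_cast hk)

end Numbering

section Multiplicity

variable {q : ℝ → ℂ} {t : ℝ} {μ : ℂ}

lemma algMult_eq_analyticOrderAt_deriv_add_one (hq : IntervalIntegrable q volume 0 1)
    (h : discriminant q μ = 2 * (Real.cos t : ℂ)) :
    algMult q t μ = analyticOrderAt (deriv (discriminant q)) μ + 1 := by
  rw [((differentiable_discriminant hq).analyticAt μ).analyticOrderAt_deriv_add_one, h, algMult]

lemma isSimpleEigenvalue_iff (hq : IntervalIntegrable q volume 0 1) : IsSimpleEigenvalue q t μ ↔
    discriminant q μ = 2 * (Real.cos t : ℂ) ∧ deriv (discriminant q) μ ≠ 0 := by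
  rw [IsSimpleEigenvalue, isEigenvalue_iff hq]
  refine and_congr_right fun h => ?_
  rw [algMult_eq_analyticOrderAt_deriv_add_one hq h,
    (ENat.add_left_injective_of_ne_top ENat.one_ne_top).eq_iff' (zero_add 1),
    ((differentiable_discriminant hq).analyticAt μ).deriv.analyticOrderAt_eq_zero]

lemma IsMultipleEigenvalue.deriv_discriminant_eq_zero (hq : IntervalIntegrable q volume 0 1)
    (h : IsMultipleEigenvalue q t μ) : deriv (discriminant q) μ = 0 := by
  by_contra hd
  have hsimple := (isSimpleEigenvalue_iff hq).2 ⟨(isEigenvalue_iff hq t μ).1 h.1, hd⟩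
  have hle := h.2
  rw [hsimple.2] at hle
  norm_num at hle

lemma exists_algMult_eq_two (hq : IntervalIntegrable q volume 0 1) :
    ∃ R : ℝ, ∀ t μ, R < ‖μ‖ → IsMultipleEigenvalue q t μ → algMult q t μ = 2 := by
  obtain ⟨R, hR⟩ := exists_deriv_deriv_discriminant_ne_zero hq
  refine ⟨R, fun t μ hμ h => ?_⟩
  have hd := h.deriv_discriminant_eq_zero hq
  have ha := ((differentiable_discriminant hq).analyticAt μ).deriv
  have hord := ha.analyticOrderAt_deriv_add_one
  rw [ha.deriv.analyticOrderAt_eq_zero.2 (hR μ hμ hd), hd] at hord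
  simp only [sub_zero] at hord
  rw [algMult_eq_analyticOrderAt_deriv_add_one hq ((isEigenvalue_iff hq t μ).1 h.1), ← hord,
    zero_add, one_add_one_eq_two]

end Multiplicity

section PuncturedInterval

lemma puncturedInterval_mem_nhdsNE (t₀ : ℝ) {δ : ℝ} (hδ : 0 < δ) :
    puncturedInterval t₀ δ ∈ 𝓝[≠] t₀ := by
  rw [← Iio_union_Ioi, nhdsWithin_union]
  exact union_mem_sup (Ioo_mem_nhdsLT (sub_lt_self t₀ hδ))
    (Ioo_mem_nhdsGT (lt_add_of_pos_right t₀ hδ))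

lemma exists_puncturedInterval_subset {t₀ : ℝ} {p : ℝ → Prop} (h : ∀ᶠ t in 𝓝[≠] t₀, p t) :
    ∃ δ > 0, ∀ t ∈ puncturedInterval t₀ δ, p t := by
  rw [eventually_nhdsWithin_iff, Metric.eventually_nhds_iff_ball] at h
  obtain ⟨δ, hδ, hball⟩ := h
  rw [Real.ball_eq_Ioo] at hball
  refine ⟨δ, hδ, ?_⟩
  rintro t (ht | ht)
  · exact hball t ⟨ht.1, by linarith [ht.2]⟩ ht.2.ne
  · exact hball t ⟨by linarith [ht.1], ht.2⟩ ht.1.ne'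

lemma puncturedInterval_mono (t₀ : ℝ) {δ' δ : ℝ} (h : δ' ≤ δ) :
    puncturedInterval t₀ δ' ⊆ puncturedInterval t₀ δ :=
  union_subset_union (Ioo_subset_Ioo_left (by linarith)) (Ioo_subset_Ioo_right (by linarith))

end PuncturedInterval

section Branch

variable {q : ℝ → ℂ} {t₀ : ℝ} {lam₀ : ℂ}

lemma exists_branch (hq : IntervalIntegrable q volume 0 1) (ht₀ : Real.sin t₀ = 0)
    (ho : algMult q t₀ lam₀ = 2) :
    ∃ μ : ℝ → ℂ, ∃ K > 0, ∀ᶠ t in 𝓝 t₀, ContinuousAt μ t ∧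
      discriminant q (μ t) = 2 * (Real.cos t : ℂ) ∧ ‖μ t - lam₀‖ ≤ K * |t - t₀| := by
  obtain ⟨ρ, hρ, hρ₀, hpow⟩ := exists_analyticAt_eq_pow two_ne_zero
    (analyticAt_discriminant_sub hq _ lam₀) (n := 2) ho
  obtain ⟨κ, hκ⟩ := IsAlgClosed.exists_pow_nat_eq (-(Real.cos t₀ : ℂ)) two_pos
  set ζ : ℝ → ℂ := fun t => κ * ((2 * Real.sin ((t - t₀) / 2) : ℝ) : ℂ)
  have hζ : Differentiable ℝ ζ := by
    have hsin : Differentiable ℝ fun t => 2 * Real.sin ((t - t₀) / 2) := by fun_prop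
    exact (Complex.ofRealCLM.differentiable.comp hsin).const_mul κ
  have hζ₀ : ζ t₀ = 0 := by simp [ζ]
  have hζ_sq : ∀ t, ζ t ^ 2 = 2 * (Real.cos t : ℂ) - 2 * (Real.cos t₀ : ℂ) := fun t => by
    have hcos : 2 * Real.cos t - 2 * Real.cos t₀ =
        -Real.cos t₀ * (2 * Real.sin ((t - t₀) / 2)) ^ 2 := by
      rw [mul_pow, Real.sin_sq_eq_half_sub, mul_div_cancel₀ _ two_ne_zero]
      nth_rw 1 [← sub_add_cancel t t₀]
      rw [Real.cos_add, ht₀]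
      ring
    rw [mul_pow, hκ]
    exact_mod_cast hcos.symm
  have hρζ : AnalyticAt ℂ ρ (ζ t₀) := hζ₀.symm ▸ hρ
  have htend : Tendsto ζ (𝓝 t₀) (𝓝 0) := hζ₀ ▸ (hζ t₀).continuousAt
  have hdiff : DifferentiableAt ℝ (ρ ∘ ζ) t₀ :=
    (hρζ.differentiableAt.restrictScalars ℝ).comp t₀ (hζ t₀)
  obtain ⟨K, hK, hbound⟩ := hdiff.hasFDerivAt.isBigO_sub.exists_pos
  refine ⟨ρ ∘ ζ, K, hK, ?_⟩
  filter_upwards [htend.eventually hρ.eventually_analyticAt, htend.eventually hpow, hbound.bound]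
    with t ht hroot hle
  refine ⟨ht.continuousAt.comp (hζ t).continuousAt, ?_, ?_⟩
  · rw [hζ_sq] at hroot
    exact sub_left_injective hroot
  · simpa [hζ₀, hρ₀] using hle

end Branch

section DoublePoint

variable {q : ℝ → ℂ} {t₀ : ℝ} {lam₀ : ℂ}

lemma IsFloquetPair.alpha_pos {hq : IntervalIntegrable q volume 0 1} {t : ℝ} {μ : ℂ}
    {v w : ℂ × ℂ} (h : IsFloquetPair hq t μ v w) (hd : deriv (discriminant q) μ ≠ 0) :
    0 < alpha hq μ v w :=
  div_pos (norm_pos_iff.2 (h.pairing_ne_zero hd))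
    (mul_pos (norm_pos_iff.2 (toL2_star_flow_ne_zero h.right_ne))
      (norm_pos_iff.2 (flowL2_ne_zero h.left_ne)))

lemma exists_alpha_le (hq : IntervalIntegrable q volume 0 1) (ht₀ : Real.sin t₀ = 0)
    (ho : algMult q t₀ lam₀ = 2)
    (hscalar : ¬ ∀ v, monodromy hq lam₀ v = Complex.exp (Complex.I * t₀) • v) :
    ∃ K > 0, ∀ᶠ μ in 𝓝 lam₀, ∀ t v w, IsFloquetPair hq t μ v w →
      alpha hq μ v w ≤ K * (‖μ - lam₀‖ + |t - t₀|) := by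
  obtain ⟨c, -, C, hC, halpha⟩ := exists_alpha_bounds hq ht₀ ho
  obtain ⟨K, hK, hsymp⟩ := exists_norm_symp_le hq ht₀ hscalar
  refine ⟨C * K, mul_pos hC hK, ?_⟩
  filter_upwards [halpha, hsymp] with μ halpha hsymp t v w h
  have hvw : 0 < ‖v‖ * ‖w‖ := mul_pos (norm_pos_iff.2 h.left_ne) (norm_pos_iff.2 h.right_ne)
  refine le_of_mul_le_mul_right ?_ hvw
  calc alpha hq μ v w * (‖v‖ * ‖w‖) ≤ C * ‖symp v w‖ := (halpha t v w h).2
    _ ≤ C * (K * (‖μ - lam₀‖ + |t - t₀|) * (‖v‖ * ‖w‖)) := by gcongr; exact hsymp t v w h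
    _ = C * K * (‖μ - lam₀‖ + |t - t₀|) * (‖v‖ * ‖w‖) := by ring

lemma exists_le_alpha (hq : IntervalIntegrable q volume 0 1) (ht₀ : Real.sin t₀ = 0)
    (ho : algMult q t₀ lam₀ = 2)
    (hscalar : ∀ v, monodromy hq lam₀ v = Complex.exp (Complex.I * t₀) • v) :
    ∃ κ > 0, ∀ᶠ μ in 𝓝 lam₀, ∀ t v w, IsFloquetPair hq t μ v w → κ ≤ alpha hq μ v w := by
  obtain ⟨c, hc, C, -, halpha⟩ := exists_alpha_bounds hq ht₀ ho
  obtain ⟨K, hK, hsymp⟩ := exists_norm_mul_norm_le_symp hq ht₀ ho hscalar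
  refine ⟨c / K, div_pos hc hK, ?_⟩
  filter_upwards [halpha, hsymp] with μ halpha hsymp t v w h
  have hvw : 0 < ‖v‖ * ‖w‖ := mul_pos (norm_pos_iff.2 h.left_ne) (norm_pos_iff.2 h.right_ne)
  refine le_of_mul_le_mul_right ?_ hvw
  calc c / K * (‖v‖ * ‖w‖) ≤ c / K * (K * ‖symp v w‖) :=
        mul_le_mul_of_nonneg_left (hsymp t v w h) (div_pos hc hK).le
    _ = c * ‖symp v w‖ := by field_simp
    _ ≤ alpha hq μ v w * (‖v‖ * ‖w‖) := (halpha t v w h).1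

lemma eventually_exists_isFloquetPair (hq : IntervalIntegrable q volume 0 1)
    (ht₀ : Real.sin t₀ = 0) (ho : algMult q t₀ lam₀ = 2) :
    ∀ᶠ μ in 𝓝 lam₀, ∀ t, IsSimpleEigenvalue q t μ → ∃ v w, IsFloquetPair hq t μ v w := by
  obtain ⟨K, -, hsin⟩ := exists_abs_sin_bounds hq ht₀ ho
  filter_upwards [hsin] with μ hμ t hsimple
  obtain ⟨h, hd⟩ := (isSimpleEigenvalue_iff hq).1 hsimple
  refine exists_isFloquetPair hq h fun hst => ?_
  have hle := (hμ t h).2.1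
  rw [hst, abs_zero, mul_zero] at hle
  exact hd (norm_le_zero_iff.1 hle)

lemma exists_singular_branch (hq : IntervalIntegrable q volume 0 1) (ht₀ : Real.sin t₀ = 0)
    (ho : algMult q t₀ lam₀ = 2)
    (hscalar : ¬ ∀ v, monodromy hq lam₀ v = Complex.exp (Complex.I * t₀) • v) :
    ∃ μ : ℝ → ℂ, ∃ K > 0, ∃ δ > 0, ContinuousOn μ (puncturedInterval t₀ δ) ∧
      Tendsto μ (𝓝[≠] t₀) (𝓝 lam₀) ∧ ∀ t ∈ puncturedInterval t₀ δ,
        IsSimpleEigenvalue q t (μ t) ∧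
          ∃ v w, IsFloquetPair hq t (μ t) v w ∧ alpha hq (μ t) v w ≤ K * |t - t₀| := by
  obtain ⟨μ, B, hB, hbranch⟩ := exists_branch hq ht₀ ho
  obtain ⟨K, hK, halpha⟩ := exists_alpha_le hq ht₀ ho hscalar
  obtain ⟨A, -, hsin⟩ := exists_abs_sin_bounds hq ht₀ ho
  have htend : Tendsto μ (𝓝 t₀) (𝓝 lam₀) := by
    refine tendsto_iff_norm_sub_tendsto_zero.2 (squeeze_zero' (g := fun t => B * |t - t₀|)
      (Eventually.of_forall fun t => norm_nonneg _) (hbranch.mono fun t ht => ht.2.2) ?_)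
    exact (by fun_prop : Continuous fun t => B * |t - t₀|).tendsto' _ _ (by simp)
  have hcos : Real.cos t₀ ≠ 0 := fun h => by
    simpa [ht₀, h] using Real.sin_sq_add_cos_sq t₀
  have hsin_ne : ∀ᶠ t in 𝓝[≠] t₀, Real.sin t ≠ 0 := (Real.hasDerivAt_sin t₀).eventually_ne hcos
  obtain ⟨δ, hδ, H⟩ := exists_puncturedInterval_subset (hsin_ne.and
    (((hbranch.and (htend.eventually (halpha.and hsin)))).filter_mono nhdsWithin_le_nhds))
  refine ⟨μ, K * (B + 1), by positivity, δ, hδ,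
    fun t ht => (H t ht).2.1.1.continuousWithinAt, htend.mono_left nhdsWithin_le_nhds,
    fun t ht => ?_⟩
  obtain ⟨hst, ⟨-, hroot, hle⟩, halpha, hsin⟩ := H t ht
  refine ⟨(isSimpleEigenvalue_iff hq).2 ⟨hroot, fun hd => hst ?_⟩, ?_⟩
  · simpa [hd] using (hsin t hroot).2.2
  · obtain ⟨v, w, h⟩ := exists_isFloquetPair hq hroot hst
    refine ⟨v, w, h, (halpha t v w h).trans ?_⟩
    rw [mul_assoc, add_mul, one_mul]
    gcongr

lemma exists_regular_neighbourhood (hq : IntervalIntegrable q volume 0 1)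
    (ht₀ : Real.sin t₀ = 0) (ho : algMult q t₀ lam₀ = 2)
    (hscalar : ∀ v, monodromy hq lam₀ v = Complex.exp (Complex.I * t₀) • v) :
    ∃ κ > 0, ∀ᶠ μ in 𝓝 lam₀, ∀ t, IsSimpleEigenvalue q t μ →
      ∃ v w, IsFloquetPair hq t μ v w ∧ κ ≤ alpha hq μ v w := by
  obtain ⟨κ, hκ, halpha⟩ := exists_le_alpha hq ht₀ ho hscalar
  refine ⟨κ, hκ, ?_⟩
  filter_upwards [halpha, eventually_exists_isFloquetPair hq ht₀ ho] with μ halpha hpair t hs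
  obtain ⟨v, w, h⟩ := hpair t hs
  exact ⟨v, w, h, halpha t v w h⟩

end DoublePoint

section Singularities

variable {q : ℝ → ℂ} {t₀ : ℝ} {lam₀ : ℂ}

lemma isEigenvalue_of_algMult_eq_two (hq : IntervalIntegrable q volume 0 1)
    (ho : algMult q t₀ lam₀ = 2) : IsEigenvalue q t₀ lam₀ :=
  (isEigenvalue_iff hq t₀ lam₀).2 ((algMult_ne_zero_iff hq).1 (ho.trans_ne two_ne_zero))

lemma sin_eq_zero_of_eq_zero_or_pi (ht₀ : t₀ = 0 ∨ t₀ = Real.pi) : Real.sin t₀ = 0 := by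
  rcases ht₀ with rfl | rfl
  · exact Real.sin_zero
  · exact Real.sin_pi

lemma isSpectralSingularity_of_not_scalar (hq : IntervalIntegrable q volume 0 1)
    (ht₀ : t₀ = 0 ∨ t₀ = Real.pi) (ho : algMult q t₀ lam₀ = 2)
    (hscalar : ¬ ∀ v, monodromy hq lam₀ v = Complex.exp (Complex.I * t₀) • v) :
    IsSpectralSingularity q lam₀ := by
  obtain ⟨μ, K, -, δ, hδ, -, htend, H⟩ :=
    exists_singular_branch hq (sin_eq_zero_of_eq_zero_or_pi ht₀) ho hscalar
  have ht₀' : t₀ ∈ Ico (0 : ℝ) (2 * Real.pi) := by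
    rcases ht₀ with rfl | rfl <;> constructor <;> linarith [Real.pi_pos]
  refine ⟨⟨t₀, ht₀', isEigenvalue_of_algMult_eq_two hq ho⟩, fun ε hε M => ?_⟩
  have hright : 𝓝[>] t₀ ≤ 𝓝[≠] t₀ := nhdsWithin_mono _ fun t (ht : t₀ < t) => ht.ne'
  have hball : ∀ᶠ t in 𝓝[>] t₀, μ t ∈ Metric.ball lam₀ ε :=
    hright (htend.eventually (Metric.ball_mem_nhds _ hε))
  have hmem : ∀ᶠ t in 𝓝[>] t₀, t ∈ puncturedInterval t₀ δ :=
    hright (puncturedInterval_mem_nhdsNE t₀ hδ)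
  have hsmall : ∀ᶠ t in 𝓝[>] t₀, K * |t - t₀| < (|M| + 1)⁻¹ := by
    have hcont : Continuous fun t => K * |t - t₀| := by fun_prop
    refine nhdsWithin_le_nhds ((hcont.tendsto' t₀ 0 (by simp)).eventually_lt_const ?_)
    positivity
  obtain ⟨t, hμ, ht, hlt, hIoo⟩ :=
    (hball.and (hmem.and (hsmall.and (Ioo_mem_nhdsGT ht₀'.2)))).exists
  obtain ⟨hsimple, v, w, hp, hle⟩ := H t ht
  have hd := ((isSimpleEigenvalue_iff hq).1 hsimple).2
  have hP := (isSpectralProjection_iff hp (hp.pairing_ne_zero hd)).2 rfl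
  refine ⟨t, ⟨ht₀'.1.trans hIoo.1.le, hIoo.2⟩, μ t, hμ, hsimple, _, hP, ?_⟩
  rw [norm_spectralProjection hp (hp.pairing_ne_zero hd) hP]
  calc M < |M| + 1 := (le_abs_self M).trans_lt (lt_add_one _)
    _ < (alpha hq (μ t) v w)⁻¹ :=
      (lt_inv_comm₀ (by positivity) (hp.alpha_pos hd)).2 (hle.trans_lt hlt)

lemma not_isSpectralSingularity_of_scalar (hq : IntervalIntegrable q volume 0 1)
    (ht₀ : Real.sin t₀ = 0) (ho : algMult q t₀ lam₀ = 2)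
    (hscalar : ∀ v, monodromy hq lam₀ v = Complex.exp (Complex.I * t₀) • v) :
    ¬ IsSpectralSingularity q lam₀ := by
  rintro ⟨-, H⟩
  obtain ⟨κ, hκ, hev⟩ := exists_regular_neighbourhood hq ht₀ ho hscalar
  obtain ⟨ε, hε, hball⟩ := Metric.eventually_nhds_iff_ball.1 hev
  obtain ⟨t, -, μ, hμ, hsimple, P, hP, hlt⟩ := H ε hε κ⁻¹
  obtain ⟨v, w, hp, hle⟩ := hball μ hμ t hsimple
  have hd := ((isSimpleEigenvalue_iff hq).1 hsimple).2
  rw [norm_spectralProjection hp (hp.pairing_ne_zero hd) hP] at hlt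
  exact absurd hlt (not_lt.2 (inv_anti₀ hκ hle))

lemma isSpectralSingularity_iff (hq : IntervalIntegrable q volume 0 1)
    (ht₀ : t₀ = 0 ∨ t₀ = Real.pi)
    (ho : algMult q t₀ lam₀ = 2) : IsSpectralSingularity q lam₀ ↔ geomMult q t₀ lam₀ = 1 := by
  rw [geomMult_eq_one_iff hq (isEigenvalue_of_algMult_eq_two hq ho)]
  exact ⟨fun h hscalar => not_isSpectralSingularity_of_scalar hq
    (sin_eq_zero_of_eq_zero_or_pi ht₀) ho hscalar h,
    isSpectralSingularity_of_not_scalar hq ht₀ ho⟩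

lemma lintegral_enorm_sub_inv_eq_top (t₀ : ℝ) {δ : ℝ} (hδ : 0 < δ) :
    ∫⁻ t in Ioo t₀ (t₀ + δ), ‖(t - t₀)⁻¹‖ₑ = ⊤ := by
  have hnot : ¬ IntervalIntegrable (fun t : ℝ => (t - t₀)⁻¹) volume t₀ (t₀ + δ) := by
    rw [intervalIntegrable_sub_inv_iff]
    rintro (h | h)
    · exact (lt_add_of_pos_right t₀ hδ).ne h
    · exact h left_mem_uIcc
  rw [intervalIntegrable_iff_integrableOn_Ioo_of_le (by linarith)] at hnot
  have hmeas : Measurable fun t : ℝ => (t - t₀)⁻¹ := by fun_prop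
  by_contra hne
  exact hnot ⟨hmeas.aestronglyMeasurable, lt_top_iff_ne_top.2 hne⟩

lemma lintegral_inv_enorm_eq_top {E : Type*} [SeminormedAddCommGroup E] {f : ℝ → E}
    {t₀ K δ : ℝ} (hδ : 0 < δ) (hf : ∀ t ∈ Ioo t₀ (t₀ + δ), ‖f t‖ ≤ K * |t - t₀|) :
    ∫⁻ t in Ioo t₀ (t₀ + δ), ‖f t‖ₑ⁻¹ = ⊤ := by
  have hmeas : Measurable fun t : ℝ => ‖(t - t₀)⁻¹‖ₑ := by fun_prop
  rw [← top_le_iff]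
  calc ⊤ = (ENNReal.ofReal K)⁻¹ * ∫⁻ t in Ioo t₀ (t₀ + δ), ‖(t - t₀)⁻¹‖ₑ := by
        rw [lintegral_enorm_sub_inv_eq_top t₀ hδ,
          ENNReal.mul_top (ENNReal.inv_ne_zero.2 ENNReal.ofReal_ne_top)]
    _ = ∫⁻ t in Ioo t₀ (t₀ + δ), (ENNReal.ofReal K)⁻¹ * ‖(t - t₀)⁻¹‖ₑ :=
        (lintegral_const_mul _ hmeas).symm
    _ ≤ ∫⁻ t in Ioo t₀ (t₀ + δ), ‖f t‖ₑ⁻¹ := by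
        refine setLIntegral_mono' measurableSet_Ioo fun t ht => ?_
        rw [enorm_inv (sub_ne_zero.2 ht.1.ne'), ← ENNReal.mul_inv (Or.inr enorm_ne_top)
          (Or.inl ENNReal.ofReal_ne_top), ENNReal.inv_le_inv, ← ofReal_norm, ← ofReal_norm,
          ← ENNReal.ofReal_mul' (norm_nonneg _)]
        exact ENNReal.ofReal_le_ofReal (hf t ht)

lemma isESS_of_not_scalar (hq : IntervalIntegrable q volume 0 1)
    (ht₀ : t₀ = 0 ∨ t₀ = Real.pi) (ho : algMult q t₀ lam₀ = 2)
    (hscalar : ¬ ∀ v, monodromy hq lam₀ v = Complex.exp (Complex.I * t₀) • v) :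
    IsESS q lam₀ := by
  obtain ⟨μ, K, -, δ, hδ, hcont, htend, H⟩ :=
    exists_singular_branch hq (sin_eq_zero_of_eq_zero_or_pi ht₀) ho hscalar
  have ht₀' : t₀ ∈ Ioc (-Real.pi) Real.pi := by
    rcases ht₀ with rfl | rfl <;> constructor <;> linarith [Real.pi_pos]
  have hex : ∀ t ∈ puncturedInterval t₀ δ, ∃ Ψ Ψs : L2,
      (Ψ ∈ eigenspace (graph q t) (μ t) ∧ ‖Ψ‖ = 1 ∧
        Ψs ∈ eigenspace (graph q t).adjoint (starRingEnd ℂ (μ t)) ∧ ‖Ψs‖ = 1) ∧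
      ‖inner ℂ Ψs Ψ‖ ≤ K * |t - t₀| := fun t ht => by
    obtain ⟨-, v, w, hp, hle⟩ := H t ht
    obtain ⟨Ψ, Ψs, h⟩ := hp.exists_normalized
    exact ⟨Ψ, Ψs, h, (norm_inner_eq_alpha hp h.1 h.2.1 h.2.2.1 h.2.2.2).trans_le hle⟩
  choose! Ψ Ψs hΨ using hex
  refine ⟨t₀, ht₀', isEigenvalue_of_algMult_eq_two hq ho, δ, hδ, μ, Ψ, Ψs, hcont,
    fun t ht => ⟨(H t ht).1, (hΨ t ht).1⟩, htend, fun δ' hδ' => ?_⟩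
  have htop := lintegral_inv_enorm_eq_top (f := fun t => inner ℂ (Ψs t) (Ψ t)) hδ'.1
    fun t ht => (hΨ t (puncturedInterval_mono t₀ hδ'.2 (Or.inr ht))).2
  exact top_le_iff.1 (htop ▸ lintegral_mono_set subset_union_right)

lemma not_isESS_of_scalar (hq : IntervalIntegrable q volume 0 1) (ht₀ : Real.sin t₀ = 0)
    (ho : algMult q t₀ lam₀ = 2)
    (hscalar : ∀ v, monodromy hq lam₀ v = Complex.exp (Complex.I * t₀) • v) :
    ¬ IsESS q lam₀ := by
  rintro ⟨s₀, -, -, δ, hδ, μ, Ψ, Ψs, -, H, htend, hint⟩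
  obtain ⟨κ, hκ, hev⟩ := exists_regular_neighbourhood hq ht₀ ho hscalar
  obtain ⟨η, hη, hgood⟩ := exists_puncturedInterval_subset (htend.eventually hev)
  have hle : ∫⁻ t in puncturedInterval s₀ (min η δ), ‖inner ℂ (Ψs t) (Ψ t)‖ₑ⁻¹ ≤
      ∫⁻ _ in puncturedInterval s₀ (min η δ), (ENNReal.ofReal κ)⁻¹ := by
    refine setLIntegral_mono' (measurableSet_Ioo.union measurableSet_Ioo) fun t ht => ?_
    obtain ⟨hsimple, hΨ, hΨ_norm, hΨs, hΨs_norm⟩ :=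
      H t (puncturedInterval_mono s₀ (min_le_right _ _) ht)
    obtain ⟨v, w, hp, hκ_le⟩ :=
      hgood t (puncturedInterval_mono s₀ (min_le_left _ _) ht) t hsimple
    rw [← norm_inner_eq_alpha hp hΨ hΨ_norm hΨs hΨs_norm] at hκ_le
    rw [ENNReal.inv_le_inv, ← ofReal_norm]
    exact ENNReal.ofReal_le_ofReal hκ_le
  have hfin : volume (puncturedInterval s₀ (min η δ)) ≠ ⊤ :=
    (measure_union_lt_top measure_Ioo_lt_top measure_Ioo_lt_top).ne
  rw [hint _ ⟨lt_min hη hδ, min_le_right _ _⟩, setLIntegral_const, top_le_iff] at hle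
  exact ENNReal.mul_ne_top (ENNReal.inv_ne_top.2 (ENNReal.ofReal_pos.2 hκ).ne') hfin hle

lemma isESS_iff (hq : IntervalIntegrable q volume 0 1) (ht₀ : t₀ = 0 ∨ t₀ = Real.pi)
    (ho : algMult q t₀ lam₀ = 2) : IsESS q lam₀ ↔ geomMult q t₀ lam₀ = 1 := by
  rw [geomMult_eq_one_iff hq (isEigenvalue_of_algMult_eq_two hq ho)]
  exact ⟨fun h hscalar => not_isESS_of_scalar hq (sin_eq_zero_of_eq_zero_or_pi ht₀) ho hscalar h,
    isESS_of_not_scalar hq ht₀ ho⟩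

end Singularities

section Quasimomentum

variable {q : ℝ → ℂ} {t t' : ℝ}

lemma graph_congr (h : Complex.exp (Complex.I * t) = Complex.exp (Complex.I * t')) :
    graph q t = graph q t' := by
  ext p
  change InGraph q t p.1 p.2 ↔ InGraph q t' p.1 p.2
  rw [InGraph, InGraph, h]

lemma exists_eq_zero_or_pi (ht : Real.sin t = 0) : ∃ t', (t' = 0 ∨ t' = Real.pi) ∧
    Complex.exp (Complex.I * t) = Complex.exp (Complex.I * t') ∧ Real.cos t = Real.cos t' := by
  have hexp : ∀ s : ℝ, Real.sin s = 0 → Complex.exp (Complex.I * s) = (Real.cos s : ℂ) :=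
    fun s hs => by
      rw [mul_comm, Complex.exp_mul_I, ← Complex.ofReal_cos, ← Complex.ofReal_sin, hs,
        Complex.ofReal_zero, zero_mul, add_zero]
  obtain ⟨t', ht', hcos⟩ : ∃ t', (t' = 0 ∨ t' = Real.pi) ∧ Real.cos t = Real.cos t' := by
    rcases Real.sin_eq_zero_iff_cos_eq.1 ht with h | h
    · exact ⟨0, Or.inl rfl, h.trans Real.cos_zero.symm⟩
    · exact ⟨Real.pi, Or.inr rfl, h.trans Real.cos_pi.symm⟩
  refine ⟨t', ht', ?_, hcos⟩
  rw [hexp t ht, hexp t' (sin_eq_zero_of_eq_zero_or_pi ht'), hcos]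

lemma exists_not_isMultipleEigenvalue (hq : IntervalIntegrable q volume 0 1)
    (ht : Real.sin t ≠ 0) : ∃ R : ℝ, ∀ μ, R < ‖μ‖ → ¬ IsMultipleEigenvalue q t μ := by
  have hc : (2 * (Real.cos t : ℂ)) ^ 2 ≠ 4 := fun h => by
    have hreal : (2 * Real.cos t) ^ 2 = 4 := by exact_mod_cast h
    exact ht (pow_eq_zero_iff two_ne_zero |>.1 (by linarith [Real.sin_sq_add_cos_sq t]))
  obtain ⟨R, hR⟩ := exists_deriv_discriminant_ne_zero hq hc
  exact ⟨R, fun μ hμ h => hR μ hμ ((isEigenvalue_iff hq t μ).1 h.1)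
    (h.deriv_discriminant_eq_zero hq)⟩

lemma exists_isSpectralSingularity_iff_and_isESS_iff (hq : IntervalIntegrable q volume 0 1)
    (t : ℝ) : ∃ R : ℝ, ∀ μ, R < ‖μ‖ → IsMultipleEigenvalue q t μ →
      (IsSpectralSingularity q μ ↔ geomMult q t μ = 1) ∧ (IsESS q μ ↔ geomMult q t μ = 1) := by
  by_cases ht : Real.sin t = 0
  · obtain ⟨t', ht', hexp, hcos⟩ := exists_eq_zero_or_pi ht
    obtain ⟨R, hR⟩ := exists_algMult_eq_two hq
    refine ⟨R, fun μ hμ h => ?_⟩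
    have ho := hR t μ hμ h
    rw [algMult, hcos] at ho
    rw [geomMult, graph_congr hexp]
    exact ⟨isSpectralSingularity_iff hq ht' ho, isESS_iff hq ht' ho⟩
  · obtain ⟨R, hR⟩ := exists_not_isMultipleEigenvalue hq ht
    exact ⟨R, fun μ hμ h => absurd h (hR μ hμ)⟩

end Quasimomentum

end Hill

theorem theorem15_general (q : ℝ → ℂ) (hq : IntervalIntegrable q MeasureTheory.volume 0 1)
    (t₀ : ℝ) :
    (∃ lam : ℤ → ℂ, Hill.IsNumbering q t₀ lam) ∧
    ∀ lam : ℤ → ℂ, Hill.IsNumbering q t₀ lam →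
      ∃ N : ℕ, ∀ k : ℤ, (N : ℤ) < |k| → Hill.IsMultipleEigenvalue q t₀ (lam k) →
        (Hill.IsSpectralSingularity q (lam k) ↔ Hill.geomMult q t₀ (lam k) = 1) ∧
        (Hill.IsESS q (lam k) ↔ Hill.geomMult q t₀ (lam k) = 1) := by
  refine ⟨Hill.exists_isNumbering hq t₀, fun lam hlam => ?_⟩
  obtain ⟨R, hR⟩ := Hill.exists_isSpectralSingularity_iff_and_isESS_iff hq t₀
  obtain ⟨N, hN⟩ := hlam.exists_lt_norm hq R
  exact ⟨N, fun k hk => hR (lam k) (hN k hk)⟩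

theorem theorem15 (q : ℝ → ℂ) (hper : Function.Periodic q 1)
    (hint : IntervalIntegrable q MeasureTheory.volume 0 1)
    (t₀ : ℝ) (ht₀ : t₀ = 0 ∨ t₀ = Real.pi) :
    (∃ lam : ℤ → ℂ, Hill.IsNumbering q t₀ lam) ∧
    ∀ lam : ℤ → ℂ, Hill.IsNumbering q t₀ lam →
      ∃ N : ℕ, ∀ k : ℤ, (N : ℤ) < |k| → Hill.IsMultipleEigenvalue q t₀ (lam k) →
        (Hill.IsSpectralSingularity q (lam k) ↔ Hill.geomMult q t₀ (lam k) = 1) ∧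
        (Hill.IsESS q (lam k) ↔ Hill.geomMult q t₀ (lam k) = 1) :=
  theorem15_general q hint t₀
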